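/- **Morawetz inequality for the Klein–Gordon–Hartree equation.** Let $n\ge 3$ and let $p_1,p_2$ satisfy $\max(1,\frac n4)\le p_2\le p_1\le\infty$. Let $V$ be a real radial function on $\mathbb R^n$ with $V\in L^{p_1}(\mathbb R^n)+L^{p_2}(\mathbb R^n)$ (no sign condition). Let $u:\mathbb R\times\mathbb R^n\to\mathbb C$ be a global finite energy solution of $$\ddot u-\Delta u+u+(V*|u|^2)\,u=0 ,$$ that is, $u\in C(\mathbb R;H^1)\cap C^1(\mathbb R;L^2)\cap L^3_{\rm loc}(\mathbb R;L^{r})$ with $\frac1r=\frac12-\frac1{3p_2}$, and the equation holds in the sense of distributions. (The $L^3_{\rm loc}L^r$ condition follows from $u\in C(\mathbb R;H^1)$ if $p_2\ge \frac n3$.) Then for all real $s\le t$ the function $|u|^2\,\frac{x}{|x|}\cdot(V*\nabla|u|^2)$ is absolutely integrable over $[s,t]\times\mathbb R^n$ (as an iterated integral in $x$, then in $\tau$), and $$-\int_s^t\int_{\mathbb R^n}|u(\tau,x)|^2\,\frac{x}{|x|}\cdot\bigl(V*\nabla|u|^2\bigr)(\tau,x)\,dx\,d\tau\;\le\;4\,\|\dot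 u\|_{L^\infty L^2}\,\|\nabla u\|_{L^\infty L^2},$$ where $*$ is convolution in $x$, $\nabla$ is the weak spatial gradient, and the norms on the right are those of $L^\infty([s,t];L^2(\mathbb R^n))$; a fortiori the inequality holds with the norms of $L^\infty(\mathbb R;L^2(\mathbb R^n))$. -/

import Mathlib

open MeasureTheory Set
open scoped ENNReal ContDiff Convolution

noncomputable section

/-- Hypothesis on the potential: `V` is a real radial function on `ℝⁿ` in `L^{p₁} + L^{p₂}`, where
`max (1, n/4) ≤ p₂ ≤ p₁ ≤ ∞`. -/
structure IsHartreePotential (n : ℕ) (p₁ p₂ : ℝ≥0∞) (V : EuclideanSpace ℝ (Fin n) → ℝ) :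
    Prop where
  max_le : max 1 ((n : ℝ≥0∞) / 4) ≤ p₂
  le : p₂ ≤ p₁
  radial : ∃ v : ℝ → ℝ, ∀ᵐ x, V x = v ‖x‖
  decomp : ∃ V₁ V₂ : EuclideanSpace ℝ (Fin n) → ℝ,
    MemLp V₁ p₁ volume ∧ MemLp V₂ p₂ volume ∧ ∀ᵐ x, V x = V₁ x + V₂ x

/-- The partial derivative `∂ᵢ φ` of a (smooth) function on `ℝⁿ`. -/
def partialDeriv {n : ℕ} (i : Fin n) (φ : EuclideanSpace ℝ (Fin n) → ℝ)
    (x : EuclideanSpace ℝ (Fin n)) : ℝ :=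
  fderiv ℝ φ x (EuclideanSpace.single i 1)

/-- `G` is the weak (distributional) gradient of the locally integrable function `f` on `ℝⁿ`:
`∫ (∂ᵢ φ) f = - ∫ φ Gᵢ` for all real test functions `φ ∈ C_c^∞(ℝⁿ)` and all `i`. -/
structure IsWeakGradient {n : ℕ} {𝕜 : Type*} [RCLike 𝕜] (f : EuclideanSpace ℝ (Fin n) → 𝕜)
    (G : EuclideanSpace ℝ (Fin n) → EuclideanSpace 𝕜 (Fin n)) : Prop where
  locallyIntegrable : LocallyIntegrable f volume
  locallyIntegrable_grad : LocallyIntegrable G volume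
  integral_eq : ∀ φ : EuclideanSpace ℝ (Fin n) → ℝ, ContDiff ℝ ∞ φ → HasCompactSupport φ →
    ∀ i : Fin n, ∫ x, partialDeriv i φ x • f x = - ∫ x, φ x • G x i

open Classical in
/-- The weak gradient of a function on `ℝⁿ` (determined up to a null set when it exists, and `0`
by convention when it does not exist). -/
def weakGradient {n : ℕ} {𝕜 : Type*} [RCLike 𝕜] (f : EuclideanSpace ℝ (Fin n) → 𝕜) :
    EuclideanSpace ℝ (Fin n) → EuclideanSpace 𝕜 (Fin n) :=
  if h : ∃ G, IsWeakGradient f G then h.choose else 0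

/-- The convolution `(V * F)(x) = ∫ V(y) F(x - y) dy` of a real function with a scalar or vector
valued function on `ℝⁿ`. -/
def spatialConv {n : ℕ} {F : Type*} [NormedAddCommGroup F] [NormedSpace ℝ F]
    (V : EuclideanSpace ℝ (Fin n) → ℝ) (f : EuclideanSpace ℝ (Fin n) → F) :
    EuclideanSpace ℝ (Fin n) → F :=
  V ⋆[ContinuousLinearMap.lsmul ℝ ℝ, volume] f

/-- The Hartree nonlinearity `f(w) = (V * |w|²) w`. -/
def hartree {n : ℕ} (V : EuclideanSpace ℝ (Fin n) → ℝ) (w : EuclideanSpace ℝ (Fin n) → ℂ)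
    (x : EuclideanSpace ℝ (Fin n)) : ℂ :=
  spatialConv V (fun y => ‖w y‖ ^ 2) x • w x

/-- `u` is a global finite energy solution of `ü - Δu + u + (V * |u|²) u = 0` on `ℝ × ℝⁿ`, with
time derivative `u'` and spatial gradient `g`, where `V ∈ L^{p₁} + L^{p₂}` with `p₂ ≤ p₁`:
`u ∈ C(ℝ; H¹) ∩ C¹(ℝ; L²) ∩ L³_loc(ℝ; L^r)` with `1/r = 1/2 - 1/(3 p₂)`, and the equation holds in
the sense of distributions.

By Hölder and Young, the `L³_loc(ℝ; L^r)` regularity is what makes the nonlinear term an element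
of `L¹_loc(ℝ; L²)`; it follows from `u ∈ C(ℝ; H¹)` when `p₂ ≥ n/3`. -/
structure IsFiniteEnergySolution {n : ℕ} (p₂ : ℝ≥0∞) (V : EuclideanSpace ℝ (Fin n) → ℝ)
    (u u' : ℝ → Lp ℂ 2 (volume : Measure (EuclideanSpace ℝ (Fin n))))
    (g : ℝ → Lp (EuclideanSpace ℂ (Fin n)) 2 (volume : Measure (EuclideanSpace ℝ (Fin n)))) :
    Prop where
  isWeakGradient : ∀ t, IsWeakGradient (u t) (g t)
  continuous_grad : Continuous g
  hasDerivAt : ∀ t, HasDerivAt u (u' t) t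
  continuous_deriv : Continuous u'
  strichartz : ∀ r : ℝ≥0∞, r⁻¹ + (3 * p₂)⁻¹ = 2⁻¹ →
    ∀ a b : ℝ, ∫⁻ t in Icc a b, eLpNorm (u t) r volume ^ 3 < ⊤
  equation : ∀ φ : EuclideanSpace ℝ (Fin n) → ℝ, ContDiff ℝ ∞ φ → HasCompactSupport φ →
    ∀ s t : ℝ, s ≤ t →
      (∫ x, φ x • u' t x) - (∫ x, φ x • u' s x) =
        - ∫ τ in s..t, ((∫ x, ∑ i, partialDeriv i φ x • g τ x i) + (∫ x, φ x • u τ x)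
            + ∫ x, φ x • hartree V (u τ) x)

/-- The density `|w(x)|² (x/|x|) · (V * ∇|w|²)(x)`. -/
def morawetzDensity {n : ℕ} (V : EuclideanSpace ℝ (Fin n) → ℝ)
    (w : EuclideanSpace ℝ (Fin n) → ℂ) (x : EuclideanSpace ℝ (Fin n)) : ℝ :=
  ‖w x‖ ^ 2 * inner ℝ (‖x‖⁻¹ • x) (spatialConv V (weakGradient fun y => ‖w y‖ ^ 2) x)

end

open Filter Topology

noncomputable section

/-! The proof is the Morawetz multiplier argument. Put `h = x / √(|x|² + ε²)`, `d = div h` and `M =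
h·∇ + d/2`. For the real inner product of `L²` the operator `M` is skew-adjoint, so pairing the
equation with `M u` kills the mass term `⟨u, M u⟩`, and in the time derivative of `⟨u', M u⟩` it
kills `⟨u', M u'⟩`. The Laplacian contributes `⟨Δu, M u⟩ = -∑ ∫ ∂ⱼhᵢ ⟨∂ⱼu, ∂ᵢu⟩ + ¼ ∫ (Δd) |u|²`,
which is nonpositive because `h` is the gradient of a convex function and `Δd ≤ 0` when `n ≥ 3`.
Hence, with `F = (V * |u|²) u`, the time integral of `⟨F, M u⟩` is at most the sum of `|⟨u', M u⟩|`
over the two endpoints.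

Two facts turn this into the theorem. First, `‖M u‖ ≤ ‖∇u‖`: expanding the square and integrating
the cross term by parts leaves the potential `-d²/4 - h·∇d/2`, which is nonpositive for `n ≥ 3`
(`norm_multL_sq_le`). Secondly, with `ρ = |u|²`, one has `2⟨F, M u⟩ = ∫ (V * ρ) div(ρ h) = -∫ ρ h·(V
* ∇ρ)` (`two_mul_inner_multiplier`, `integral_divProd`). The right side tends to the Morawetz
integral as `ε → 0`. The factor 2 and the two endpoints give the constant 4.

Low regularity is the remaining difficulty. Young and Hölder in trilinear form (`triform_le_rpow`)
give `F ∈ L¹_loc(L²)` and absolute convergence of all integrals containing `V`; this is what the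
exponent `r` is for. Convolving the equation with a mollifier makes it an identity in `L²`
(`convL_equation`), where `M` acts on smooth functions. A product rule for an absolutely continuous
factor against a `C¹` factor then gives the mollified inequality (`integral_inner_moll_le`). The
scale of the mollifier tends to zero first, then `ε`; both limits are dominated, since the bound `‖M
u‖ ≤ ‖∇u‖` depends on neither parameter.

The integration by parts through `V`, which has no derivative, is done on correlations: as functions
of the shift `z`, `∫ div(ρh)(x) ρ(x - z) dx` and `-∫ ρ(x) h(x)·∇ρ(x - z) dx` agree almost everywhere
(`correlation_ae_eq`), so they may be multiplied by `V(z)` and integrated. -/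

/-- The trilinear convolution form `∫∫ V(z) A(x) B(x - z) dz dx` with values in `[0, ∞]`. -/
def triform {n : ℕ} (V A B : EuclideanSpace ℝ (Fin n) → ℝ≥0∞) : ℝ≥0∞ :=
  ∫⁻ x, ∫⁻ z, V z * A x * B (x - z)

/-! ### Young and Hölder inequalities for the trilinear convolution form -/

section Young

variable {n : ℕ} {V A B : EuclideanSpace ℝ (Fin n) → ℝ≥0∞}

theorem AEMeasurable.comp_sub_prod {β : Type*} [MeasurableSpace β]
    {B : EuclideanSpace ℝ (Fin n) → β} (hB : AEMeasurable B) :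
    AEMeasurable (fun p : EuclideanSpace ℝ (Fin n) × EuclideanSpace ℝ (Fin n) => B (p.1 - p.2))
      (volume.prod volume) :=
  hB.comp_quasiMeasurePreserving (quasiMeasurePreserving_sub_of_right_invariant volume volume)

theorem aemeasurable_triform_integrand (hV : AEMeasurable V) (hA : AEMeasurable A)
    (hB : AEMeasurable B) :
    AEMeasurable (fun p : EuclideanSpace ℝ (Fin n) × EuclideanSpace ℝ (Fin n) =>
      V p.2 * A p.1 * B (p.1 - p.2)) (volume.prod volume) :=
  (hV.comp_snd.fun_mul hA.comp_fst).fun_mul hB.comp_sub_prod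

theorem triform_eq_lintegral_prod (hV : AEMeasurable V) (hA : AEMeasurable A)
    (hB : AEMeasurable B) :
    triform V A B = ∫⁻ p : EuclideanSpace ℝ (Fin n) × EuclideanSpace ℝ (Fin n),
      V p.2 * A p.1 * B (p.1 - p.2) ∂(volume.prod volume) := by
  rw [lintegral_prod _ (aemeasurable_triform_integrand hV hA hB)]
  rfl

theorem lintegral_prod_mul_comp_sub (hA : AEMeasurable A) (hB : AEMeasurable B) :
    ∫⁻ p : EuclideanSpace ℝ (Fin n) × EuclideanSpace ℝ (Fin n),
      A p.1 * B (p.1 - p.2) ∂(volume.prod volume) = (∫⁻ x, A x) * ∫⁻ x, B x := by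
  rw [lintegral_prod _ (hA.comp_fst.fun_mul hB.comp_sub_prod)]
  have : ∀ x, ∫⁻ z, A x * B (x - z) = A x * ∫⁻ z, B z := fun x => by
    rw [lintegral_const_mul'', lintegral_sub_left_eq_self (fun z => B z) x]
    exact hB.comp_quasiMeasurePreserving (quasiMeasurePreserving_sub_left volume x)
  simp_rw [this]
  rw [lintegral_mul_const'' _ hA]

theorem lintegral_prod_snd_mul_fst (hV : AEMeasurable V) (hA : AEMeasurable A) :
    ∫⁻ p : EuclideanSpace ℝ (Fin n) × EuclideanSpace ℝ (Fin n),
      V p.2 * A p.1 ∂(volume.prod volume) = (∫⁻ x, V x) * ∫⁻ x, A x := by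
  simp_rw [mul_comm (V _)]
  rw [lintegral_prod_mul hA hV, mul_comm]

theorem lintegral_prod_snd_mul_comp_sub (hV : AEMeasurable V) (hB : AEMeasurable B) :
    ∫⁻ p : EuclideanSpace ℝ (Fin n) × EuclideanSpace ℝ (Fin n),
      V p.2 * B (p.1 - p.2) ∂(volume.prod volume) = (∫⁻ x, V x) * ∫⁻ x, B x := by
  rw [lintegral_prod_symm _ (hV.comp_snd.fun_mul hB.comp_sub_prod)]
  have : ∀ z, ∫⁻ x, V z * B (x - z) = V z * ∫⁻ x, B x := fun z => by
    rw [lintegral_const_mul'', lintegral_sub_right_eq_self (fun x => B x) z]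
    exact hB.comp_quasiMeasurePreserving (measurePreserving_sub_right volume z).quasiMeasurePreserving
  simp_rw [this]
  rw [lintegral_mul_const'' _ hV]

/-- Young's convolution inequality in trilinear form. -/
theorem triform_le_of_young {p a b : ℝ} (hp : 1 ≤ p) (ha : 1 ≤ a) (hb : 1 ≤ b)
    (h : 1 / p + 1 / a + 1 / b = 2) (hV : AEMeasurable V) (hA : AEMeasurable A)
    (hB : AEMeasurable B) :
    triform V A B ≤ (∫⁻ x, V x ^ p) ^ (1 / p) * (∫⁻ x, A x ^ a) ^ (1 / a) *
      (∫⁻ x, B x ^ b) ^ (1 / b) := by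
  have hp0 : 0 < p := by linarith
  have ha0 : 0 < a := by linarith
  have hb0 : 0 < b := by linarith
  have ip : 1 / p ≤ 1 := by rw [div_le_one hp0]; exact hp
  have ia : 1 / a ≤ 1 := by rw [div_le_one ha0]; exact ha
  have ib : 1 / b ≤ 1 := by rw [div_le_one hb0]; exact hb
  have split : ∀ (X : ℝ≥0∞) (c s t : ℝ), 0 < c → 0 ≤ s → 0 ≤ t → s + t = 1 / c →
      (X ^ c) ^ s * (X ^ c) ^ t = X := fun X c s t hc hs ht hst => by
    rw [← ENNReal.rpow_add_of_nonneg _ _ hs ht, hst, ← ENNReal.rpow_mul, mul_one_div_cancel hc.ne',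
      ENNReal.rpow_one]
  have hVp := hV.pow_const p
  have hAa := hA.pow_const a
  have hBb := hB.pow_const b
  -- Write `V A B` as `(AᵃBᵇ)^(1-1/p) (VᵖAᵃ)^(1-1/b) (VᵖBᵇ)^(1-1/a)`. The weights sum to `3 - 2 =
  -- 1`, so Hölder with three factors applies, and the integral of each pair over the product space
  -- factorises after a translation.
  let f : Fin 3 → EuclideanSpace ℝ (Fin n) × EuclideanSpace ℝ (Fin n) → ℝ≥0∞ :=
    ![fun q => A q.1 ^ a * B (q.1 - q.2) ^ b, fun q => V q.2 ^ p * A q.1 ^ a,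
      fun q => V q.2 ^ p * B (q.1 - q.2) ^ b]
  let w : Fin 3 → ℝ := ![1 - 1 / p, 1 - 1 / b, 1 - 1 / a]
  have key := ENNReal.lintegral_prod_norm_pow_le (μ := volume.prod volume) Finset.univ
    (f := f) (p := w) (by
      intro i _
      fin_cases i
      · exact hAa.comp_fst.fun_mul hBb.comp_sub_prod
      · exact hVp.comp_snd.fun_mul hAa.comp_fst
      · exact hVp.comp_snd.fun_mul hBb.comp_sub_prod)
    (by simp only [Fin.sum_univ_three, w, Matrix.cons_val]; linarith)
    (by
      intro i _
      fin_cases i <;> simp only [w, Matrix.cons_val, Fin.zero_eta, Fin.mk_one, Fin.reduceFinMk] <;>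
        linarith)
  simp only [Fin.prod_univ_three, f, w, Matrix.cons_val] at key
  rw [lintegral_prod_mul_comp_sub hAa hBb, lintegral_prod_snd_mul_fst hVp hAa,
    lintegral_prod_snd_mul_comp_sub hVp hBb] at key
  have h1 : 0 ≤ 1 - 1 / p := by linarith
  have h2 : 0 ≤ 1 - 1 / b := by linarith
  have h3 : 0 ≤ 1 - 1 / a := by linarith
  have arr : ∀ X Y Z : ℝ≥0∞, (Y * Z) ^ (1 - 1 / p) * (X * Y) ^ (1 - 1 / b) *
      (X * Z) ^ (1 - 1 / a) = X ^ (1 / p) * Y ^ (1 / a) * Z ^ (1 / b) := by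
    intro X Y Z
    rw [ENNReal.mul_rpow_of_nonneg _ _ h1, ENNReal.mul_rpow_of_nonneg _ _ h2,
      ENNReal.mul_rpow_of_nonneg _ _ h3]
    calc _ = (X ^ (1 - 1 / b) * X ^ (1 - 1 / a)) * (Y ^ (1 - 1 / p) * Y ^ (1 - 1 / b)) *
          (Z ^ (1 - 1 / p) * Z ^ (1 - 1 / a)) := by ring
      _ = _ := by
        rw [← ENNReal.rpow_add_of_nonneg _ _ h2 h3, ← ENNReal.rpow_add_of_nonneg _ _ h1 h2,
          ← ENNReal.rpow_add_of_nonneg _ _ h1 h3]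
        congr 3 <;> linarith
  rw [arr] at key
  refine le_trans (le_of_eq ?_) key
  rw [triform_eq_lintegral_prod hV hA hB]
  refine lintegral_congr fun q => ?_
  rw [arr, ← ENNReal.rpow_mul, ← ENNReal.rpow_mul, ← ENNReal.rpow_mul,
    mul_one_div_cancel hp0.ne', mul_one_div_cancel ha0.ne', mul_one_div_cancel hb0.ne']
  simp only [ENNReal.rpow_one]

theorem triform_le_of_ae_le {C : ℝ≥0∞} (hC : ∀ᵐ z, V z ≤ C) (hA : AEMeasurable A)
    (hB : AEMeasurable B) :
    triform V A B ≤ C * (∫⁻ x, A x) * ∫⁻ x, B x := by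
  calc triform V A B ≤ ∫⁻ x, ∫⁻ z, C * (A x * B (x - z)) := by
        refine lintegral_mono fun x => lintegral_mono_ae ?_
        filter_upwards [hC] with z hz
        rw [mul_assoc]
        gcongr
    _ = ∫⁻ q : EuclideanSpace ℝ (Fin n) × EuclideanSpace ℝ (Fin n), C * (A q.1 * B (q.1 - q.2))
          ∂(volume.prod volume) := by
        rw [lintegral_prod _ ((hA.comp_fst.fun_mul hB.comp_sub_prod).const_mul C)]
    _ = _ := by
        rw [lintegral_const_mul'' _ (hA.comp_fst.fun_mul hB.comp_sub_prod),
          lintegral_prod_mul_comp_sub hA hB, mul_assoc]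

theorem triform_mono {V' A' B' : EuclideanSpace ℝ (Fin n) → ℝ≥0∞} (hV : ∀ᵐ z, V z ≤ V' z)
    (hA : ∀ x, A x ≤ A' x) (hB : ∀ x, B x ≤ B' x) : triform V A B ≤ triform V' A' B' := by
  refine lintegral_mono fun x => lintegral_mono_ae ?_
  filter_upwards [hV] with z hz
  gcongr
  exacts [hA x, hB _]

theorem triform_add_left {V' : EuclideanSpace ℝ (Fin n) → ℝ≥0∞} (hV : AEMeasurable V)
    (hV' : AEMeasurable V') (hA : AEMeasurable A) (hB : AEMeasurable B) :
    triform (fun z => V z + V' z) A B = triform V A B + triform V' A B := by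
  rw [triform_eq_lintegral_prod hV hA hB, triform_eq_lintegral_prod hV' hA hB,
    triform_eq_lintegral_prod (hV.fun_add hV') hA hB,
    ← lintegral_add_left' (aemeasurable_triform_integrand hV hA hB)]
  simp only [add_mul]

theorem lintegral_rpow_mul_le {f k : EuclideanSpace ℝ (Fin n) → ℝ≥0∞} (hf : AEMeasurable f)
    (hk : AEMeasurable k) {b r : ℝ} (hb : 0 < b) (hr : 0 < r) (h : 1 / b = 1 / r + 1 / 2) :
    (∫⁻ x, (f x * k x) ^ b) ^ (1 / b) ≤
      (∫⁻ x, f x ^ r) ^ (1 / r) * (∫⁻ x, k x ^ (2 : ℝ)) ^ (1 / 2 : ℝ) := by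
  refine ENNReal.lintegral_Lp_mul_le_Lq_mul_Lr hb ?_ h volume hf hk
  rw [← one_div_lt_one_div hr hb, h]
  linarith

/-- The quadrilinear Young–Hölder estimate for `V ∈ L^p`, `f ∈ L^r`, `k ∈ L²` with
`1/r = 1/2 - 1/(3p)`, in its two arrangements. -/
theorem triform_le_rpow {f k : EuclideanSpace ℝ (Fin n) → ℝ≥0∞} (hV : AEMeasurable V)
    (hf : AEMeasurable f) (hk : AEMeasurable k) {p r : ℝ} (hp : 1 ≤ p)
    (hr : 0 < r) (h : 1 / r + 1 / (3 * p) = 1 / 2) :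
    triform V (fun x => f x * k x) (fun x => f x ^ 2) ≤
        (∫⁻ x, V x ^ p) ^ (1 / p) * ((∫⁻ x, f x ^ r) ^ (1 / r)) ^ 3 *
          (∫⁻ x, k x ^ (2 : ℝ)) ^ (1 / 2 : ℝ) ∧
      triform V (fun x => f x ^ 2) (fun x => f x * k x) ≤
        (∫⁻ x, V x ^ p) ^ (1 / p) * ((∫⁻ x, f x ^ r) ^ (1 / r)) ^ 3 *
          (∫⁻ x, k x ^ (2 : ℝ)) ^ (1 / 2 : ℝ) := by
  have hp0 : 0 < p := by linarith
  have e3 : 1 / (3 * p) = 1 / p / 3 := by field_simp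
  have ip : 1 / p ≤ 1 := by rw [div_le_one hp0]; exact hp
  have ip0 : 0 < 1 / p := by positivity
  -- `b` is the Hölder exponent of the product `f k`. Young is applied with exponents `p`, `b`,
  -- `r/2`, whose reciprocals sum to `1/p + 3/r + 1/2`; this equals 2 exactly when `1/r = 1/2 -
  -- 1/(3p)`.
  set b : ℝ := 1 / (1 / r + 1 / 2) with hbdef
  have hb' : 1 / b = 1 / r + 1 / 2 := by rw [hbdef, one_div_one_div]
  have ir0 : 0 < 1 / r := by positivity
  have hb0 : 0 < b := by positivity
  have hb1 : 1 ≤ b := by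
    rw [← one_div_le_one_div hb0 one_pos, hb']; linarith
  have hr2 : 1 ≤ r / 2 := by
    rw [← one_div_le_one_div (by positivity) one_pos]
    have : 1 / (r / 2) = 2 * (1 / r) := by field_simp
    rw [this]; linarith
  have hir2 : 1 / (r / 2) = 2 * (1 / r) := by field_simp
  have hsq : (∫⁻ x, (f x ^ 2) ^ (r / 2)) ^ (1 / (r / 2)) = ((∫⁻ x, f x ^ r) ^ (1 / r)) ^ 2 := by
    have : ∀ x, (f x ^ 2) ^ (r / 2) = f x ^ r := fun x => by
      rw [← ENNReal.rpow_natCast, ← ENNReal.rpow_mul]; congr 1; push_cast; ring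
    simp_rw [this]
    rw [hir2, mul_comm, ENNReal.rpow_mul]
    norm_cast
  have hfk := lintegral_rpow_mul_le hf hk hb0 hr hb'
  constructor
  · refine (triform_le_of_young hp hb1 hr2 (by rw [hb', hir2]; linarith) hV (hf.fun_mul hk)
      (hf.pow_const 2)).trans ?_
    rw [hsq]
    calc _ ≤ (∫⁻ x, V x ^ p) ^ (1 / p) * ((∫⁻ x, f x ^ r) ^ (1 / r) *
          (∫⁻ x, k x ^ (2 : ℝ)) ^ (1 / 2 : ℝ)) * ((∫⁻ x, f x ^ r) ^ (1 / r)) ^ 2 := by gcongr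
      _ = _ := by ring
  · refine (triform_le_of_young hp hr2 hb1 (by rw [hb', hir2]; linarith) hV (hf.pow_const 2)
      (hf.fun_mul hk)).trans ?_
    rw [hsq]
    calc _ ≤ (∫⁻ x, V x ^ p) ^ (1 / p) * ((∫⁻ x, f x ^ r) ^ (1 / r)) ^ 2 *
          ((∫⁻ x, f x ^ r) ^ (1 / r) * (∫⁻ x, k x ^ (2 : ℝ)) ^ (1 / 2 : ℝ)) := by gcongr
      _ = _ := by ring

/-- The case `p = ∞`, `r = 2` of the Young–Hölder estimate. -/
theorem triform_le_of_ae_le_sq {f k : EuclideanSpace ℝ (Fin n) → ℝ≥0∞} {C : ℝ≥0∞}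
    (hC : ∀ᵐ z, V z ≤ C) (hf : AEMeasurable f) (hk : AEMeasurable k) :
    triform V (fun x => f x * k x) (fun x => f x ^ 2) ≤
        C * ((∫⁻ x, f x ^ (2 : ℝ)) ^ (1 / 2 : ℝ)) ^ 3 *
          (∫⁻ x, k x ^ (2 : ℝ)) ^ (1 / 2 : ℝ) ∧
      triform V (fun x => f x ^ 2) (fun x => f x * k x) ≤
        C * ((∫⁻ x, f x ^ (2 : ℝ)) ^ (1 / 2 : ℝ)) ^ 3 *
          (∫⁻ x, k x ^ (2 : ℝ)) ^ (1 / 2 : ℝ) := by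
  have hfk := lintegral_rpow_mul_le hf hk one_pos two_pos (by norm_num)
  simp only [ENNReal.rpow_one, div_one] at hfk
  have hsq : ∫⁻ x, f x ^ 2 = ((∫⁻ x, f x ^ (2 : ℝ)) ^ (1 / 2 : ℝ)) ^ 2 := by
    rw [← ENNReal.rpow_natCast, ← ENNReal.rpow_mul]
    norm_num
  constructor
  · refine (triform_le_of_ae_le hC (hf.fun_mul hk) (hf.pow_const 2)).trans ?_
    rw [hsq]
    calc _ ≤ C * ((∫⁻ x, f x ^ (2 : ℝ)) ^ (1 / 2 : ℝ) * (∫⁻ x, k x ^ (2 : ℝ)) ^ (1 / 2 : ℝ)) *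
          ((∫⁻ x, f x ^ (2 : ℝ)) ^ (1 / 2 : ℝ)) ^ 2 := by gcongr
      _ = _ := by ring
  · refine (triform_le_of_ae_le hC (hf.pow_const 2) (hf.fun_mul hk)).trans ?_
    rw [hsq]
    calc _ ≤ C * ((∫⁻ x, f x ^ (2 : ℝ)) ^ (1 / 2 : ℝ)) ^ 2 *
          ((∫⁻ x, f x ^ (2 : ℝ)) ^ (1 / 2 : ℝ) * (∫⁻ x, k x ^ (2 : ℝ)) ^ (1 / 2 : ℝ)) := by gcongr
      _ = _ := by ring

end Young

/-! ### Trilinear estimates for potentials in `L^{p₁} + L^{p₂}` -/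

section Potential

variable {n : ℕ} {p₁ p₂ : ℝ≥0∞} {V : EuclideanSpace ℝ (Fin n) → ℝ}

theorem IsHartreePotential.one_le (hV : IsHartreePotential n p₁ p₂ V) : 1 ≤ p₂ :=
  (le_max_left _ _).trans hV.max_le

theorem IsHartreePotential.aestronglyMeasurable (hV : IsHartreePotential n p₁ p₂ V) :
    AEStronglyMeasurable V := by
  obtain ⟨V₁, V₂, h₁, h₂, h⟩ := hV.decomp
  exact (h₁.1.add h₂.1).congr (h.mono fun x hx => hx.symm)

/-- The potential splits into a bounded part and a part in `L^{p₂}`. -/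
theorem IsHartreePotential.exists_bounded_add (hV : IsHartreePotential n p₁ p₂ V) :
    ∃ V₁ V₂ : EuclideanSpace ℝ (Fin n) → ℝ, AEStronglyMeasurable V₁ ∧
      (∃ C : ℝ≥0∞, C ≠ ⊤ ∧ ∀ᵐ z, ‖V₁ z‖ₑ ≤ C) ∧ MemLp V₂ p₂ ∧ ∀ᵐ z, V z = V₁ z + V₂ z := by
  obtain ⟨V₁, V₂, h₁, h₂, h⟩ := hV.decomp
  rcases eq_or_ne p₁ ⊤ with rfl | htop
  · refine ⟨V₁, V₂, h₁.1, ⟨eLpNorm V₁ ⊤ volume, h₁.2.ne, ?_⟩, h₂, h⟩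
    simpa only [eLpNorm_exponent_top] using enorm_ae_le_eLpNormEssSup V₁ volume
  · have hp0 : p₁ ≠ 0 := (zero_lt_one.trans_le (hV.one_le.trans hV.le)).ne'
    obtain ⟨W, hW, hVW⟩ := h₁.1
    have hWp : MemLp W p₁ volume := h₁.ae_eq hVW
    -- The set where `|W| ≥ 1` has finite measure, so on it `L^{p₁} ⊆ L^{p₂}` because `p₂ ≤ p₁`; off
    -- it `W` is bounded by 1.
    set S : Set (EuclideanSpace ℝ (Fin n)) := {x | 1 ≤ ‖W x‖ₑ} with hS
    have hSm : MeasurableSet S := measurableSet_le measurable_const hW.measurable.enorm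
    have hSfin : volume S ≠ ⊤ := (hWp.meas_ge_lt_top'_enorm hp0 htop one_ne_zero (by simp)).ne
    refine ⟨Sᶜ.indicator W, fun x => V₂ x + S.indicator W x,
      (hW.indicator hSm.compl).aestronglyMeasurable, ⟨1, ENNReal.one_ne_top, ?_⟩, ?_, ?_⟩
    · refine ae_of_all _ fun x => ?_
      by_cases hx : x ∈ S
      · simp [hx]
      · have : ¬ (1 ≤ ‖W x‖ₑ) := hx
        simpa [hx] using (not_le.1 this).le
    · refine h₂.add (MemLp.mono_exponent_of_measure_support_ne_top (hWp.indicator hSm)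
        (s := S) (fun x hx => by simp [hx]) hSfin hV.le)
    · filter_upwards [h, hVW] with x hx hx'
      have hsum := congrFun (indicator_self_add_compl S W) x
      rw [Pi.add_apply] at hsum
      rw [hx, hx', ← hsum]
      ring

/-- The sum of the cubes of the `L²` and `L^r` norms. -/
def cubeNorm {F : Type*} [NormedAddCommGroup F] (r : ℝ≥0∞)
    (w : EuclideanSpace ℝ (Fin n) → F) : ℝ≥0∞ :=
  eLpNorm w 2 volume ^ 3 + eLpNorm w r volume ^ 3

theorem eLpNorm_two_eq {F : Type*} [NormedAddCommGroup F] (w : EuclideanSpace ℝ (Fin n) → F) :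
    eLpNorm w 2 volume = (∫⁻ x, ‖w x‖ₑ ^ (2 : ℝ)) ^ (1 / 2 : ℝ) := by
  rw [eLpNorm_eq_lintegral_rpow_enorm_toReal two_ne_zero ENNReal.ofNat_ne_top]
  norm_num

/-- The bounded part of `V` is estimated with the exponents `p = ∞`, `r = 2`, the other part with `p
= p₂`; the two norms of `w` are collected in `cubeNorm`. The weight `k` stays free: by duality in
`k` the first estimate bounds the nonlinearity in `L²`, and with `k` comparable to `|∇w|` the
estimates control the densities that contain a derivative. -/
theorem IsHartreePotential.exists_triform_le (hV : IsHartreePotential n p₁ p₂ V) {r : ℝ≥0∞}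
    (hr : r⁻¹ + (3 * p₂)⁻¹ = 2⁻¹) :
    ∃ C : ℝ≥0∞, C ≠ ⊤ ∧ ∀ (w : EuclideanSpace ℝ (Fin n) → ℂ)
      (k : EuclideanSpace ℝ (Fin n) → ℝ≥0∞), AEStronglyMeasurable w → AEMeasurable k →
      triform (fun z => ‖V z‖ₑ) (fun x => ‖w x‖ₑ * k x) (fun x => ‖w x‖ₑ ^ 2) ≤
        C * cubeNorm r w * (∫⁻ x, k x ^ (2 : ℝ)) ^ (1 / 2 : ℝ) ∧
      triform (fun z => ‖V z‖ₑ) (fun x => ‖w x‖ₑ ^ 2) (fun x => ‖w x‖ₑ * k x) ≤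
        C * cubeNorm r w * (∫⁻ x, k x ^ (2 : ℝ)) ^ (1 / 2 : ℝ) := by
  obtain ⟨V₁, V₂, hm₁, ⟨C₁, hC₁, hb₁⟩, h₂, h⟩ := hV.exists_bounded_add
  have hle : ∀ᵐ z, ‖V z‖ₑ ≤ ‖V₁ z‖ₑ + ‖V₂ z‖ₑ := by
    filter_upwards [h] with z hz
    rw [hz]
    exact enorm_add_le _ _
  have hm₂ := h₂.1
  have exists_lp_bound : ∃ C₂ : ℝ≥0∞, C₂ ≠ ⊤ ∧ ∀ f k : EuclideanSpace ℝ (Fin n) → ℝ≥0∞, AEMeasurable f →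
      AEMeasurable k →
      triform (fun z => ‖V₂ z‖ₑ) (fun x => f x * k x) (fun x => f x ^ 2) ≤
        C₂ * eLpNorm f r volume ^ 3 * (∫⁻ x, k x ^ (2 : ℝ)) ^ (1 / 2 : ℝ) ∧
      triform (fun z => ‖V₂ z‖ₑ) (fun x => f x ^ 2) (fun x => f x * k x) ≤
        C₂ * eLpNorm f r volume ^ 3 * (∫⁻ x, k x ^ (2 : ℝ)) ^ (1 / 2 : ℝ) := by
    refine ⟨eLpNorm V₂ p₂ volume, h₂.2.ne, fun f k hf hk => ?_⟩
    rcases eq_or_ne p₂ ⊤ with rfl | htop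
    · have hr2 : r = 2 := by
        rw [← inv_inj, ← hr]; simp
      subst hr2
      have hb : ∀ᵐ z, ‖V₂ z‖ₑ ≤ eLpNorm V₂ ⊤ volume := by
        simpa only [eLpNorm_exponent_top] using enorm_ae_le_eLpNormEssSup V₂ volume
      have e : eLpNorm f 2 volume = (∫⁻ x, f x ^ (2 : ℝ)) ^ (1 / 2 : ℝ) := by
        rw [eLpNorm_eq_lintegral_rpow_enorm_toReal two_ne_zero ENNReal.ofNat_ne_top]
        simp
      rw [e]
      exact triform_le_of_ae_le_sq hb hf hk
    · have hp1 : 1 ≤ p₂ := hV.one_le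
      have hp1' : 1 ≤ p₂.toReal := by
        simpa using ENNReal.toReal_mono htop hp1
      have hp0 : p₂ ≠ 0 := (zero_lt_one.trans_le hp1).ne'
      have h3 : (3 * p₂)⁻¹ ≠ ⊤ := by simp [hp0]
      have hr_inv : r⁻¹ ≠ ⊤ := fun hx => by
        rw [hx, top_add] at hr
        exact ENNReal.inv_ne_top.2 two_ne_zero hr.symm
      have hreal : (r.toReal)⁻¹ + (3 * p₂.toReal)⁻¹ = 2⁻¹ := by
        have := congrArg ENNReal.toReal hr
        rwa [ENNReal.toReal_add hr_inv h3, ENNReal.toReal_inv, ENNReal.toReal_inv,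
          ENNReal.toReal_inv, ENNReal.toReal_mul, ENNReal.toReal_ofNat, ENNReal.toReal_ofNat]
          at this
      have hrpos : 0 < r.toReal := by
        rw [← inv_pos]
        have : (3 * p₂.toReal)⁻¹ ≤ 3⁻¹ := by
          apply inv_anti₀ (by norm_num); linarith
        have h23 : (3 : ℝ)⁻¹ < 2⁻¹ := by norm_num
        linarith
      have hr0 : r ≠ 0 := fun hx => by simp [hx] at hrpos
      have hrt : r ≠ ⊤ := fun hx => by simp [hx] at hrpos
      have e : eLpNorm f r volume = (∫⁻ x, f x ^ r.toReal) ^ (1 / r.toReal) := by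
        rw [eLpNorm_eq_lintegral_rpow_enorm_toReal hr0 hrt]
        simp
      rw [e, eLpNorm_eq_lintegral_rpow_enorm_toReal hp0 htop]
      exact triform_le_rpow hm₂.enorm hf hk hp1' hrpos (by simpa only [one_div] using hreal)
  obtain ⟨C₂, hC₂, hb₂⟩ := exists_lp_bound
  refine ⟨C₁ + C₂, ENNReal.add_ne_top.2 ⟨hC₁, hC₂⟩, fun w k hw hk => ?_⟩
  have a₁ := triform_le_of_ae_le_sq hb₁ hw.enorm hk
  have a₂ := hb₂ _ _ hw.enorm hk
  have hmono : ∀ A B : EuclideanSpace ℝ (Fin n) → ℝ≥0∞, AEMeasurable A → AEMeasurable B →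
      triform (fun z => ‖V z‖ₑ) A B ≤
        triform (fun z => ‖V₁ z‖ₑ) A B + triform (fun z => ‖V₂ z‖ₑ) A B := fun A B hA hB => by
    rw [← triform_add_left hm₁.enorm hm₂.enorm hA hB]
    exact triform_mono hle (fun _ => le_rfl) fun _ => le_rfl
  rw [eLpNorm_enorm] at a₂
  rw [← eLpNorm_two_eq] at a₁
  set K := (∫⁻ x, k x ^ (2 : ℝ)) ^ (1 / 2 : ℝ)
  have fin : C₁ * eLpNorm w 2 volume ^ 3 * K +
      C₂ * eLpNorm w r volume ^ 3 * K ≤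
      (C₁ + C₂) * cubeNorm r w * K := by
    rw [← add_mul, cubeNorm]
    gcongr
    rw [add_mul, mul_add, mul_add]
    exact add_le_add le_self_add le_add_self
  exact ⟨(hmono _ _ (hw.enorm.fun_mul hk) (hw.enorm.pow_const 2)).trans
      ((add_le_add a₁.1 a₂.1).trans fin),
    (hmono _ _ (hw.enorm.pow_const 2) (hw.enorm.fun_mul hk)).trans
      ((add_le_add a₁.2 a₂.2).trans fin)⟩

end Potential

/-! ### Bounded continuous coefficients -/

/-- A continuous bounded real function. -/
def IsBddCont {X : Type*} [TopologicalSpace X] (c : X → ℝ) : Prop :=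
  Continuous c ∧ ∃ C, ∀ x, |c x| ≤ C

namespace IsBddCont

variable {X : Type*} [TopologicalSpace X] {c c' : X → ℝ}

theorem const (a : ℝ) : IsBddCont (fun _ : X => a) := ⟨continuous_const, |a|, fun _ => le_rfl⟩

theorem add (h : IsBddCont c) (h' : IsBddCont c') : IsBddCont (fun x => c x + c' x) := by
  obtain ⟨hc, C, hC⟩ := h
  obtain ⟨hc', C', hC'⟩ := h'
  exact ⟨hc.add hc', C + C', fun x => (abs_add_le _ _).trans (add_le_add (hC x) (hC' x))⟩

theorem mul (h : IsBddCont c) (h' : IsBddCont c') : IsBddCont (fun x => c x * c' x) := by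
  obtain ⟨hc, C, hC⟩ := h
  obtain ⟨hc', C', hC'⟩ := h'
  refine ⟨hc.mul hc', C * C', fun x => ?_⟩
  rw [abs_mul]
  exact mul_le_mul (hC x) (hC' x) (abs_nonneg _) ((abs_nonneg _).trans (hC x))

theorem neg (h : IsBddCont c) : IsBddCont (fun x => -c x) := by
  obtain ⟨hc, C, hC⟩ := h
  exact ⟨hc.neg, C, fun x => by rw [abs_neg]; exact hC x⟩

theorem sub (h : IsBddCont c) (h' : IsBddCont c') : IsBddCont (fun x => c x - c' x) := by
  simpa only [sub_eq_add_neg] using h.add h'.neg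

theorem pow (h : IsBddCont c) (k : ℕ) : IsBddCont (fun x => c x ^ k) := by
  induction k with
  | zero => simpa using const 1
  | succ k ih => simpa only [pow_succ] using ih.mul h

theorem sum {ι : Type*} (s : Finset ι) {c : ι → X → ℝ} (h : ∀ i ∈ s, IsBddCont (c i)) :
    IsBddCont (fun x => ∑ i ∈ s, c i x) := by
  classical
  induction s using Finset.induction_on with
  | empty => simpa using const 0
  | insert a s ha ih =>
    simp only [Finset.sum_insert ha]
    exact (h a (Finset.mem_insert_self a s)).add
      (ih fun i hi => h i (Finset.mem_insert_of_mem hi))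

end IsBddCont

/-! ### Weighted `L²` pairings and integration by parts -/

section WeightedPairing

variable {n : ℕ}

/-- The weighted pairing `∫ c ⟨a, b⟩`. -/
def wpair (c : EuclideanSpace ℝ (Fin n) → ℝ) (a b : EuclideanSpace ℝ (Fin n) → ℂ) : ℝ :=
  ∫ x, c x * inner ℝ (a x) (b x)

theorem wpair_comm (c : EuclideanSpace ℝ (Fin n) → ℝ) (a b : EuclideanSpace ℝ (Fin n) → ℂ) :
    wpair c a b = wpair c b a := by
  simp only [wpair, real_inner_comm]

theorem integrable_inner_of_memLp {a b : EuclideanSpace ℝ (Fin n) → ℂ} (ha : MemLp a 2)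
    (hb : MemLp b 2) : Integrable (fun x => inner ℝ (a x) (b x)) := by
  have := L2.integrable_inner (𝕜 := ℝ) (ha.toLp a) (hb.toLp b)
  refine this.congr ?_
  filter_upwards [ha.coeFn_toLp, hb.coeFn_toLp] with x h1 h2
  rw [h1, h2]

theorem integrable_wpair {c : EuclideanSpace ℝ (Fin n) → ℝ} (hc : IsBddCont c)
    {a b : EuclideanSpace ℝ (Fin n) → ℂ} (ha : MemLp a 2) (hb : MemLp b 2) :
    Integrable (fun x => c x * inner ℝ (a x) (b x)) := by
  obtain ⟨hc, C, hC⟩ := hc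
  exact (integrable_inner_of_memLp ha hb).bdd_mul hc.aestronglyMeasurable
    (ae_of_all _ fun x => by rw [Real.norm_eq_abs]; exact hC x)

theorem wpair_add {c c' : EuclideanSpace ℝ (Fin n) → ℝ} (hc : IsBddCont c) (hc' : IsBddCont c')
    {a b : EuclideanSpace ℝ (Fin n) → ℂ} (ha : MemLp a 2) (hb : MemLp b 2) :
    wpair (fun x => c x + c' x) a b = wpair c a b + wpair c' a b := by
  rw [wpair, wpair, wpair, ← integral_add (integrable_wpair hc ha hb) (integrable_wpair hc' ha hb)]
  simp only [add_mul]

theorem wpair_sum {ι : Type*} (s : Finset ι) {c : ι → EuclideanSpace ℝ (Fin n) → ℝ}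
    (hc : ∀ i ∈ s, IsBddCont (c i))
    {a b : EuclideanSpace ℝ (Fin n) → ℂ} (ha : MemLp a 2) (hb : MemLp b 2) :
    wpair (fun x => ∑ i ∈ s, c i x) a b = ∑ i ∈ s, wpair (c i) a b := by
  simp only [wpair]
  rw [← integral_finsetSum _ fun i hi => integrable_wpair (hc i hi) ha hb]
  simp only [Finset.sum_mul]

theorem wpair_const_mul (r : ℝ) (c : EuclideanSpace ℝ (Fin n) → ℝ)
    (a b : EuclideanSpace ℝ (Fin n) → ℂ) :
    wpair (fun x => r * c x) a b = r * wpair c a b := by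
  simp only [wpair, mul_assoc, integral_const_mul]

theorem wpair_self_nonpos {c : EuclideanSpace ℝ (Fin n) → ℝ} (hc : ∀ x, c x ≤ 0)
    (a : EuclideanSpace ℝ (Fin n) → ℂ) : wpair c a a ≤ 0 := by
  refine integral_nonpos fun x => mul_nonpos_of_nonpos_of_nonneg (hc x) real_inner_self_nonneg

/-- `v` is square integrable with square integrable classical first partial derivatives `dv i`. -/
structure IsC1L2 (v : EuclideanSpace ℝ (Fin n) → ℂ) (dv : Fin n → EuclideanSpace ℝ (Fin n) → ℂ) :
    Prop where
  hasLineDerivAt : ∀ i x, HasLineDerivAt ℝ v (dv i x) x (EuclideanSpace.single i 1)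
  memLp : MemLp v 2
  memLp_deriv : ∀ i, MemLp (dv i) 2

/-- `c` is continuous and bounded, and so is its partial derivative `c'` in direction `i`. -/
structure IsC1Bdd (i : Fin n) (c c' : EuclideanSpace ℝ (Fin n) → ℝ) : Prop where
  hasLineDerivAt : ∀ x, HasLineDerivAt ℝ c (c' x) x (EuclideanSpace.single i 1)
  bdd : IsBddCont c
  bdd_deriv : IsBddCont c'

theorem HasLineDerivAt.inner_real {v w : EuclideanSpace ℝ (Fin n) → ℂ} {v' w' : ℂ}
    {x e : EuclideanSpace ℝ (Fin n)} (hv : HasLineDerivAt ℝ v v' x e)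
    (hw : HasLineDerivAt ℝ w w' x e) :
    HasLineDerivAt ℝ (fun y => inner ℝ (v y) (w y))
      (inner ℝ (v x) w' + inner ℝ v' (w x)) x e := by
  have := HasDerivAt.inner ℝ hv hw
  simpa [HasLineDerivAt] using this

theorem HasLineDerivAt.mul_real {v w : EuclideanSpace ℝ (Fin n) → ℝ} {v' w' : ℝ}
    {x e : EuclideanSpace ℝ (Fin n)} (hv : HasLineDerivAt ℝ v v' x e)
    (hw : HasLineDerivAt ℝ w w' x e) :
    HasLineDerivAt ℝ (fun y => v y * w y) (v' * w x + v x * w') x e := by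
  have := HasDerivAt.mul hv hw
  simp only [zero_smul, add_zero] at this
  exact this

/-- Integration by parts in the weighted pairing. -/
theorem wpair_deriv_left {i : Fin n} {c c' : EuclideanSpace ℝ (Fin n) → ℝ} (hc : IsC1Bdd i c c')
    {v w : EuclideanSpace ℝ (Fin n) → ℂ} {dv dw : Fin n → EuclideanSpace ℝ (Fin n) → ℂ}
    (hv : IsC1L2 v dv) (hw : IsC1L2 w dw) :
    wpair c (dv i) w = - wpair c v (dw i) - wpair c' v w := by
  have i1 := integrable_wpair hc.bdd hv.memLp (hw.memLp_deriv i)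
  have i2 := integrable_wpair hc.bdd (hv.memLp_deriv i) hw.memLp
  have i3 := integrable_wpair hc.bdd_deriv hv.memLp hw.memLp
  have i0 := integrable_wpair hc.bdd hv.memLp hw.memLp
  have key := integral_bilinear_hasLineDerivAt_right_eq_neg_left_of_integrable
    (μ := (volume : Measure (EuclideanSpace ℝ (Fin n))))
    (B := ContinuousLinearMap.mul ℝ ℝ) (f := fun x => inner ℝ (v x) (w x))
    (f' := fun x => inner ℝ (v x) (dw i x) + inner ℝ (dv i x) (w x))
    (g := c) (g' := c') (v := EuclideanSpace.single i 1)
    (by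
      refine (i1.add i2).congr (ae_of_all _ fun x => ?_)
      simp only [Pi.add_apply, ContinuousLinearMap.mul_apply']; ring)
    (i3.congr (ae_of_all _ fun x => by
      simp only [ContinuousLinearMap.mul_apply']; ring))
    (i0.congr (ae_of_all _ fun x => by
      simp only [ContinuousLinearMap.mul_apply']; ring))
    (fun x _ => (hv.hasLineDerivAt i x).inner_real (hw.hasLineDerivAt i x))
    (fun x _ => hc.hasLineDerivAt x)
  simp only [ContinuousLinearMap.mul_apply'] at key
  have e : ∀ x, (inner ℝ (v x) (dw i x) + inner ℝ (dv i x) (w x)) * c x =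
      c x * inner ℝ (v x) (dw i x) + c x * inner ℝ (dv i x) (w x) := fun x => by ring
  simp only [e] at key
  rw [integral_add i1 i2] at key
  simp only [wpair]
  have e' : ∀ x, inner ℝ (v x) (w x) * c' x = c' x * inner ℝ (v x) (w x) := fun x => mul_comm _ _
  simp only [e'] at key
  linarith

/-- Since `⟨v, ∂ᵢv⟩ = ½ ∂ᵢ|v|²`, this is integration by parts against a total derivative; it is what
makes first order terms collapse to zeroth order ones. -/
theorem wpair_deriv_self {i : Fin n} {c c' : EuclideanSpace ℝ (Fin n) → ℝ} (hc : IsC1Bdd i c c')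
    {v : EuclideanSpace ℝ (Fin n) → ℂ} {dv : Fin n → EuclideanSpace ℝ (Fin n) → ℂ}
    (hv : IsC1L2 v dv) : wpair c v (dv i) = - (1 / 2) * wpair c' v v := by
  have := wpair_deriv_left hc hv hv
  rw [wpair_comm c (dv i) v] at this
  linarith

end WeightedPairing

/-! ### Algebra of the Morawetz multiplier -/

section Coefficients

/-- Bounded coefficients of a first order multiplier `h·∇ + (div h)/2` with the sign properties used
in the Morawetz argument. Here `Dh j i = ∂ⱼ hᵢ`, `d = div h`, `Dd j = ∂ⱼ d` and
`DDd j = ∂ⱼ² d`. -/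
structure IsMorawetzField {n : ℕ} (h : Fin n → EuclideanSpace ℝ (Fin n) → ℝ)
    (Dh : Fin n → Fin n → EuclideanSpace ℝ (Fin n) → ℝ) (d : EuclideanSpace ℝ (Fin n) → ℝ)
    (Dd DDd : Fin n → EuclideanSpace ℝ (Fin n) → ℝ) : Prop where
  field : ∀ j i, IsC1Bdd j (h i) (Dh j i)
  div_eq : ∀ x, d x = ∑ i, Dh i i x
  div : ∀ j, IsC1Bdd j d (Dd j)
  grad_div : ∀ j, IsC1Bdd j (Dd j) (DDd j)
  convex : ∀ x (a : Fin n → ℂ), 0 ≤ ∑ j, ∑ i, Dh j i x * inner ℝ (a j) (a i)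
  laplacian_div_nonpos : ∀ x, ∑ j, DDd j x ≤ 0
  hardy : ∀ x, - (d x) ^ 2 / 4 - (∑ i, h i x * Dd i x) / 2 ≤ 0
  norm_le : ∀ x, ∑ i, (h i x) ^ 2 ≤ 1

variable {n : ℕ} {h : Fin n → EuclideanSpace ℝ (Fin n) → ℝ}
    {Dh : Fin n → Fin n → EuclideanSpace ℝ (Fin n) → ℝ} {d : EuclideanSpace ℝ (Fin n) → ℝ}
    {Dd DDd : Fin n → EuclideanSpace ℝ (Fin n) → ℝ}

namespace IsMorawetzField

theorem wpair_div (H : IsMorawetzField h Dh d Dd DDd) {a b : EuclideanSpace ℝ (Fin n) → ℂ}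
    (ha : MemLp a 2) (hb : MemLp b 2) : wpair d a b = ∑ i, wpair (Dh i i) a b := by
  rw [← wpair_sum _ (fun i _ => (H.field i i).bdd_deriv) ha hb]
  simp only [wpair, H.div_eq]

/-- The multiplier is skew-adjoint. -/
theorem skew (H : IsMorawetzField h Dh d Dd DDd) {v : EuclideanSpace ℝ (Fin n) → ℂ}
    {dv : Fin n → EuclideanSpace ℝ (Fin n) → ℂ} (hv : IsC1L2 v dv) :
    ∑ i, wpair (h i) v (dv i) + 1 / 2 * wpair d v v = 0 := by
  rw [H.wpair_div hv.memLp hv.memLp, Finset.mul_sum, ← Finset.sum_add_distrib]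
  refine Finset.sum_eq_zero fun i _ => ?_
  rw [wpair_deriv_self (H.field i i) hv]
  ring

/-- The first sum is `½ ∫ d h·∇|v|² = -½ ∫ div(d h) |v|²` with `div(d h) = h·∇d + d²`. The
coefficient of `|v|²` becomes `-d²/4 - h·∇d/2`, which the field `hardy` makes nonpositive. In the
expansion of `‖h·∇v + (d/2) v‖²` these are all the terms other than `‖h·∇v‖²`. -/
theorem hardy_wpair (H : IsMorawetzField h Dh d Dd DDd) {v : EuclideanSpace ℝ (Fin n) → ℂ}
    {dv : Fin n → EuclideanSpace ℝ (Fin n) → ℂ} (hv : IsC1L2 v dv) :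
    ∑ i, wpair (fun x => d x * h i x) v (dv i) + 1 / 4 * wpair (fun x => d x * d x) v v ≤ 0 := by
  have hdb : IsBddCont d := by
    have : d = fun x => ∑ i, Dh i i x := funext H.div_eq
    rw [this]
    exact IsBddCont.sum _ fun i _ => (H.field i i).bdd_deriv
  have b1 : ∀ i, IsBddCont (fun x => d x * Dh i i x) := fun i => hdb.mul (H.field i i).bdd_deriv
  have b2 : ∀ i, IsBddCont (fun x => Dd i x * h i x) := fun i =>
    (H.div i).bdd_deriv.mul (H.field i i).bdd
  have hder : ∀ i, IsC1Bdd i (fun x => d x * h i x) (fun x => Dd i x * h i x + d x * Dh i i x) :=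
    fun i => ⟨fun x => ((H.div i).hasLineDerivAt x).mul_real ((H.field i i).hasLineDerivAt x),
      hdb.mul (H.field i i).bdd, (b2 i).add (b1 i)⟩
  have e1 : ∑ i, wpair (fun x => d x * h i x) v (dv i) =
      wpair (fun x => ∑ i, - (1 / 2) * (Dd i x * h i x + d x * Dh i i x)) v v := by
    rw [wpair_sum _ (fun i _ => (IsBddCont.const _).mul ((b2 i).add (b1 i))) hv.memLp hv.memLp]
    refine Finset.sum_congr rfl fun i _ => ?_
    rw [wpair_deriv_self (hder i) hv, wpair_const_mul]
  rw [e1, ← wpair_const_mul, ← wpair_add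
    (IsBddCont.sum _ fun i _ => (IsBddCont.const _).mul ((b2 i).add (b1 i)))
    ((IsBddCont.const _).mul (hdb.mul hdb)) hv.memLp hv.memLp]
  refine wpair_self_nonpos (fun x => ?_) v
  have := H.hardy x
  rw [← Finset.mul_sum, Finset.sum_add_distrib, ← Finset.mul_sum, ← H.div_eq]
  have e2 : ∑ i, Dd i x * h i x = ∑ i, h i x * Dd i x :=
    Finset.sum_congr rfl fun i _ => mul_comm _ _
  rw [e2]
  nlinarith

/-- The multiplier has the right sign against the Laplacian. -/
theorem laplacian_nonpos (H : IsMorawetzField h Dh d Dd DDd) {v : EuclideanSpace ℝ (Fin n) → ℂ}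
    {dv : Fin n → EuclideanSpace ℝ (Fin n) → ℂ}
    {ddv : Fin n → Fin n → EuclideanSpace ℝ (Fin n) → ℂ} (hv : IsC1L2 v dv)
    (hdv : ∀ j, IsC1L2 (dv j) (ddv j)) (hsymm : ∀ i j x, ddv i j x = ddv j i x) :
    ∑ j, (∑ i, wpair (h i) (ddv j j) (dv i) + 1 / 2 * wpair d (ddv j j) v) ≤ 0 := by
  have mdv := hv.memLp_deriv
  have second : ∀ j, wpair d (ddv j j) v =
      - wpair d (dv j) (dv j) + 1 / 2 * wpair (DDd j) v v := fun j => by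
    rw [wpair_deriv_left (H.div j) (hdv j) hv, wpair_comm _ (dv j) v,
      wpair_deriv_self (H.grad_div j) hv]
    ring
  have first : ∀ j i, wpair (h i) (ddv j j) (dv i) =
      1 / 2 * wpair (Dh i i) (dv j) (dv j) - wpair (Dh j i) (dv j) (dv i) := fun j i => by
    rw [wpair_deriv_left (H.field j i) (hdv j) (hdv i)]
    have : ddv i j = ddv j i := funext fun x => hsymm i j x
    rw [this, wpair_deriv_self (H.field i i) (hdv j)]
    ring
  -- The terms `½ ∫ d |∂ⱼv|²` produced by `first` and by `second` cancel; this is why the zeroth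
  -- order part of the multiplier carries the factor one half.
  have total : ∑ j, (∑ i, wpair (h i) (ddv j j) (dv i) + 1 / 2 * wpair d (ddv j j) v) =
      1 / 4 * ∑ j, wpair (DDd j) v v - ∑ j, ∑ i, wpair (Dh j i) (dv j) (dv i) := by
    rw [Finset.mul_sum, ← Finset.sum_sub_distrib]
    refine Finset.sum_congr rfl fun j _ => ?_
    simp only [first, second]
    rw [Finset.sum_sub_distrib, ← Finset.mul_sum, ← H.wpair_div (mdv j) (mdv j)]
    ring
  rw [total, ← wpair_sum _ (fun j _ => (H.grad_div j).bdd_deriv) hv.memLp hv.memLp]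
  have hneg := wpair_self_nonpos H.laplacian_div_nonpos v
  have hpos : 0 ≤ ∑ j, ∑ i, wpair (Dh j i) (dv j) (dv i) := by
    have hint : ∀ j i, Integrable (fun x => Dh j i x * inner ℝ (dv j x) (dv i x)) := fun j i =>
      integrable_wpair (H.field j i).bdd_deriv (mdv j) (mdv i)
    have : ∑ j, ∑ i, wpair (Dh j i) (dv j) (dv i) =
        ∫ x, ∑ j, ∑ i, Dh j i x * inner ℝ (dv j x) (dv i x) := by
      rw [integral_finsetSum _ fun j _ => integrable_finsetSum _ fun i _ => hint j i]
      refine Finset.sum_congr rfl fun j _ => ?_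
      rw [integral_finsetSum _ fun i _ => hint j i]
      rfl
    rw [this]
    exact integral_nonneg fun x => H.convex x fun j => dv j x
  linarith

end IsMorawetzField

end Coefficients

/-! ### The regularised radial field -/

section ConcreteField

variable {n : ℕ} {ε : ℝ}

/-- The regularised inverse radius `(|x|² + ε²)^{-1/2}`. -/
def invRadius (ε : ℝ) (x : EuclideanSpace ℝ (Fin n)) : ℝ := (√(‖x‖ ^ 2 + ε ^ 2))⁻¹

theorem invRadius_pos (hε : 0 < ε) (x : EuclideanSpace ℝ (Fin n)) : 0 < invRadius ε x := by
  unfold invRadius; positivity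

theorem invRadius_sq (hε : 0 < ε) (x : EuclideanSpace ℝ (Fin n)) :
    invRadius ε x ^ 2 * (‖x‖ ^ 2 + ε ^ 2) = 1 := by
  unfold invRadius
  rw [inv_pow, Real.sq_sqrt (by positivity)]
  exact inv_mul_cancel₀ (by positivity)

theorem contDiff_invRadius (hε : 0 < ε) :
    ContDiff ℝ ∞ (invRadius ε : EuclideanSpace ℝ (Fin n) → ℝ) := by
  unfold invRadius
  refine ContDiff.inv (ContDiff.sqrt ((contDiff_norm_sq ℝ).add contDiff_const) ?_) ?_ <;>
  · intro x; positivity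

theorem hasLineDerivAt_coord (i j : Fin n) (x : EuclideanSpace ℝ (Fin n)) :
    HasLineDerivAt ℝ (fun y : EuclideanSpace ℝ (Fin n) => y i) (if i = j then 1 else 0) x
      (EuclideanSpace.single j 1) := by
  have := ((EuclideanSpace.proj (𝕜 := ℝ) i : EuclideanSpace ℝ (Fin n) →L[ℝ] ℝ).hasFDerivAt
    (x := x)).hasLineDerivAt (EuclideanSpace.single j 1)
  simpa [Pi.single_apply] using this

theorem hasLineDerivAt_invRadius (hε : 0 < ε) (j : Fin n) (x : EuclideanSpace ℝ (Fin n)) :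
    HasLineDerivAt ℝ (invRadius ε) (-(x j * invRadius ε x ^ 3)) x
      (EuclideanSpace.single j 1) := by
  have h1 : HasFDerivAt (fun y : EuclideanSpace ℝ (Fin n) => ‖y‖ ^ 2 + ε ^ 2)
      (2 • innerSL ℝ x) x := ((hasStrictFDerivAt_norm_sq x).hasFDerivAt).add_const _
  have hpos : 0 < ‖x‖ ^ 2 + ε ^ 2 := by positivity
  have h2 := h1.hasLineDerivAt (EuclideanSpace.single j 1)
  have h3 : HasDerivAt (fun t : ℝ => ‖x + t • EuclideanSpace.single j (1 : ℝ)‖ ^ 2 + ε ^ 2)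
      (2 * x j) 0 := by
    refine HasDerivAt.congr_deriv h2 ?_
    simp [EuclideanSpace.inner_single_right]
  have h4 := (h3.sqrt (by simpa using hpos.ne')).inv (by
    simpa using (Real.sqrt_pos.2 hpos).ne')
  refine HasDerivAt.congr_deriv h4 ?_
  simp only [zero_smul, add_zero, invRadius]
  have : √(‖x‖ ^ 2 + ε ^ 2) ≠ 0 := (Real.sqrt_pos.2 hpos).ne'
  field_simp

theorem abs_coord_mul_invRadius_le (hε : 0 < ε) (i : Fin n) (x : EuclideanSpace ℝ (Fin n)) :
    |x i * invRadius ε x| ≤ 1 := by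
  rw [← sq_le_one_iff_abs_le_one, mul_pow]
  have h1 := invRadius_sq hε x
  have h2 : (x i) ^ 2 ≤ ‖x‖ ^ 2 := by
    have := PiLp.norm_apply_le x i
    rw [Real.norm_eq_abs] at this
    rw [← sq_abs (x i)]
    gcongr
  have h3 : 0 < invRadius ε x ^ 2 := pow_pos (invRadius_pos hε x) 2
  nlinarith [sq_nonneg ε]

theorem abs_invRadius_le (hε : 0 < ε) (x : EuclideanSpace ℝ (Fin n)) :
    |invRadius ε x| ≤ ε⁻¹ := by
  rw [abs_of_pos (invRadius_pos hε x)]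
  unfold invRadius
  refine inv_anti₀ hε (Real.le_sqrt_of_sq_le ?_)
  nlinarith [sq_nonneg ‖x‖]

theorem isBddCont_invRadius (hε : 0 < ε) :
    IsBddCont (invRadius ε : EuclideanSpace ℝ (Fin n) → ℝ) :=
  ⟨(contDiff_invRadius hε).continuous, ε⁻¹, abs_invRadius_le hε⟩

theorem isBddCont_coord_mul_invRadius (hε : 0 < ε) (i : Fin n) :
    IsBddCont (fun x : EuclideanSpace ℝ (Fin n) => x i * invRadius ε x) :=
  ⟨(EuclideanSpace.proj (𝕜 := ℝ) i).continuous.mul (contDiff_invRadius hε).continuous, 1,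
    abs_coord_mul_invRadius_le hε i⟩

/-- The regularised radial field `x / √(|x|² + ε²)`. -/
def radialField (ε : ℝ) (i : Fin n) (x : EuclideanSpace ℝ (Fin n)) : ℝ := x i * invRadius ε x

/-- The Jacobian `∂ⱼ hᵢ` of the regularised radial field. -/
def radialFieldDeriv (ε : ℝ) (j i : Fin n) (x : EuclideanSpace ℝ (Fin n)) : ℝ :=
  (if i = j then 1 else 0) * invRadius ε x - x i * x j * invRadius ε x ^ 3

/-- The divergence of the regularised radial field. -/
def radialDiv (ε : ℝ) (x : EuclideanSpace ℝ (Fin n)) : ℝ :=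
  (n - 1) * invRadius ε x + ε ^ 2 * invRadius ε x ^ 3

/-- The gradient of the divergence of the regularised radial field. -/
def radialDivDeriv (ε : ℝ) (j : Fin n) (x : EuclideanSpace ℝ (Fin n)) : ℝ :=
  -(x j * ((n - 1) * invRadius ε x ^ 3 + 3 * ε ^ 2 * invRadius ε x ^ 5))

/-- The pure second derivatives of the divergence of the regularised radial field. -/
def radialDivDeriv₂ (ε : ℝ) (j : Fin n) (x : EuclideanSpace ℝ (Fin n)) : ℝ :=
  x j ^ 2 * (3 * (n - 1) * invRadius ε x ^ 5 + 15 * ε ^ 2 * invRadius ε x ^ 7) -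
    ((n - 1) * invRadius ε x ^ 3 + 3 * ε ^ 2 * invRadius ε x ^ 5)

theorem hasLineDerivAt_invRadius_pow (hε : 0 < ε) (k : ℕ) (j : Fin n)
    (x : EuclideanSpace ℝ (Fin n)) :
    HasLineDerivAt ℝ (fun y => invRadius ε y ^ (k + 1))
      (-((k + 1) * x j * invRadius ε x ^ (k + 3))) x (EuclideanSpace.single j 1) := by
  have h : HasDerivAt (fun t : ℝ => invRadius ε (x + t • EuclideanSpace.single j (1 : ℝ)))
    (-(x j * invRadius ε x ^ 3)) 0 := hasLineDerivAt_invRadius hε j x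
  have := h.pow (k + 1)
  refine HasDerivAt.congr_deriv this ?_
  simp
  ring

theorem sum_coord_sq (x : EuclideanSpace ℝ (Fin n)) : ∑ i, x i ^ 2 = ‖x‖ ^ 2 := by
  rw [EuclideanSpace.norm_sq_eq]; simp

/-- With `s = (|x|² + ε²)^(-1/2)` all coefficients are polynomials in `x` and `s`, and every
identity follows from `s²(|x|² + ε²) = 1`. Convexity holds because the field is the gradient of the
convex function `√(|x|² + ε²)`. For `ε > 0` the divergence and its derivatives are bounded, unlike
`(n-1)/|x|`, so no singularity at the origin has to be handled. -/
theorem isMorawetzField_radial (hn : 3 ≤ n) (hε : 0 < ε) :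
    IsMorawetzField (n := n) (radialField ε) (radialFieldDeriv ε) (radialDiv ε) (radialDivDeriv ε)
      (radialDivDeriv₂ ε) := by
  have bs := isBddCont_invRadius (n := n) hε
  have bx := isBddCont_coord_mul_invRadius (n := n) hε
  have hn' : (3 : ℝ) ≤ n := by exact_mod_cast hn
  have bD : ∀ j i, IsBddCont (radialFieldDeriv (n := n) ε j i) := fun j i => by
    have : radialFieldDeriv (n := n) ε j i = fun x => (if i = j then 1 else 0) * invRadius ε x -
        (x i * invRadius ε x) * ((x j * invRadius ε x) * invRadius ε x) := by
      funext x; unfold radialFieldDeriv; ring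
    rw [this]
    exact ((IsBddCont.const _).mul bs).sub ((bx i).mul ((bx j).mul bs))
  have bd : IsBddCont (radialDiv (n := n) ε) :=
    ((IsBddCont.const _).mul bs).add ((IsBddCont.const _).mul (bs.pow 3))
  have bDd : ∀ j, IsBddCont (radialDivDeriv (n := n) ε j) := fun j => by
    have : radialDivDeriv (n := n) ε j = fun x => -((x j * invRadius ε x) *
        ((n - 1) * invRadius ε x ^ 2 + 3 * ε ^ 2 * invRadius ε x ^ 4)) := by
      funext x; unfold radialDivDeriv; ring
    rw [this]
    exact ((bx j).mul (((IsBddCont.const _).mul (bs.pow 2)).add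
      ((IsBddCont.const _).mul (bs.pow 4)))).neg
  have bDDd : ∀ j, IsBddCont (radialDivDeriv₂ (n := n) ε j) := fun j => by
    have : radialDivDeriv₂ (n := n) ε j = fun x => (x j * invRadius ε x) ^ 2 *
        (3 * (n - 1) * invRadius ε x ^ 3 + 15 * ε ^ 2 * invRadius ε x ^ 5) -
        ((n - 1) * invRadius ε x ^ 3 + 3 * ε ^ 2 * invRadius ε x ^ 5) := by
      funext x; unfold radialDivDeriv₂; ring
    rw [this]
    exact (((bx j).pow 2).mul (((IsBddCont.const _).mul (bs.pow 3)).add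
      ((IsBddCont.const _).mul (bs.pow 5)))).sub
      (((IsBddCont.const _).mul (bs.pow 3)).add ((IsBddCont.const _).mul (bs.pow 5)))
  have dpow := fun k j x => hasLineDerivAt_invRadius_pow (n := n) hε k j x
  have ldadd : ∀ {f g : EuclideanSpace ℝ (Fin n) → ℝ} {a b : ℝ} {x e},
      HasLineDerivAt ℝ f a x e → HasLineDerivAt ℝ g b x e →
      HasLineDerivAt ℝ (fun y => f y + g y) (a + b) x e := fun hf hg => HasDerivAt.add hf hg
  have ldc : ∀ {f : EuclideanSpace ℝ (Fin n) → ℝ} {a : ℝ} {x e} (c : ℝ),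
      HasLineDerivAt ℝ f a x e → HasLineDerivAt ℝ (fun y => c * f y) (c * a) x e :=
    fun c hf => HasDerivAt.const_mul c hf
  refine ⟨fun j i => ⟨fun x => ?_, bx i, bD j i⟩, fun x => ?_, fun j => ⟨fun x => ?_, bd, bDd j⟩,
    fun j => ⟨fun x => ?_, bDd j, bDDd j⟩, fun x a => ?_, fun x => ?_, fun x => ?_, fun x => ?_⟩
  · have := (hasLineDerivAt_coord i j x).mul_real (hasLineDerivAt_invRadius hε j x)
    refine HasDerivAt.congr_deriv this ?_
    unfold radialFieldDeriv; ring
  · have h1 := invRadius_sq hε x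
    simp only [radialFieldDeriv, radialDiv, if_true, one_mul, Finset.sum_sub_distrib,
      Finset.sum_const, Finset.card_univ, Fintype.card_fin, nsmul_eq_mul]
    rw [← Finset.sum_mul]
    have : ∑ i, x i * x i = ‖x‖ ^ 2 := by rw [← sum_coord_sq]; simp only [sq]
    rw [this]
    linear_combination (invRadius ε x) * h1
  · have := ldadd (ldc ((n : ℝ) - 1) (dpow 0 j x)) (ldc (ε ^ 2) (dpow 2 j x))
    simp only [zero_add, pow_one] at this
    have e : (fun y => (n - 1) * invRadius ε y + ε ^ 2 * invRadius ε y ^ (2 + 1)) =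
        radialDiv (n := n) ε := rfl
    rw [e] at this
    refine HasDerivAt.congr_deriv this ?_
    unfold radialDivDeriv; push_cast; ring
  · have := (hasLineDerivAt_coord j j x).mul_real
      (ldadd (ldc ((n : ℝ) - 1) (dpow 2 j x)) (ldc (3 * ε ^ 2) (dpow 4 j x)))
    have := ldc (-1) this
    convert this using 1
    · funext y; unfold radialDivDeriv; ring
    · unfold radialDivDeriv₂; rw [if_pos rfl]; push_cast; ring
  · have h1 := invRadius_sq hε x
    set s := invRadius ε x with hs
    have hspos : 0 < s := invRadius_pos hε x
    have e1 : ∑ j, ∑ i, radialFieldDeriv ε j i x * inner ℝ (a j) (a i) =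
        s * ∑ j, ‖a j‖ ^ 2 - s ^ 3 * ‖∑ j, (x j : ℝ) • a j‖ ^ 2 := by
      rw [← real_inner_self_eq_norm_sq, sum_inner, Finset.mul_sum, Finset.mul_sum,
        ← Finset.sum_sub_distrib]
      refine Finset.sum_congr rfl fun j _ => ?_
      simp only [radialFieldDeriv, sub_mul, Finset.sum_sub_distrib]
      congr 1
      · rw [Finset.sum_eq_single j]
        · simp [← hs]
        · intro i _ hij; simp [hij]
        · simp
      · rw [inner_sum, Finset.mul_sum]
        refine Finset.sum_congr rfl fun i _ => ?_
        rw [real_inner_smul_left, real_inner_smul_right, ← hs]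
        ring
    rw [e1]
    -- Cauchy–Schwarz gives `s|a|² - s³|∑ xⱼaⱼ|² ≥ s(1 - s²|x|²)|a|² = s³ε²|a|²`.
    have cs : ‖∑ j, (x j : ℝ) • a j‖ ^ 2 ≤ ‖x‖ ^ 2 * ∑ j, ‖a j‖ ^ 2 := by
      calc ‖∑ j, (x j : ℝ) • a j‖ ^ 2 ≤ (∑ j, |x j| * ‖a j‖) ^ 2 := by
            gcongr
            refine (norm_sum_le _ _).trans (Finset.sum_le_sum fun j _ => ?_)
            rw [norm_smul, Real.norm_eq_abs]
        _ ≤ (∑ j, |x j| ^ 2) * ∑ j, ‖a j‖ ^ 2 := Finset.sum_mul_sq_le_sq_mul_sq _ _ _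
        _ = _ := by simp only [sq_abs, sum_coord_sq]
    have hA : 0 ≤ ∑ j, ‖a j‖ ^ 2 := Finset.sum_nonneg fun j _ => by positivity
    have h2 : s ^ 3 * ‖∑ j, (x j : ℝ) • a j‖ ^ 2 ≤ s ^ 3 * (‖x‖ ^ 2 * ∑ j, ‖a j‖ ^ 2) := by gcongr
    have h3 : s ^ 3 * (‖x‖ ^ 2 * ∑ j, ‖a j‖ ^ 2) =
        s * (1 - s ^ 2 * ε ^ 2) * ∑ j, ‖a j‖ ^ 2 := by
      linear_combination s * (∑ j, ‖a j‖ ^ 2) * h1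
    have h4 : 0 ≤ s * (s ^ 2 * ε ^ 2) * ∑ j, ‖a j‖ ^ 2 := by positivity
    nlinarith
  · have h1 := invRadius_sq hε x
    simp only [radialDivDeriv₂, Finset.sum_sub_distrib, Finset.sum_const, Finset.card_univ,
      Fintype.card_fin, nsmul_eq_mul]
    rw [← Finset.sum_mul, sum_coord_sq]
    set s := invRadius ε x with hs
    have hspos : 0 < s := invRadius_pos hε x
    -- At `ε = 0` the right side is `-(n-1)(n-3)/|x|³ = Δ((n-1)/|x|)` away from the origin; its sign
    -- for `n ≥ 3` persists in the correction terms.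
    have e : ‖x‖ ^ 2 * (3 * (n - 1) * s ^ 5 + 15 * ε ^ 2 * s ^ 7) -
        n * ((n - 1) * s ^ 3 + 3 * ε ^ 2 * s ^ 5) =
        -((n - 1) * (n - 3) * s ^ 3 + 6 * (n - 3) * ε ^ 2 * s ^ 5 + 15 * ε ^ 4 * s ^ 7) := by
      linear_combination (3 * (n - 1) * s ^ 3 + 15 * ε ^ 2 * s ^ 5) * h1
    rw [e, neg_nonpos]
    have a1 : (0 : ℝ) ≤ n - 1 := by linarith
    have a3 : (0 : ℝ) ≤ n - 3 := by linarith
    positivity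
  · have h1 := invRadius_sq hε x
    have e0 : ∑ i, radialField ε i x * radialDivDeriv ε i x =
        -(‖x‖ ^ 2 * invRadius ε x * ((n - 1) * invRadius ε x ^ 3 + 3 * ε ^ 2 * invRadius ε x ^ 5)) := by
      rw [← sum_coord_sq, Finset.sum_mul, Finset.sum_mul, ← Finset.sum_neg_distrib]
      refine Finset.sum_congr rfl fun i _ => ?_
      unfold radialField radialDivDeriv
      ring
    rw [e0]
    unfold radialDiv
    set s := invRadius ε x with hs
    have hspos : 0 < s := invRadius_pos hε x
    -- At `ε = 0` this is `-(n-1)(n-3)/(4|x|²)`, so the dimension again enters through the factor `n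
    -- - 3`.
    have e : -((n - 1) * s + ε ^ 2 * s ^ 3) ^ 2 / 4 -
        -(‖x‖ ^ 2 * s * ((n - 1) * s ^ 3 + 3 * ε ^ 2 * s ^ 5)) / 2 =
        -((n - 1) * (n - 3) / 4 * s ^ 2 + (n - 5 / 2) * ε ^ 2 * s ^ 4 + 7 / 4 * ε ^ 4 * s ^ 6) := by
      linear_combination ((n - 1) * s ^ 2 + 3 * ε ^ 2 * s ^ 4) / 2 * h1
    rw [e, neg_nonpos]
    have a1 : (0 : ℝ) ≤ n - 1 := by linarith
    have a3 : (0 : ℝ) ≤ n - 3 := by linarith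
    have a5 : (0 : ℝ) ≤ n - 5 / 2 := by linarith
    positivity
  · have h1 := invRadius_sq hε x
    simp only [radialField, mul_pow]
    rw [← Finset.sum_mul, sum_coord_sq]
    nlinarith [sq_nonneg (invRadius ε x * ε)]

end ConcreteField

/-! ### `L²` bounds by duality, and basic properties of convolution -/

section Duality

variable {n : ℕ}

/-- Testing with `k = G` would give `‖G‖² ≤ C ‖G‖`, but `‖G‖` may be infinite. Truncating `G` in
height and to sets of finite measure makes the norm finite, so it can be cancelled; Fatou removes
the truncation. -/
theorem lintegral_sq_le_of_dual {G : EuclideanSpace ℝ (Fin n) → ℝ≥0∞} (hG : AEMeasurable G)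
    {C : ℝ≥0∞} (h : ∀ k : EuclideanSpace ℝ (Fin n) → ℝ≥0∞, AEMeasurable k →
      ∫⁻ x, G x * k x ≤ C * (∫⁻ x, k x ^ (2 : ℝ)) ^ (1 / 2 : ℝ)) :
    (∫⁻ x, G x ^ (2 : ℝ)) ^ (1 / 2 : ℝ) ≤ C := by
  set S := spanningSets (volume : Measure (EuclideanSpace ℝ (Fin n)))
  let k : ℕ → EuclideanSpace ℝ (Fin n) → ℝ≥0∞ := fun m => (S m).indicator fun x => min (G x) m
  have hSm : ∀ m, MeasurableSet (S m) := fun m => measurableSet_spanningSets _ m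
  have hk : ∀ m, AEMeasurable (k m) := fun m => (hG.min aemeasurable_const).indicator (hSm m)
  have hkG : ∀ m x, k m x ≤ G x := fun m x => by
    refine (indicator_le_self' (fun _ _ => zero_le) x).trans (min_le_left _ _)
  have hfin : ∀ m, ∫⁻ x, k m x ^ (2 : ℝ) ≠ ⊤ := fun m => by
    have : ∫⁻ x, k m x ^ (2 : ℝ) ≤ ∫⁻ x, (S m).indicator (fun _ => (m : ℝ≥0∞) ^ (2 : ℝ)) x := by
      refine lintegral_mono fun x => ?_
      by_cases hx : x ∈ S m
      · simp only [k, indicator_of_mem hx]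
        gcongr
        exact min_le_right _ _
      · simp [k, indicator_of_notMem hx]
    refine ne_top_of_le_ne_top ?_ this
    rw [lintegral_indicator_const (hSm m)]
    refine ENNReal.mul_ne_top (ENNReal.rpow_ne_top_of_nonneg (by norm_num) (by simp)) ?_
    exact (measure_spanningSets_lt_top _ m).ne
  have hbound : ∀ m, ∫⁻ x, k m x ^ (2 : ℝ) ≤ C ^ (2 : ℝ) := fun m => by
    set I := ∫⁻ x, k m x ^ (2 : ℝ) with hI
    have h1 : I ≤ C * I ^ (1 / 2 : ℝ) := by
      refine le_trans ?_ (h (k m) (hk m))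
      refine lintegral_mono fun x => ?_
      have : k m x ^ (2 : ℝ) = k m x * k m x := by norm_num [sq]
      rw [this]
      gcongr
      exact hkG m x
    rcases eq_or_ne I 0 with h0 | h0
    · rw [h0]; exact zero_le
    · have h2 : I = I ^ (1 / 2 : ℝ) * I ^ (1 / 2 : ℝ) := by
        rw [← ENNReal.rpow_add_of_nonneg _ _ (by norm_num) (by norm_num)]; norm_num
      have hI0 : I ^ (1 / 2 : ℝ) ≠ 0 := by
        simp [h0]
      have hIt : I ^ (1 / 2 : ℝ) ≠ ⊤ := ENNReal.rpow_ne_top_of_nonneg (by norm_num) (hfin m)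
      have h3 : I ^ (1 / 2 : ℝ) ≤ C := by
        rw [h2] at h1
        have e : (I ^ (1 / 2 : ℝ) * I ^ (1 / 2 : ℝ)) ^ (1 / 2 : ℝ) = I ^ (1 / 2 : ℝ) := by rw [← h2]
        rw [e] at h1
        exact (ENNReal.mul_le_mul_iff_left hI0 hIt).1 h1
      calc I = (I ^ (1 / 2 : ℝ)) ^ (2 : ℝ) := by rw [← ENNReal.rpow_mul]; norm_num
        _ ≤ C ^ (2 : ℝ) := by gcongr
  have hlim : ∀ x, Tendsto (fun m => k m x) atTop (𝓝 (G x)) := fun x => by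
    have hx : ∀ᶠ m in atTop, k m x = min (G x) m := by
      filter_upwards [eventually_ge_atTop (spanningSetsIndex volume x)] with m hm
      exact indicator_of_mem (mem_spanningSets_of_index_le volume x hm) _
    refine Tendsto.congr' (hx.mono fun m hm => hm.symm) ?_
    have := (tendsto_const_nhds (x := G x)).min ENNReal.tendsto_nat_nhds_top
    simpa using this
  have hfatou : ∫⁻ x, G x ^ (2 : ℝ) ≤ C ^ (2 : ℝ) := by
    calc ∫⁻ x, G x ^ (2 : ℝ) = ∫⁻ x, liminf (fun m => k m x ^ (2 : ℝ)) atTop := by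
          refine lintegral_congr fun x => ?_
          exact (((ENNReal.continuous_rpow_const (y := 2)).tendsto (G x)).comp
            (hlim x)).liminf_eq.symm
      _ ≤ liminf (fun m => ∫⁻ x, k m x ^ (2 : ℝ)) atTop :=
          lintegral_liminf_le' fun m => (hk m).pow_const _
      _ ≤ C ^ (2 : ℝ) := by
          refine liminf_le_of_le (by isBoundedDefault) fun b hb => ?_
          obtain ⟨m, hm⟩ := hb.exists
          exact hm.trans (hbound m)
  calc (∫⁻ x, G x ^ (2 : ℝ)) ^ (1 / 2 : ℝ) ≤ (C ^ (2 : ℝ)) ^ (1 / 2 : ℝ) := by gcongr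
    _ = C := by rw [← ENNReal.rpow_mul]; norm_num

variable {F : Type*} [NormedAddCommGroup F] [NormedSpace ℝ F]

theorem spatialConv_def (φ : EuclideanSpace ℝ (Fin n) → ℝ) (f : EuclideanSpace ℝ (Fin n) → F)
    (x : EuclideanSpace ℝ (Fin n)) : spatialConv φ f x = ∫ z, φ z • f (x - z) := rfl

theorem spatialConv_eq_swap (φ : EuclideanSpace ℝ (Fin n) → ℝ) (f : EuclideanSpace ℝ (Fin n) → F)
    (x : EuclideanSpace ℝ (Fin n)) : spatialConv φ f x = ∫ y, φ (x - y) • f y :=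
  convolution_lsmul_swap

theorem ae_eq_comp_sub_left {β : Type*} {f f' : EuclideanSpace ℝ (Fin n) → β}
    (h : f =ᵐ[volume] f') (x : EuclideanSpace ℝ (Fin n)) :
    (fun z => f (x - z)) =ᵐ[volume] fun z => f' (x - z) :=
  (quasiMeasurePreserving_sub_left volume x).ae_eq_comp h

theorem spatialConv_congr {φ : EuclideanSpace ℝ (Fin n) → ℝ} {f f' : EuclideanSpace ℝ (Fin n) → F}
    (h : f =ᵐ[volume] f') : spatialConv φ f = spatialConv φ f' := by
  funext x
  refine integral_congr_ae ?_
  filter_upwards [ae_eq_comp_sub_left h x] with z hz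
  rw [hz]

theorem aestronglyMeasurable_spatialConv {φ : EuclideanSpace ℝ (Fin n) → ℝ}
    {f : EuclideanSpace ℝ (Fin n) → F} (hφ : AEStronglyMeasurable φ)
    (hf : AEStronglyMeasurable f) : AEStronglyMeasurable (spatialConv φ f) :=
  (AEStronglyMeasurable.convolution_integrand (ContinuousLinearMap.lsmul ℝ ℝ) hφ
    hf).integral_prod_right'

theorem enorm_spatialConv_le (φ : EuclideanSpace ℝ (Fin n) → ℝ)
    (f : EuclideanSpace ℝ (Fin n) → F) (x : EuclideanSpace ℝ (Fin n)) :
    ‖spatialConv φ f x‖ₑ ≤ ∫⁻ z, ‖φ z‖ₑ * ‖f (x - z)‖ₑ := by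
  rw [spatialConv_def]
  refine (enorm_integral_le_lintegral_enorm _).trans (lintegral_mono fun z => ?_)
  rw [enorm_smul]

theorem aemeasurable_lintegral_conv {V B : EuclideanSpace ℝ (Fin n) → ℝ≥0∞} (hV : AEMeasurable V)
    (hB : AEMeasurable B) : AEMeasurable fun x => ∫⁻ z, V z * B (x - z) :=
  (hV.comp_snd.fun_mul hB.comp_sub_prod).lintegral_prod_right'

theorem lintegral_mul_conv_eq_triform {V A B : EuclideanSpace ℝ (Fin n) → ℝ≥0∞}
    (hV : AEMeasurable V) (hB : AEMeasurable B) :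
    ∫⁻ x, A x * ∫⁻ z, V z * B (x - z) = triform V A B := by
  refine lintegral_congr fun x => ?_
  have hm : AEMeasurable fun z => V z * B (x - z) := hV.fun_mul
    (hB.comp_quasiMeasurePreserving (quasiMeasurePreserving_sub_left volume x))
  rw [← lintegral_const_mul'' (A x) hm]
  refine lintegral_congr fun z => ?_
  ring

/-- Young's inequality `L¹ * L² ⊆ L²`. -/
theorem eLpNorm_spatialConv_le {φ : EuclideanSpace ℝ (Fin n) → ℝ}
    {f : EuclideanSpace ℝ (Fin n) → F} (hφ : AEStronglyMeasurable φ)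
    (hf : AEStronglyMeasurable f) :
    eLpNorm (spatialConv φ f) 2 volume ≤ eLpNorm φ 1 volume * eLpNorm f 2 volume := by
  have hmeas := aemeasurable_lintegral_conv hφ.enorm hf.enorm
  have h1 : eLpNorm (spatialConv φ f) 2 volume ≤
      (∫⁻ x, (∫⁻ z, ‖φ z‖ₑ * ‖f (x - z)‖ₑ) ^ (2 : ℝ)) ^ (1 / 2 : ℝ) := by
    rw [eLpNorm_two_eq]
    gcongr with x
    exact enorm_spatialConv_le φ f x
  refine h1.trans (lintegral_sq_le_of_dual hmeas fun k hk => ?_)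
  have h2 := triform_le_of_young (p := 1) (a := 2) (b := 2) le_rfl one_le_two one_le_two
    (by norm_num) hφ.enorm hk hf.enorm
  simp_rw [mul_comm _ (k _)]
  rw [lintegral_mul_conv_eq_triform hφ.enorm hf.enorm]
  refine h2.trans (le_of_eq ?_)
  rw [eLpNorm_two_eq f, eLpNorm_one_eq_lintegral_enorm]
  simp only [ENNReal.rpow_one, div_one]
  ring

end Duality

/-! ### Convolution and multiplication operators on `L²` -/

section Operators

variable {n : ℕ}

/-- The space `L²(ℝⁿ; ℂ)`. -/
abbrev LTwo (n : ℕ) : Type := Lp ℂ 2 (volume : Measure (EuclideanSpace ℝ (Fin n)))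

/-- Test functions. -/
structure IsTest (φ : EuclideanSpace ℝ (Fin n) → ℝ) : Prop where
  contDiff : ContDiff ℝ ∞ φ
  hasCompactSupport : HasCompactSupport φ

theorem IsTest.integrable {φ : EuclideanSpace ℝ (Fin n) → ℝ} (h : IsTest φ) : Integrable φ :=
  h.contDiff.continuous.integrable_of_hasCompactSupport h.hasCompactSupport

theorem IsTest.memLp {φ : EuclideanSpace ℝ (Fin n) → ℝ} (h : IsTest φ) (p : ℝ≥0∞) : MemLp φ p :=
  h.contDiff.continuous.memLp_of_hasCompactSupport h.hasCompactSupport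

theorem IsTest.partialDeriv {φ : EuclideanSpace ℝ (Fin n) → ℝ} (h : IsTest φ) (i : Fin n) :
    IsTest (partialDeriv i φ) := by
  refine ⟨?_, h.hasCompactSupport.fderiv_apply ℝ _⟩
  exact (h.contDiff.fderiv_right (m := ∞) le_rfl).clm_apply contDiff_const

theorem IsTest.isBddCont {φ : EuclideanSpace ℝ (Fin n) → ℝ} (h : IsTest φ) : IsBddCont φ := by
  obtain ⟨C, hC⟩ := h.contDiff.continuous.bounded_above_of_compact_support h.hasCompactSupport
  exact ⟨h.contDiff.continuous, C, hC⟩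

theorem IsTest.comp_sub_left {φ : EuclideanSpace ℝ (Fin n) → ℝ} (h : IsTest φ)
    (x : EuclideanSpace ℝ (Fin n)) : IsTest (fun y => φ (x - y)) :=
  ⟨h.contDiff.comp (contDiff_const.sub contDiff_id),
    h.hasCompactSupport.comp_homeomorph (Homeomorph.subLeft x)⟩

theorem IsTest.differentiable {φ : EuclideanSpace ℝ (Fin n) → ℝ} (h : IsTest φ) :
    Differentiable ℝ φ := h.contDiff.differentiable (by simp)

theorem IsTest.partialDeriv_comp_sub_left {φ : EuclideanSpace ℝ (Fin n) → ℝ} (h : IsTest φ)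
    (x : EuclideanSpace ℝ (Fin n)) (i : Fin n) :
    _root_.partialDeriv i (fun y => φ (x - y)) = fun y => -_root_.partialDeriv i φ (x - y) := by
  funext y
  have h1 := (h.differentiable (x - y)).hasFDerivAt.comp y
    ((hasFDerivAt_id y).const_sub x)
  simp only [_root_.partialDeriv]
  have h2 : fderiv ℝ (fun y => φ (x - y)) y = _ := h1.fderiv
  rw [h2]
  simp

theorem IsTest.partialDeriv_comm {φ : EuclideanSpace ℝ (Fin n) → ℝ} (h : IsTest φ) (i j : Fin n) :
    _root_.partialDeriv i (_root_.partialDeriv j φ) =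
      _root_.partialDeriv j (_root_.partialDeriv i φ) := by
  have hd : Differentiable ℝ (fderiv ℝ φ) :=
    (h.contDiff.fderiv_right (m := ∞) le_rfl).differentiable (by simp)
  have key : ∀ i j x, _root_.partialDeriv i (_root_.partialDeriv j φ) x =
      fderiv ℝ (fderiv ℝ φ) x (EuclideanSpace.single i 1) (EuclideanSpace.single j 1) := by
    intro i j x
    have := ((hd x).hasFDerivAt.clm_apply (hasFDerivAt_const (EuclideanSpace.single j (1 : ℝ)) x))
    change fderiv ℝ (fun y => fderiv ℝ φ y (EuclideanSpace.single j 1)) x _ = _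
    rw [this.fderiv]
    simp
  funext x
  rw [key, key]
  have hs : IsSymmSndFDerivAt ℝ φ x :=
    (h.contDiff.contDiffAt (x := x)).isSymmSndFDerivAt
      (by rw [minSmoothness_of_isRCLikeNormedField]; exact WithTop.coe_le_coe.2 le_top)
  exact hs _ _

theorem LTwo.locallyIntegrable {F : Type*} [NormedAddCommGroup F]
    {f : EuclideanSpace ℝ (Fin n) → F} (hf : MemLp f 2) :
    LocallyIntegrable f := hf.locallyIntegrable one_le_two

theorem IsTest.memLp_spatialConv {φ : EuclideanSpace ℝ (Fin n) → ℝ} (hφ : IsTest φ)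
    {F : Type*} [NormedAddCommGroup F] [NormedSpace ℝ F]
    {f : EuclideanSpace ℝ (Fin n) → F} (hf : MemLp f 2) : MemLp (spatialConv φ f) 2 := by
  refine ⟨aestronglyMeasurable_spatialConv hφ.integrable.1 hf.1, ?_⟩
  exact (eLpNorm_spatialConv_le hφ.integrable.1 hf.1).trans_lt
    (ENNReal.mul_lt_top (hφ.memLp 1).2 hf.2)

theorem IsTest.convolutionExists {φ : EuclideanSpace ℝ (Fin n) → ℝ} (hφ : IsTest φ)
    {F : Type*} [NormedAddCommGroup F] [NormedSpace ℝ F]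
    {f : EuclideanSpace ℝ (Fin n) → F} (hf : LocallyIntegrable f) :
    ConvolutionExists φ f (ContinuousLinearMap.lsmul ℝ ℝ) volume :=
  hφ.hasCompactSupport.convolutionExists_left _ hφ.contDiff.continuous hf

/-- Convolution with a test function as a bounded operator on `L²`. -/
def convL (φ : EuclideanSpace ℝ (Fin n) → ℝ) (hφ : IsTest φ) : LTwo n →L[ℝ] LTwo n :=
  LinearMap.mkContinuous
    { toFun := fun f => (hφ.memLp_spatialConv (Lp.memLp f)).toLp _
      map_add' := fun f g => by
        rw [← MemLp.toLp_add]
        refine (MemLp.toLp_eq_toLp_iff _ _).2 ?_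
        rw [spatialConv_congr (Lp.coeFn_add f g)]
        refine ae_of_all _ fun x => ?_
        exact ((hφ.convolutionExists (LTwo.locallyIntegrable (Lp.memLp f))) x).distrib_add
          ((hφ.convolutionExists (LTwo.locallyIntegrable (Lp.memLp g))) x)
      map_smul' := fun c f => by
        rw [RingHom.id_apply, ← MemLp.toLp_const_smul]
        refine (MemLp.toLp_eq_toLp_iff _ _).2 ?_
        rw [spatialConv_congr (Lp.coeFn_smul c f)]
        exact ae_of_all _ fun x => congrFun convolution_smul x }
    (eLpNorm φ 1 volume).toReal
    (fun f => by
      change ‖(hφ.memLp_spatialConv (Lp.memLp f)).toLp _‖ ≤ _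
      rw [Lp.norm_toLp, Lp.norm_def, ← ENNReal.toReal_mul]
      refine ENNReal.toReal_mono (ENNReal.mul_ne_top (hφ.memLp 1).2.ne (Lp.memLp f).2.ne) ?_
      exact eLpNorm_spatialConv_le hφ.integrable.1 (Lp.memLp f).1)

theorem coeFn_convL {φ : EuclideanSpace ℝ (Fin n) → ℝ} (hφ : IsTest φ) (f : LTwo n) :
    convL φ hφ f =ᵐ[volume] spatialConv φ f :=
  (hφ.memLp_spatialConv (Lp.memLp f)).coeFn_toLp

theorem norm_convL_le {φ : EuclideanSpace ℝ (Fin n) → ℝ} (hφ : IsTest φ) (f : LTwo n) :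
    ‖convL φ hφ f‖ ≤ (eLpNorm φ 1 volume).toReal * ‖f‖ :=
  (LinearMap.mkContinuous _ _ _).le_of_opNorm_le
    (LinearMap.mkContinuous_norm_le _ ENNReal.toReal_nonneg _) f

theorem IsBddCont.memLp_smul {c : EuclideanSpace ℝ (Fin n) → ℝ} (hc : IsBddCont c)
    {f : EuclideanSpace ℝ (Fin n) → ℂ} (hf : MemLp f 2) : MemLp (fun x => c x • f x) 2 := by
  obtain ⟨hc, C, hC⟩ := hc
  refine MemLp.of_le_mul (c := C) hf (hc.aestronglyMeasurable.smul hf.1) (ae_of_all _ fun x => ?_)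
  rw [norm_smul, Real.norm_eq_abs]
  exact mul_le_mul_of_nonneg_right (hC x) (norm_nonneg _)

/-- Multiplication by a bounded continuous function as a bounded operator on `L²`. -/
def mulL (c : EuclideanSpace ℝ (Fin n) → ℝ) (hc : IsBddCont c) : LTwo n →L[ℝ] LTwo n :=
  LinearMap.mkContinuous
    { toFun := fun f => (hc.memLp_smul (Lp.memLp f)).toLp _
      map_add' := fun f g => by
        rw [← MemLp.toLp_add]
        refine (MemLp.toLp_eq_toLp_iff _ _).2 ?_
        filter_upwards [Lp.coeFn_add f g] with x hx
        simp only [hx, Pi.add_apply, smul_add]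
      map_smul' := fun a f => by
        rw [RingHom.id_apply, ← MemLp.toLp_const_smul]
        refine (MemLp.toLp_eq_toLp_iff _ _).2 ?_
        filter_upwards [Lp.coeFn_smul a f] with x hx
        simp only [hx, Pi.smul_apply, smul_comm a] }
    hc.2.choose
    (fun f => by
      refine Lp.norm_le_mul_norm_of_ae_le_mul ?_
      filter_upwards [(hc.memLp_smul (Lp.memLp f)).coeFn_toLp] with x hx
      change ‖(hc.memLp_smul (Lp.memLp f)).toLp _ x‖ ≤ _
      rw [hx, norm_smul, Real.norm_eq_abs]
      exact mul_le_mul_of_nonneg_right (hc.2.choose_spec x) (norm_nonneg _))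

theorem coeFn_mulL {c : EuclideanSpace ℝ (Fin n) → ℝ} (hc : IsBddCont c) (f : LTwo n) :
    mulL c hc f =ᵐ[volume] fun x => c x • f x :=
  (hc.memLp_smul (Lp.memLp f)).coeFn_toLp

theorem inner_mulL {c : EuclideanSpace ℝ (Fin n) → ℝ} (hc : IsBddCont c) (f g : LTwo n) :
    inner ℝ f (mulL c hc g) = wpair c f g := by
  rw [L2.inner_def]
  refine integral_congr_ae ?_
  filter_upwards [coeFn_mulL hc g] with x hx
  rw [hx, real_inner_smul_right]

theorem wpair_congr {c : EuclideanSpace ℝ (Fin n) → ℝ} {a b a' b' : EuclideanSpace ℝ (Fin n) → ℂ}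
    (ha : a =ᵐ[volume] a') (hb : b =ᵐ[volume] b') : wpair c a b = wpair c a' b' := by
  refine integral_congr_ae ?_
  filter_upwards [ha, hb] with x h1 h2
  rw [h1, h2]

theorem hasLineDerivAt_spatialConv {φ : EuclideanSpace ℝ (Fin n) → ℝ} (hφ : IsTest φ)
    {F : Type*} [NormedAddCommGroup F] [NormedSpace ℝ F] [CompleteSpace F]
    {f : EuclideanSpace ℝ (Fin n) → F} (hf : LocallyIntegrable f) (i : Fin n)
    (x : EuclideanSpace ℝ (Fin n)) :
    HasLineDerivAt ℝ (spatialConv φ f) (spatialConv (partialDeriv i φ) f x) x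
      (EuclideanSpace.single i 1) := by
  have h1 := hφ.hasCompactSupport.hasFDerivAt_convolution_left (ContinuousLinearMap.lsmul ℝ ℝ)
    (hφ.contDiff.of_le (by simp)) hf x
  have h2 := h1.hasLineDerivAt (EuclideanSpace.single i 1)
  refine HasDerivAt.congr_deriv h2 ?_
  have hex : ConvolutionExistsAt (fderiv ℝ φ) f x
      (ContinuousLinearMap.precompL (EuclideanSpace ℝ (Fin n)) (ContinuousLinearMap.lsmul ℝ ℝ :
        ℝ →L[ℝ] F →L[ℝ] F)) volume :=
    (hφ.hasCompactSupport.fderiv ℝ).convolutionExists_left _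
      (hφ.contDiff.continuous_fderiv (by simp)) hf x
  rw [convolution_def, ContinuousLinearMap.integral_apply hex]
  rfl

theorem IsTest.isC1L2_spatialConv {φ : EuclideanSpace ℝ (Fin n) → ℝ} (hφ : IsTest φ)
    {f : EuclideanSpace ℝ (Fin n) → ℂ} (hf : MemLp f 2) :
    IsC1L2 (spatialConv φ f) (fun i => spatialConv (_root_.partialDeriv i φ) f) :=
  ⟨fun i x => hasLineDerivAt_spatialConv hφ (LTwo.locallyIntegrable hf) i x,
    hφ.memLp_spatialConv hf, fun i => (hφ.partialDeriv i).memLp_spatialConv hf⟩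

end Operators

/-! ### Mollification in `L²` -/

section Mollifier

variable {n : ℕ}

/-- A smooth bump at the origin with radii `1/(m+1)` and `2/(m+1)`. -/
def mollBump (n m : ℕ) : ContDiffBump (0 : EuclideanSpace ℝ (Fin n)) where
  rIn := 1 / (m + 1)
  rOut := 2 / (m + 1)
  rIn_pos := by positivity
  rIn_lt_rOut := by gcongr; norm_num

/-- The standard mollifier at scale `1/(m+1)`. -/
def moll (n m : ℕ) : EuclideanSpace ℝ (Fin n) → ℝ := (mollBump n m).normed volume

theorem isTest_moll (m : ℕ) : IsTest (moll n m) :=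
  ⟨(mollBump n m).contDiff_normed, (mollBump n m).hasCompactSupport_normed⟩

theorem moll_nonneg (m : ℕ) (x : EuclideanSpace ℝ (Fin n)) : 0 ≤ moll n m x :=
  (mollBump n m).nonneg_normed x

theorem eLpNorm_moll (m : ℕ) : eLpNorm (moll n m) 1 volume = 1 := by
  rw [eLpNorm_one_eq_lintegral_enorm]
  have : ∀ x, ‖moll n m x‖ₑ = ENNReal.ofReal (moll n m x) := fun x =>
    Real.enorm_of_nonneg (moll_nonneg m x)
  simp_rw [this]
  rw [← ofReal_integral_eq_lintegral_ofReal (isTest_moll m).integrable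
    (ae_of_all _ (moll_nonneg m))]
  have : ∫ x, moll n m x = 1 := (mollBump n m).integral_normed
  rw [this, ENNReal.ofReal_one]

theorem ae_tendsto_moll {F : Type*} [NormedAddCommGroup F] [NormedSpace ℝ F] [CompleteSpace F]
    {f : EuclideanSpace ℝ (Fin n) → F} (hf : LocallyIntegrable f) :
    ∀ᵐ x, Tendsto (fun m => spatialConv (moll n m) f x) atTop (𝓝 (f x)) := by
  -- `K = 2` is the constant ratio of the outer to the inner radius of the bumps.
  refine ContDiffBump.ae_convolution_tendsto_right_of_locallyIntegrable (K := 2) ?_ ?_ hf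
  · change Tendsto (fun m : ℕ => (2 : ℝ) / (m + 1)) atTop (𝓝 0)
    exact tendsto_const_nhds.div_atTop
      (tendsto_atTop_add_const_right _ _ tendsto_natCast_atTop_atTop)
  · refine Eventually.of_forall fun m => ?_
    change (2 : ℝ) / (m + 1) ≤ 2 * (1 / (m + 1))
    exact le_of_eq (by ring)

/-- Mollification at scale `1/(m+1)` on `L²`. -/
def mollL (n m : ℕ) : LTwo n →L[ℝ] LTwo n := convL (moll n m) (isTest_moll m)

theorem norm_mollL_le (m : ℕ) (f : LTwo n) : ‖mollL n m f‖ ≤ ‖f‖ := by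
  have := norm_convL_le (isTest_moll m) f
  rwa [eLpNorm_moll, ENNReal.toReal_one, one_mul] at this

/-- Strong convergence follows from almost everywhere convergence and contractivity. Fatou applied
to `f + Jₘf → 2f` gives `liminf ‖f + Jₘf‖ ≥ 2‖f‖`, contractivity gives the reverse bound, and the
parallelogram law converts `‖f + Jₘf‖ → 2‖f‖` into `‖f - Jₘf‖ → 0`. -/
theorem tendsto_mollL (f : LTwo n) : Tendsto (fun m => mollL n m f) atTop (𝓝 f) := by
  have hae : ∀ᵐ x, Tendsto (fun m => (f + mollL n m f : LTwo n) x) atTop (𝓝 ((f + f : LTwo n) x)) := by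
    have h1 : ∀ᵐ x, ∀ m, (f + mollL n m f : LTwo n) x = f x + spatialConv (moll n m) f x := by
      rw [ae_all_iff]
      intro m
      filter_upwards [Lp.coeFn_add f (mollL n m f), coeFn_convL (isTest_moll m) f] with x h1 h2
      rw [h1, Pi.add_apply]
      congr 1
    filter_upwards [h1, Lp.coeFn_add f f, ae_tendsto_moll
      (LTwo.locallyIntegrable (Lp.memLp f))] with x h1 h2 h3
    rw [h2, Pi.add_apply]
    simp_rw [h1]
    exact tendsto_const_nhds.add h3
  have hle : eLpNorm (f + f : LTwo n) 2 volume ≤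
      liminf (fun m => eLpNorm (f + mollL n m f : LTwo n) 2 volume) atTop :=
    Lp.eLpNorm_lim_le_liminf_eLpNorm (fun m => (Lp.memLp _).1) _ hae
  have hnorm : ∀ g : LTwo n, eLpNorm g 2 volume = ENNReal.ofReal ‖g‖ := fun g => by
    rw [Lp.norm_def, ENNReal.ofReal_toReal (Lp.memLp g).2.ne]
  have e2 : ‖f + f‖ = 2 * ‖f‖ := by
    rw [← two_smul ℝ f, norm_smul]; simp
  have hub : ∀ m, ‖f + mollL n m f‖ ≤ 2 * ‖f‖ := fun m =>
    (norm_add_le _ _).trans (by linarith [norm_mollL_le m f])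
  have hlim : Tendsto (fun m => eLpNorm (f + mollL n m f : LTwo n) 2 volume) atTop
      (𝓝 (ENNReal.ofReal (2 * ‖f‖))) := by
    rw [hnorm (f + f), e2] at hle
    refine tendsto_of_le_liminf_of_limsup_le hle ?_
    refine limsup_le_of_le (by isBoundedDefault) (Eventually.of_forall fun m => ?_)
    rw [hnorm]
    exact ENNReal.ofReal_le_ofReal (hub m)
  have hlim' : Tendsto (fun m => ‖f + mollL n m f‖) atTop (𝓝 (2 * ‖f‖)) := by
    have := (ENNReal.tendsto_toReal ENNReal.ofReal_ne_top).comp hlim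
    rw [ENNReal.toReal_ofReal (by positivity)] at this
    exact this
  have hsq : Tendsto (fun m => 4 * ‖f‖ ^ 2 - ‖f + mollL n m f‖ ^ 2) atTop (𝓝 0) := by
    have := (hlim'.pow 2).const_sub (4 * ‖f‖ ^ 2)
    convert this using 2
    ring
  have hd : Tendsto (fun m => ‖f - mollL n m f‖ ^ 2) atTop (𝓝 0) := by
    refine squeeze_zero (fun _ => by positivity) (fun m => ?_) hsq
    have := parallelogram_law_with_norm ℝ f (mollL n m f)
    have h1 := norm_mollL_le m f
    have h2 : ‖mollL n m f‖ * ‖mollL n m f‖ ≤ ‖f‖ * ‖f‖ := by gcongr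
    nlinarith
  have hd' : Tendsto (fun m => ‖f - mollL n m f‖) atTop (𝓝 0) := by
    have := (Real.continuous_sqrt.tendsto 0).comp hd
    simpa [Function.comp_def, Real.sqrt_sq] using this
  rw [tendsto_iff_norm_sub_tendsto_zero]
  simpa only [norm_sub_rev] using hd'

end Mollifier

/-! ### The mollified multiplier: skewness, sign against the Laplacian, Hardy bound -/

section Multiplier

variable {n : ℕ} {h : Fin n → EuclideanSpace ℝ (Fin n) → ℝ}
    {Dh : Fin n → Fin n → EuclideanSpace ℝ (Fin n) → ℝ} {d : EuclideanSpace ℝ (Fin n) → ℝ}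
    {Dd DDd : Fin n → EuclideanSpace ℝ (Fin n) → ℝ}

theorem IsMorawetzField.bdd_div (H : IsMorawetzField h Dh d Dd DDd) : IsBddCont d := by
  have : d = fun x => ∑ i, Dh i i x := funext H.div_eq
  rw [this]
  exact IsBddCont.sum _ fun i _ => (H.field i i).bdd_deriv

/-- The first order expression `∑ᵢ hᵢ gᵢ + (div h / 2) f`. -/
def IsMorawetzField.multiplier (H : IsMorawetzField h Dh d Dd DDd) (g : Fin n → LTwo n)
    (f : LTwo n) : LTwo n :=
  ∑ i, mulL (h i) (H.field i i).bdd (g i) + (1 / 2 : ℝ) • mulL d H.bdd_div f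

/-- The mollified multiplier operator `f ↦ h·∇(φ * f) + (div h / 2) (φ * f)`. -/
def IsMorawetzField.multL (H : IsMorawetzField h Dh d Dd DDd) (φ : EuclideanSpace ℝ (Fin n) → ℝ)
    (hφ : IsTest φ) : LTwo n →L[ℝ] LTwo n :=
  ∑ i, (mulL (h i) (H.field i i).bdd).comp (convL (partialDeriv i φ) (hφ.partialDeriv i)) +
    (1 / 2 : ℝ) • (mulL d H.bdd_div).comp (convL φ hφ)

/-- The mollified Laplacian `f ↦ Δ(φ * f)`. -/
def lapL (φ : EuclideanSpace ℝ (Fin n) → ℝ) (hφ : IsTest φ) : LTwo n →L[ℝ] LTwo n :=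
  ∑ j, convL (partialDeriv j (partialDeriv j φ)) ((hφ.partialDeriv j).partialDeriv j)

variable (H : IsMorawetzField h Dh d Dd DDd) {φ : EuclideanSpace ℝ (Fin n) → ℝ} (hφ : IsTest φ)

namespace IsMorawetzField

theorem multL_apply (f : LTwo n) : H.multL φ hφ f =
    H.multiplier (fun i => convL (partialDeriv i φ) (hφ.partialDeriv i) f) (convL φ hφ f) := by
  simp [multL, multiplier]

theorem inner_multiplier (a : LTwo n) (g : Fin n → LTwo n) (f : LTwo n) :
    inner ℝ a (H.multiplier g f) = ∑ i, wpair (h i) a (g i) + 1 / 2 * wpair d a f := by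
  rw [multiplier, inner_add_right, inner_sum, real_inner_smul_right]
  simp only [inner_mulL]

theorem inner_multL (a f : LTwo n) : inner ℝ a (H.multL φ hφ f) =
    ∑ i, wpair (h i) a (spatialConv (partialDeriv i φ) f) +
      1 / 2 * wpair d a (spatialConv φ f) := by
  rw [multL_apply, inner_multiplier]
  congr 1
  · exact Finset.sum_congr rfl fun i _ => wpair_congr (EventuallyEq.refl _ _) (coeFn_convL _ f)
  · rw [wpair_congr (EventuallyEq.refl _ _) (coeFn_convL _ f)]

/-- Used twice: at `u` it removes the mass term of the equation, at `u'` the term in which the time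
derivative falls on the multiplier. -/
theorem inner_convL_multL (f : LTwo n) : inner ℝ (convL φ hφ f) (H.multL φ hφ f) = 0 := by
  rw [inner_multL]
  have := H.skew (hφ.isC1L2_spatialConv (Lp.memLp f))
  rw [← this]
  congr 1
  · exact Finset.sum_congr rfl fun i _ => wpair_congr (coeFn_convL _ f) (EventuallyEq.refl _ _)
  · rw [wpair_congr (coeFn_convL _ f) (EventuallyEq.refl _ _)]

theorem inner_lapL_multL_nonpos (f : LTwo n) :
    inner ℝ (lapL φ hφ f) (H.multL φ hφ f) ≤ 0 := by
  have key := H.laplacian_nonpos (hφ.isC1L2_spatialConv (Lp.memLp f))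
    (fun j => (hφ.partialDeriv j).isC1L2_spatialConv (Lp.memLp f))
    (fun i j x => by rw [hφ.partialDeriv_comm])
  refine le_of_eq_of_le ?_ key
  rw [lapL, _root_.sum_apply, sum_inner]
  refine Finset.sum_congr rfl fun j _ => ?_
  rw [inner_multL]
  congr 1
  · exact Finset.sum_congr rfl fun i _ => wpair_congr (coeFn_convL _ f) (EventuallyEq.refl _ _)
  · rw [wpair_congr (coeFn_convL _ f) (EventuallyEq.refl _ _)]

theorem norm_sum_mulL_sq_le (g : Fin n → LTwo n) :
    ‖∑ i, mulL (h i) (H.field i i).bdd (g i)‖ ^ 2 ≤ ∑ i, ‖g i‖ ^ 2 := by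
  have hns : ∀ f : LTwo n, ‖f‖ ^ 2 = ∫ x, ‖f x‖ ^ 2 := fun f => by
    rw [← real_inner_self_eq_norm_sq, L2.inner_def]
    simp only [real_inner_self_eq_norm_sq]
  have hint : ∀ f : LTwo n, Integrable fun x => ‖f x‖ ^ 2 := fun f =>
    (integrable_inner_of_memLp (Lp.memLp f) (Lp.memLp f)).congr
      (ae_of_all _ fun x => real_inner_self_eq_norm_sq (f x))
  simp only [hns]
  rw [← integral_finsetSum _ fun i _ => hint (g i)]
  refine integral_mono_ae (hint _) (integrable_finsetSum _ fun i _ => hint (g i)) ?_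
  have hall : ∀ᵐ x, ∀ i, mulL (h i) (H.field i i).bdd (g i) x = h i x • g i x := by
    rw [ae_all_iff]
    exact fun i => coeFn_mulL _ _
  have hsum : ((∑ i, mulL (h i) (H.field i i).bdd (g i) : LTwo n) :
      EuclideanSpace ℝ (Fin n) → ℂ) =ᵐ[volume] fun x => ∑ i, mulL (h i) (H.field i i).bdd (g i) x := by
    have := Lp.coeFn_finsetSum Finset.univ fun i => mulL (h i) (H.field i i).bdd (g i)
    filter_upwards [this] with x hx
    rw [hx]
    simp
  filter_upwards [hall, hsum] with x h1 h2
  rw [h2]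
  simp only [h1]
  calc ‖∑ i, h i x • g i x‖ ^ 2 ≤ (∑ i, |h i x| * ‖g i x‖) ^ 2 := by
        gcongr
        refine (norm_sum_le _ _).trans (Finset.sum_le_sum fun j _ => ?_)
        rw [norm_smul, Real.norm_eq_abs]
    _ ≤ (∑ i, |h i x| ^ 2) * ∑ i, ‖g i x‖ ^ 2 := Finset.sum_mul_sq_le_sq_mul_sq _ _ _
    _ ≤ 1 * ∑ i, ‖g i x‖ ^ 2 := by
        gcongr
        simpa only [sq_abs] using H.norm_le x
    _ = _ := one_mul _

/-- In the expanded square the cross term and the square of the zeroth order term have nonpositive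
sum by `hardy_wpair`, and `|h| ≤ 1` bounds what is left. The divergence part thus costs nothing: the
constant is 1, uniformly in the mollifier and in the field. -/
theorem norm_multL_sq_le (f : LTwo n) : ‖H.multL φ hφ f‖ ^ 2 ≤
    ∑ i, ‖convL (partialDeriv i φ) (hφ.partialDeriv i) f‖ ^ 2 := by
  have hv := hφ.isC1L2_spatialConv (Lp.memLp f)
  set g : Fin n → LTwo n := fun i => convL (partialDeriv i φ) (hφ.partialDeriv i) f with hg
  set v := convL φ hφ f with hvdef
  rw [multL_apply, multiplier, norm_add_sq_real]
  have h1 := H.norm_sum_mulL_sq_le g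
  have h2 := H.hardy_wpair hv
  have e1 : inner ℝ (∑ i, mulL (h i) (H.field i i).bdd (g i)) ((1 / 2 : ℝ) • mulL d H.bdd_div v) =
      1 / 2 * ∑ i, wpair (fun x => d x * h i x) (spatialConv φ f)
        (spatialConv (partialDeriv i φ) f) := by
    rw [real_inner_smul_right, sum_inner]
    congr 1
    refine Finset.sum_congr rfl fun i _ => ?_
    rw [inner_mulL]
    refine integral_congr_ae ?_
    filter_upwards [coeFn_mulL (H.field i i).bdd (g i), coeFn_convL hφ f,
      coeFn_convL (hφ.partialDeriv i) f] with x h1 h2 h3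
    rw [h1, h2, h3, real_inner_smul_left, real_inner_comm]
    ring
  have e2 : ‖(1 / 2 : ℝ) • mulL d H.bdd_div v‖ ^ 2 =
      1 / 4 * wpair (fun x => d x * d x) (spatialConv φ f) (spatialConv φ f) := by
    rw [norm_smul, mul_pow, ← real_inner_self_eq_norm_sq (mulL d H.bdd_div v), inner_mulL]
    have : wpair d (mulL d H.bdd_div v) v =
        wpair (fun x => d x * d x) (spatialConv φ f) (spatialConv φ f) := by
      refine integral_congr_ae ?_
      filter_upwards [coeFn_mulL H.bdd_div v, coeFn_convL hφ f] with x h1 h2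
      rw [h1, h2, real_inner_smul_left]
      ring
    rw [this]
    norm_num
  rw [e1, e2]
  linarith

end IsMorawetzField

end Multiplier

/-! ### Weak gradients and the gradient of `|u|²` -/

section WeakGradients

variable {n : ℕ}

/-- The space `L²(ℝⁿ; ℂⁿ)`. -/
abbrev LTwoVec (n : ℕ) : Type :=
  Lp (EuclideanSpace ℂ (Fin n)) 2 (volume : Measure (EuclideanSpace ℝ (Fin n)))

/-- The `i`-th component of a square integrable vector field. -/
def gradComp (i : Fin n) : LTwoVec n →L[ℂ] LTwo n :=
  (EuclideanSpace.proj i : EuclideanSpace ℂ (Fin n) →L[ℂ] ℂ).compLpL 2 volume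

theorem coeFn_gradComp (i : Fin n) (g : LTwoVec n) :
    gradComp i g =ᵐ[volume] fun x => g x i :=
  ContinuousLinearMap.coeFn_compLpL _ g

theorem norm_sq_eq_integral {F : Type*} [NormedAddCommGroup F] [InnerProductSpace ℝ F]
    (f : Lp F 2 (volume : Measure (EuclideanSpace ℝ (Fin n)))) : ‖f‖ ^ 2 = ∫ x, ‖f x‖ ^ 2 := by
  rw [← real_inner_self_eq_norm_sq, L2.inner_def]
  simp only [real_inner_self_eq_norm_sq]

theorem integrable_norm_sq {F : Type*} [NormedAddCommGroup F]
    (f : Lp F 2 (volume : Measure (EuclideanSpace ℝ (Fin n)))) :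
    Integrable fun x => ‖f x‖ ^ 2 := (Lp.memLp f).integrable_norm_pow two_ne_zero

theorem sum_norm_gradComp_sq (g : LTwoVec n) : ∑ i, ‖gradComp i g‖ ^ 2 = ‖g‖ ^ 2 := by
  have hg : ‖g‖ ^ 2 = ∫ x, ‖g x‖ ^ 2 := by
    rw [← inner_self_eq_norm_sq (𝕜 := ℂ), L2.inner_def, ← integral_re]
    · simp only [inner_self_eq_norm_sq]
    · exact L2.integrable_inner g g
  rw [hg]
  simp only [norm_sq_eq_integral]
  rw [← integral_finsetSum _ fun i _ => integrable_norm_sq (gradComp i g)]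
  refine integral_congr_ae ?_
  have : ∀ᵐ x, ∀ i, gradComp i g x = g x i := by
    rw [ae_all_iff]; exact fun i => coeFn_gradComp i g
  filter_upwards [this] with x hx
  rw [EuclideanSpace.norm_sq_eq]
  simp only [hx]

namespace IsWeakGradient

theorem integral_gradComp {u : LTwo n} {g : LTwoVec n} (h : IsWeakGradient u g)
    {φ : EuclideanSpace ℝ (Fin n) → ℝ} (hφ : IsTest φ) (i : Fin n) :
    ∫ x, partialDeriv i φ x • u x = - ∫ x, φ x • gradComp i g x := by
  rw [h.integral_eq φ hφ.contDiff hφ.hasCompactSupport i]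
  congr 1
  refine integral_congr_ae ?_
  filter_upwards [coeFn_gradComp i g] with x hx
  rw [hx]

/-- This is the definition of the weak gradient with test function `y ↦ φ(x - y)`; reflection
changes the sign of the derivative and so cancels the minus sign. -/
theorem convL_partialDeriv {u : LTwo n} {g : LTwoVec n} (h : IsWeakGradient u g)
    {φ : EuclideanSpace ℝ (Fin n) → ℝ} (hφ : IsTest φ) (i : Fin n) :
    convL (partialDeriv i φ) (hφ.partialDeriv i) u = convL φ hφ (gradComp i g) := by
  refine Lp.ext ?_
  refine (coeFn_convL _ u).trans (EventuallyEq.trans ?_ (coeFn_convL _ _).symm)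
  refine ae_of_all _ fun x => ?_
  rw [spatialConv_eq_swap, spatialConv_eq_swap]
  have := h.integral_gradComp (hφ.comp_sub_left x) i
  rw [hφ.partialDeriv_comp_sub_left] at this
  simp only [neg_smul, integral_neg, neg_inj] at this
  exact this

variable {𝕜 : Type*} [RCLike 𝕜]

theorem locallyIntegrable_comp {f : EuclideanSpace ℝ (Fin n) → 𝕜}
    {G : EuclideanSpace ℝ (Fin n) → EuclideanSpace 𝕜 (Fin n)} (h : IsWeakGradient f G)
    (i : Fin n) : LocallyIntegrable fun x => G x i := by
  intro x
  obtain ⟨s, hs, hi⟩ := h.locallyIntegrable_grad x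
  exact ⟨s, hs, (EuclideanSpace.proj (𝕜 := 𝕜) i).integrable_comp hi⟩

theorem ae_eq {f : EuclideanSpace ℝ (Fin n) → 𝕜}
    {G G' : EuclideanSpace ℝ (Fin n) → EuclideanSpace 𝕜 (Fin n)} (h : IsWeakGradient f G)
    (h' : IsWeakGradient f G') : G =ᵐ[volume] G' := by
  have : ∀ᵐ x, ∀ i, G x i = G' x i := by
    rw [ae_all_iff]
    intro i
    refine ae_eq_of_integral_contDiff_smul_eq (h.locallyIntegrable_comp i)
      (h'.locallyIntegrable_comp i) fun φ hφ hc => ?_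
    rw [← neg_inj, ← h.integral_eq φ hφ hc i, ← h'.integral_eq φ hφ hc i]
  filter_upwards [this] with x hx
  ext i
  exact hx i

/-- `weakGradient` is an arbitrary choice; almost everywhere uniqueness lets any explicit gradient
replace it under an integral. -/
theorem weakGradient_ae_eq {f : EuclideanSpace ℝ (Fin n) → 𝕜}
    {G : EuclideanSpace ℝ (Fin n) → EuclideanSpace 𝕜 (Fin n)} (h : IsWeakGradient f G) :
    weakGradient f =ᵐ[volume] G := by
  have hex : ∃ G, IsWeakGradient f G := ⟨G, h⟩
  rw [weakGradient, dif_pos hex]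
  exact hex.choose_spec.ae_eq h

end IsWeakGradient

theorem IsTest.isC1Bdd {φ : EuclideanSpace ℝ (Fin n) → ℝ} (hφ : IsTest φ) (i : Fin n) :
    IsC1Bdd i φ (_root_.partialDeriv i φ) :=
  ⟨fun x => (hφ.differentiable x).hasFDerivAt.hasLineDerivAt _, hφ.isBddCont,
    (hφ.partialDeriv i).isBddCont⟩

/-- The product rule `∂ᵢ|u|² = 2⟨u, ∂ᵢu⟩` in weak form. It holds classically for the mollifications
of `u`, and both sides are continuous under `L²` convergence of `u` and of its gradient. -/
theorem wpair_gradComp {u : LTwo n} {g : LTwoVec n} (h : IsWeakGradient u g)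
    {φ : EuclideanSpace ℝ (Fin n) → ℝ} (hφ : IsTest φ) (i : Fin n) :
    wpair φ u (gradComp i g) = -(1 / 2) * wpair (partialDeriv i φ) u u := by
  have key : ∀ m, inner ℝ (mollL n m u) (mulL φ hφ.isBddCont (mollL n m (gradComp i g))) =
      -(1 / 2) * inner ℝ (mollL n m u)
        (mulL (partialDeriv i φ) (hφ.partialDeriv i).isBddCont (mollL n m u)) := fun m => by
    have h1 := wpair_deriv_self (hφ.isC1Bdd i) ((isTest_moll m).isC1L2_spatialConv (Lp.memLp u))
    have h2 := h.convL_partialDeriv (isTest_moll m) i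
    rw [inner_mulL, inner_mulL, mollL, ← h2, wpair_congr (coeFn_convL _ u) (coeFn_convL _ u),
      wpair_congr (coeFn_convL _ u) (coeFn_convL _ u), h1]
  have l1 : Tendsto (fun m => inner ℝ (mollL n m u)
      (mulL φ hφ.isBddCont (mollL n m (gradComp i g)))) atTop
      (𝓝 (inner ℝ u (mulL φ hφ.isBddCont (gradComp i g)))) :=
    (tendsto_mollL u).inner (((mulL φ hφ.isBddCont).continuous.tendsto _).comp (tendsto_mollL _))
  have l2 : Tendsto (fun m => -(1 / 2) * inner ℝ (mollL n m u)
      (mulL (partialDeriv i φ) (hφ.partialDeriv i).isBddCont (mollL n m u))) atTop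
      (𝓝 (-(1 / 2) * inner ℝ u (mulL (partialDeriv i φ) (hφ.partialDeriv i).isBddCont u))) :=
    ((tendsto_mollL u).inner (((mulL _ (hφ.partialDeriv i).isBddCont).continuous.tendsto _).comp
      (tendsto_mollL _))).const_mul _
  have := tendsto_nhds_unique (l1.congr key) l2
  rwa [inner_mulL, inner_mulL] at this

/-- The vector field `2 Re (ū g)`, the gradient of `|u|²` when `g = ∇u`. -/
def densityGrad (u : LTwo n) (g : LTwoVec n) (x : EuclideanSpace ℝ (Fin n)) :
    EuclideanSpace ℝ (Fin n) :=
  WithLp.toLp 2 fun i => 2 * inner ℝ (u x) (gradComp i g x)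

theorem integrable_densityGrad_apply (u : LTwo n) (g : LTwoVec n) (i : Fin n) :
    Integrable fun x => densityGrad u g x i :=
  (integrable_inner_of_memLp (Lp.memLp u) (Lp.memLp (gradComp i g))).const_mul 2

theorem integrable_densityGrad (u : LTwo n) (g : LTwoVec n) : Integrable (densityGrad u g) := by
  have h : Integrable fun x => (fun i => densityGrad u g x i) :=
    Integrable.of_eval fun i => integrable_densityGrad_apply u g i
  exact (PiLp.continuousLinearEquiv 2 ℝ (fun _ : Fin n => ℝ)).symm.toContinuousLinearMap.integrable_comp h

theorem IsWeakGradient.norm_sq {u : LTwo n} {g : LTwoVec n} (h : IsWeakGradient u g) :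
    IsWeakGradient (fun y => ‖u y‖ ^ 2) (densityGrad u g) := by
  refine ⟨(integrable_norm_sq u).locallyIntegrable, (integrable_densityGrad u g).locallyIntegrable,
    fun φ hφ hc i => ?_⟩
  have := wpair_gradComp h ⟨hφ, hc⟩ i
  have e1 : ∫ x, partialDeriv i φ x • ‖u x‖ ^ 2 = wpair (partialDeriv i φ) u u := by
    simp only [wpair, real_inner_self_eq_norm_sq, smul_eq_mul]
  have e2 : ∫ x, φ x • densityGrad u g x i = 2 * wpair φ u (gradComp i g) := by
    rw [wpair, ← integral_const_mul]
    refine integral_congr_ae (ae_of_all _ fun x => ?_)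
    simp only [densityGrad, smul_eq_mul]
    ring
  rw [e1, e2, this]
  ring

end WeakGradients

/-! ### The Hartree nonlinearity for a bounded potential -/

section BoundedPotential

variable {n : ℕ} {U : EuclideanSpace ℝ (Fin n) → ℝ} {K : ℝ}

theorem aestronglyMeasurable_hartree {V : EuclideanSpace ℝ (Fin n) → ℝ}
    (hV : AEStronglyMeasurable V) {w : EuclideanSpace ℝ (Fin n) → ℂ}
    (hw : AEStronglyMeasurable w) : AEStronglyMeasurable (hartree V w) :=
  (aestronglyMeasurable_spatialConv hV (hw.norm.pow 2)).smul hw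

theorem integral_norm_mul_norm_le (f g : LTwo n) :
    ∫ x, ‖f x‖ * ‖g x‖ ≤ ‖f‖ * ‖g‖ := by
  have h := real_inner_le_norm ((Lp.memLp f).norm.toLp _) ((Lp.memLp g).norm.toLp _)
  have hn : ∀ f : LTwo n, ‖(Lp.memLp f).norm.toLp _‖ = ‖f‖ := fun f => by
    rw [Lp.norm_toLp, eLpNorm_norm, Lp.norm_def]
  rw [hn, hn, L2.inner_def] at h
  refine le_trans (le_of_eq ?_) h
  refine integral_congr_ae ?_
  filter_upwards [(Lp.memLp f).norm.coeFn_toLp, (Lp.memLp g).norm.coeFn_toLp] with x h1 h2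
  rw [h1, h2, real_inner_eq_re_inner ℝ]
  simp [mul_comm]

theorem abs_spatialConv_le (hU : ∀ z, |U z| ≤ K) {f : EuclideanSpace ℝ (Fin n) → ℝ}
    (hf : Integrable f) (x : EuclideanSpace ℝ (Fin n)) : |spatialConv U f x| ≤ K * ∫ y, ‖f y‖ := by
  rw [spatialConv_def, ← Real.norm_eq_abs]
  calc ‖∫ z, U z • f (x - z)‖ ≤ ∫ z, K * ‖f (x - z)‖ := by
        refine norm_integral_le_of_norm_le ((hf.comp_sub_left x).norm.const_mul K)
          (ae_of_all _ fun z => ?_)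
        rw [norm_smul, Real.norm_eq_abs]
        exact mul_le_mul_of_nonneg_right (hU z) (norm_nonneg _)
    _ = _ := by rw [integral_const_mul, integral_sub_left_eq_self (fun y => ‖f y‖) volume x]

theorem integrable_spatialConv_integrand (hUm : AEStronglyMeasurable U) (hU : ∀ z, |U z| ≤ K)
    {f : EuclideanSpace ℝ (Fin n) → ℝ}
    (hf : Integrable f) (x : EuclideanSpace ℝ (Fin n)) : Integrable fun z => U z • f (x - z) :=
  (hf.comp_sub_left x).bdd_mul hUm (ae_of_all _ hU)

theorem abs_spatialConv_sq_le (hU : ∀ z, |U z| ≤ K) (w : LTwo n)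
    (x : EuclideanSpace ℝ (Fin n)) : |spatialConv U (fun y => ‖w y‖ ^ 2) x| ≤ K * ‖w‖ ^ 2 := by
  refine (abs_spatialConv_le hU (integrable_norm_sq w) x).trans (le_of_eq ?_)
  rw [norm_sq_eq_integral]
  simp only [norm_pow, norm_norm]

/-- The factorisation `|w|² - |w'|² = ⟨w - w', w + w'⟩` and Cauchy–Schwarz bound the `L¹` norm of
the difference of densities. -/
theorem abs_spatialConv_sq_sub_le (hUm : AEStronglyMeasurable U) (hU : ∀ z, |U z| ≤ K)
    (w w' : LTwo n) (x : EuclideanSpace ℝ (Fin n)) :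
    |spatialConv U (fun y => ‖w y‖ ^ 2) x - spatialConv U (fun y => ‖w' y‖ ^ 2) x| ≤
      K * (‖w - w'‖ * ‖w + w'‖) := by
  have hK : 0 ≤ K := (abs_nonneg _).trans (hU 0)
  have e : spatialConv U (fun y => ‖w y‖ ^ 2) x - spatialConv U (fun y => ‖w' y‖ ^ 2) x =
      spatialConv U (fun y => ‖w y‖ ^ 2 - ‖w' y‖ ^ 2) x := by
    simp only [spatialConv_def]
    rw [← integral_sub (integrable_spatialConv_integrand hUm hU (integrable_norm_sq w) x)
      (integrable_spatialConv_integrand hUm hU (integrable_norm_sq w') x)]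
    simp only [smul_sub]
  rw [e]
  refine (abs_spatialConv_le hU ((integrable_norm_sq w).sub (integrable_norm_sq w')) x).trans ?_
  gcongr
  refine le_trans ?_ (integral_norm_mul_norm_le _ _)
  have hint : Integrable fun x => ‖(w - w' : LTwo n) x‖ * ‖(w + w' : LTwo n) x‖ :=
    (Lp.memLp (w - w')).norm.integrable_mul (Lp.memLp (w + w')).norm
  refine integral_mono_ae ((integrable_norm_sq w).sub (integrable_norm_sq w')).norm hint ?_
  filter_upwards [Lp.coeFn_sub w w', Lp.coeFn_add w w'] with y h1 h2
  rw [h1, h2, Pi.sub_apply, Pi.add_apply]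
  have : ‖w y‖ ^ 2 - ‖w' y‖ ^ 2 = inner ℝ (w y - w' y) (w y + w' y) := by
    rw [inner_sub_left, inner_add_right, inner_add_right, real_inner_self_eq_norm_sq,
      real_inner_self_eq_norm_sq, real_inner_comm]
    ring
  simp only [Pi.sub_apply]
  rw [this]
  exact norm_inner_le_norm _ _

theorem memLp_hartree_of_bounded (hUm : AEStronglyMeasurable U) (hU : ∀ z, |U z| ≤ K)
    (w : LTwo n) : MemLp (hartree U w) 2 := by
  refine MemLp.of_le_mul (c := K * ‖w‖ ^ 2) (Lp.memLp w)
    (aestronglyMeasurable_hartree hUm (Lp.memLp w).1) (ae_of_all _ fun x => ?_)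
  rw [hartree, norm_smul, Real.norm_eq_abs]
  exact mul_le_mul_of_nonneg_right (abs_spatialConv_sq_le hU w x) (norm_nonneg _)

open Classical in
/-- The Hartree nonlinearity as an element of `L²`, and `0` when it is not square integrable. -/
def hartreeLp (V : EuclideanSpace ℝ (Fin n) → ℝ) (w : LTwo n) : LTwo n :=
  if h : MemLp (hartree V w) 2 then h.toLp else 0

theorem hartreeLp_eq {V : EuclideanSpace ℝ (Fin n) → ℝ} {w : LTwo n}
    (h : MemLp (hartree V w) 2) : hartreeLp V w = h.toLp := dif_pos h

theorem coeFn_hartreeLp {V : EuclideanSpace ℝ (Fin n) → ℝ} {w : LTwo n}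
    (h : MemLp (hartree V w) 2) : hartreeLp V w =ᵐ[volume] hartree V w := by
  rw [hartreeLp_eq h]
  exact h.coeFn_toLp

/-- The difference is split as `(U * |w|² - U * |w'|²) w + (U * |w'|²)(w - w')`. -/
theorem norm_hartreeLp_sub_le (hUm : AEStronglyMeasurable U) (hU : ∀ z, |U z| ≤ K)
    (w w' : LTwo n) : ‖hartreeLp U w - hartreeLp U w'‖ ≤
      K * (‖w - w'‖ * ‖w + w'‖) * ‖w‖ + K * ‖w'‖ ^ 2 * ‖w - w'‖ := by
  have m1 : MemLp (fun x => (spatialConv U (fun y => ‖w y‖ ^ 2) x -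
      spatialConv U (fun y => ‖w' y‖ ^ 2) x) • w x) 2 := by
    refine MemLp.of_le_mul (c := K * (‖w - w'‖ * ‖w + w'‖)) (Lp.memLp w) ?_
      (ae_of_all _ fun x => ?_)
    · exact ((aestronglyMeasurable_spatialConv hUm ((Lp.memLp w).1.norm.pow 2)).sub
        (aestronglyMeasurable_spatialConv hUm ((Lp.memLp w').1.norm.pow 2))).smul (Lp.memLp w).1
    · rw [norm_smul, Real.norm_eq_abs]
      exact mul_le_mul_of_nonneg_right (abs_spatialConv_sq_sub_le hUm hU w w' x) (norm_nonneg _)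
  have m2 : MemLp (fun x => spatialConv U (fun y => ‖w' y‖ ^ 2) x • (w - w' : LTwo n) x) 2 := by
    refine MemLp.of_le_mul (c := K * ‖w'‖ ^ 2) (Lp.memLp (w - w')) ?_ (ae_of_all _ fun x => ?_)
    · exact (aestronglyMeasurable_spatialConv hUm ((Lp.memLp w').1.norm.pow 2)).smul
        (Lp.memLp (w - w')).1
    · rw [norm_smul, Real.norm_eq_abs]
      exact mul_le_mul_of_nonneg_right (abs_spatialConv_sq_le hU w' x) (norm_nonneg _)
  have e : hartreeLp U w - hartreeLp U w' = m1.toLp + m2.toLp := by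
    refine Lp.ext ?_
    filter_upwards [Lp.coeFn_sub (hartreeLp U w) (hartreeLp U w'),
      coeFn_hartreeLp (memLp_hartree_of_bounded hUm hU w),
      coeFn_hartreeLp (memLp_hartree_of_bounded hUm hU w'), Lp.coeFn_add m1.toLp m2.toLp,
      m1.coeFn_toLp, m2.coeFn_toLp, Lp.coeFn_sub w w'] with x h1 h2 h3 h4 h5 h6 h7
    rw [h1, h4, Pi.sub_apply, Pi.add_apply, h2, h3, h5, h6, h7, Pi.sub_apply]
    simp only [hartree]
    module
  rw [e]
  refine (norm_add_le _ _).trans (add_le_add ?_ ?_)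
  · refine Lp.norm_le_mul_norm_of_ae_le_mul ?_
    filter_upwards [m1.coeFn_toLp] with x hx
    rw [hx, norm_smul, Real.norm_eq_abs]
    exact mul_le_mul_of_nonneg_right (abs_spatialConv_sq_sub_le hUm hU w w' x) (norm_nonneg _)
  · refine Lp.norm_le_mul_norm_of_ae_le_mul ?_
    filter_upwards [m2.coeFn_toLp] with x hx
    rw [hx, norm_smul, Real.norm_eq_abs]
    exact mul_le_mul_of_nonneg_right (abs_spatialConv_sq_le hU w' x) (norm_nonneg _)

/-- Needed for measurability in time: for a general potential, `τ ↦ F(u(τ))` will be an almost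
everywhere limit of the continuous maps obtained from truncated potentials. -/
theorem continuous_hartreeLp_of_bounded (hUm : AEStronglyMeasurable U) (hU : ∀ z, |U z| ≤ K) :
    Continuous (hartreeLp U) := by
  rw [continuous_iff_continuousAt]
  intro w'
  rw [ContinuousAt, tendsto_iff_norm_sub_tendsto_zero]
  refine squeeze_zero (fun _ => norm_nonneg _) (fun w => norm_hartreeLp_sub_le hUm hU w w') ?_
  have : Continuous fun w : LTwo n =>
      K * (‖w - w'‖ * ‖w + w'‖) * ‖w‖ + K * ‖w'‖ ^ 2 * ‖w - w'‖ := by fun_prop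
  simpa using this.tendsto w'

end BoundedPotential

/-! ### The Hartree nonlinearity for a general potential -/

section GeneralPotential

variable {n : ℕ} {p₁ p₂ r : ℝ≥0∞} {V : EuclideanSpace ℝ (Fin n) → ℝ}

/-- The truncation of a function to the values `[-k, k]`. -/
def clampFun (V : EuclideanSpace ℝ (Fin n) → ℝ) (k : ℕ) (z : EuclideanSpace ℝ (Fin n)) : ℝ :=
  max (-(k : ℝ)) (min (V z) k)

theorem aestronglyMeasurable_clampFun (hV : AEStronglyMeasurable V) (k : ℕ) :
    AEStronglyMeasurable (clampFun V k) :=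
  (continuous_const.max (continuous_id.min continuous_const) :
    Continuous fun t : ℝ => max (-(k : ℝ)) (min t k)).comp_aestronglyMeasurable hV

theorem abs_clampFun_le (k : ℕ) (z : EuclideanSpace ℝ (Fin n)) : |clampFun V k z| ≤ k := by
  have hk : (0 : ℝ) ≤ k := Nat.cast_nonneg k
  unfold clampFun
  rw [abs_le]
  exact ⟨le_max_left _ _, max_le (by linarith) (min_le_right _ _)⟩

theorem abs_clampFun_le_abs (k : ℕ) (z : EuclideanSpace ℝ (Fin n)) :
    |clampFun V k z| ≤ |V z| := by
  have hk : (0 : ℝ) ≤ k := Nat.cast_nonneg k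
  unfold clampFun
  rw [abs_le]
  constructor
  · rcases le_total (V z) k with h | h
    · rw [min_eq_left h]; exact (neg_abs_le _).trans (le_max_right _ _)
    · rw [min_eq_right h]; exact le_trans (by linarith [abs_nonneg (V z)]) (le_max_right _ _)
  · exact max_le (by linarith [abs_nonneg (V z)]) ((min_le_left _ _).trans (le_abs_self _))

theorem tendsto_clampFun (z : EuclideanSpace ℝ (Fin n)) :
    Tendsto (fun k => clampFun V k z) atTop (𝓝 (V z)) := by
  refine tendsto_const_nhds.congr' ?_
  filter_upwards [eventually_ge_atTop ⌈|V z|⌉₊] with k hk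
  have : |V z| ≤ k := Nat.ceil_le.1 hk
  rw [abs_le] at this
  unfold clampFun
  rw [min_eq_left this.2, max_eq_right this.1]

/-- A pointwise majorant of the Hartree nonlinearity. -/
def hartreeMaj (V : EuclideanSpace ℝ (Fin n) → ℝ) (w : EuclideanSpace ℝ (Fin n) → ℂ)
    (x : EuclideanSpace ℝ (Fin n)) : ℝ≥0∞ :=
  (∫⁻ z, ‖V z‖ₑ * ‖w (x - z)‖ₑ ^ 2) * ‖w x‖ₑ

theorem enorm_hartree_le_hartreeMaj (V : EuclideanSpace ℝ (Fin n) → ℝ)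
    (w : EuclideanSpace ℝ (Fin n) → ℂ) (x : EuclideanSpace ℝ (Fin n)) :
    ‖hartree V w x‖ₑ ≤ hartreeMaj V w x := by
  rw [hartree, enorm_smul, hartreeMaj]
  gcongr
  refine (enorm_spatialConv_le V _ x).trans (le_of_eq ?_)
  simp only [enorm_pow, enorm_norm]

theorem hartreeMaj_mono {U : EuclideanSpace ℝ (Fin n) → ℝ} (h : ∀ z, |U z| ≤ |V z|)
    (w : EuclideanSpace ℝ (Fin n) → ℂ) (x : EuclideanSpace ℝ (Fin n)) :
    hartreeMaj U w x ≤ hartreeMaj V w x := by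
  unfold hartreeMaj
  gcongr with z
  exact enorm_le_iff_norm_le.2 (h z)

theorem aemeasurable_hartreeMaj (hV : AEStronglyMeasurable V)
    {w : EuclideanSpace ℝ (Fin n) → ℂ} (hw : AEStronglyMeasurable w) :
    AEMeasurable (hartreeMaj V w) :=
  (aemeasurable_lintegral_conv hV.enorm (hw.enorm.pow_const 2)).mul hw.enorm

theorem lintegral_hartreeMaj_mul (hV : AEStronglyMeasurable V)
    {w : EuclideanSpace ℝ (Fin n) → ℂ} (hw : AEStronglyMeasurable w)
    (k : EuclideanSpace ℝ (Fin n) → ℝ≥0∞) :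
    ∫⁻ x, hartreeMaj V w x * k x =
      triform (fun z => ‖V z‖ₑ) (fun x => ‖w x‖ₑ * k x) (fun x => ‖w x‖ₑ ^ 2) := by
  rw [← lintegral_mul_conv_eq_triform hV.enorm (hw.enorm.pow_const 2)]
  refine lintegral_congr fun x => ?_
  rw [hartreeMaj]
  ring

/-- Paired with `k`, the majorant is a trilinear form already estimated by `‖k‖₂`, so duality gives
its `L²` norm. The majorant is bounded, not just the nonlinearity, because it also dominates all
truncations of `V`. -/
theorem IsHartreePotential.exists_hartreeMaj_le (hV : IsHartreePotential n p₁ p₂ V)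
    (hr : r⁻¹ + (3 * p₂)⁻¹ = 2⁻¹) : ∃ C : ℝ≥0∞, C ≠ ⊤ ∧
      ∀ w : EuclideanSpace ℝ (Fin n) → ℂ, AEStronglyMeasurable w →
      (∫⁻ x, hartreeMaj V w x ^ (2 : ℝ)) ^ (1 / 2 : ℝ) ≤ C * cubeNorm r w := by
  obtain ⟨C, hC, h⟩ := hV.exists_triform_le hr
  refine ⟨C, hC, fun w hw => lintegral_sq_le_of_dual
    (aemeasurable_hartreeMaj hV.aestronglyMeasurable hw) fun k hk => ?_⟩
  rw [lintegral_hartreeMaj_mul hV.aestronglyMeasurable hw]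
  exact (h w k hw hk).1

theorem eLpNorm_hartree_le (V : EuclideanSpace ℝ (Fin n) → ℝ)
    (w : EuclideanSpace ℝ (Fin n) → ℂ) :
    eLpNorm (hartree V w) 2 volume ≤ (∫⁻ x, hartreeMaj V w x ^ (2 : ℝ)) ^ (1 / 2 : ℝ) := by
  rw [eLpNorm_two_eq]
  gcongr with x
  exact enorm_hartree_le_hartreeMaj V w x

theorem tendsto_hartree_clampFun (hV : AEStronglyMeasurable V)
    {w : EuclideanSpace ℝ (Fin n) → ℂ} (hw : AEStronglyMeasurable w)
    {x : EuclideanSpace ℝ (Fin n)} (hx : hartreeMaj V w x ≠ ⊤) :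
    Tendsto (fun k => hartree (clampFun V k) w x) atTop (𝓝 (hartree V w x)) := by
  rcases eq_or_ne (w x) 0 with h0 | h0
  · simp only [hartree, h0, smul_zero]
    exact tendsto_const_nhds
  have hfin : ∫⁻ z, ‖V z‖ₑ * ‖w (x - z)‖ₑ ^ 2 ≠ ⊤ := fun htop => hx (by
    rw [hartreeMaj, htop, ENNReal.top_mul (by simpa using h0)])
  have hwx : AEStronglyMeasurable fun z => ‖w (x - z)‖ ^ 2 :=
    (hw.comp_quasiMeasurePreserving (quasiMeasurePreserving_sub_left volume x)).norm.pow 2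
  have hint : Integrable fun z => |V z| * ‖w (x - z)‖ ^ 2 := by
    refine ⟨hV.norm.mul hwx, ?_⟩
    refine lt_of_le_of_lt (lintegral_mono fun z => ?_) hfin.lt_top
    rw [enorm_mul, Real.enorm_abs, enorm_pow, enorm_norm]
  refine Tendsto.smul_const ?_ (w x)
  refine tendsto_integral_of_dominated_convergence (fun z => |V z| * ‖w (x - z)‖ ^ 2)
    (fun k => (aestronglyMeasurable_clampFun hV k).smul hwx) hint (fun k => ae_of_all _ fun z => ?_)
    (ae_of_all _ fun z => (tendsto_clampFun z).smul_const _)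
  rw [ContinuousLinearMap.lsmul_apply, norm_smul, Real.norm_eq_abs, norm_pow, norm_norm]
  exact mul_le_mul_of_nonneg_right (abs_clampFun_le_abs k z) (by positivity)

/-- Dominated convergence is used twice: in the convolution variable at each point where the
majorant is finite, then in `x` with dominating function `(2 * hartreeMaj V w)²`. -/
theorem tendsto_hartreeLp_clampFun (hV : AEStronglyMeasurable V) {w : LTwo n}
    (hw : ∫⁻ x, hartreeMaj V w x ^ (2 : ℝ) ≠ ⊤) :
    Tendsto (fun k => hartreeLp (clampFun V k) w) atTop (𝓝 (hartreeLp V w)) := by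
  have hwm := (Lp.memLp w).1
  have hmaj := aemeasurable_hartreeMaj hV hwm
  have hmem : MemLp (hartree V w) 2 := ⟨aestronglyMeasurable_hartree hV hwm,
    (eLpNorm_hartree_le V w).trans_lt (ENNReal.rpow_lt_top_of_nonneg (by norm_num) hw)⟩
  have hmemk : ∀ k, MemLp (hartree (clampFun V k) w) 2 := fun k =>
    memLp_hartree_of_bounded (aestronglyMeasurable_clampFun hV k) (abs_clampFun_le k) w
  rw [hartreeLp_eq hmem]
  simp_rw [fun k => hartreeLp_eq (hmemk k)]
  rw [Lp.tendsto_Lp_iff_tendsto_eLpNorm'']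
  have hfin : ∀ᵐ x, hartreeMaj V w x ≠ ⊤ := by
    filter_upwards [ae_lt_top' (hmaj.pow_const 2) hw] with x hx htop
    rw [htop] at hx
    simp at hx
  have hlim : Tendsto (fun k => ∫⁻ x, ‖hartree (clampFun V k) w x - hartree V w x‖ₑ ^ (2 : ℝ))
      atTop (𝓝 (∫⁻ _ : EuclideanSpace ℝ (Fin n), 0)) := by
    refine tendsto_lintegral_of_dominated_convergence'
      (fun x => (2 * hartreeMaj V w x) ^ (2 : ℝ)) (fun k => ?_) (fun k => ae_of_all _ fun x => ?_)
      ?_ ?_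
    · exact ((hmemk k).1.sub hmem.1).enorm.pow_const 2
    · refine ENNReal.rpow_le_rpow ?_ (by norm_num)
      refine (enorm_sub_le).trans ?_
      rw [two_mul]
      exact add_le_add ((enorm_hartree_le_hartreeMaj _ _ _).trans
        (hartreeMaj_mono (abs_clampFun_le_abs k) _ x)) (enorm_hartree_le_hartreeMaj _ _ _)
    · simp_rw [ENNReal.mul_rpow_of_nonneg _ _ (zero_le_two (α := ℝ))]
      rw [lintegral_const_mul'' _ (hmaj.pow_const 2)]
      exact ENNReal.mul_ne_top (ENNReal.rpow_ne_top_of_nonneg (by norm_num) (by simp)) hw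
    · filter_upwards [hfin] with x hx
      have h1 := tendsto_hartree_clampFun hV hwm hx
      have h2 := (h1.sub_const (hartree V w x)).enorm
      have h3 := ((ENNReal.continuous_rpow_const (y := 2)).tendsto _).comp h2
      simpa [Function.comp_def] using h3
  have h2 := ((ENNReal.continuous_rpow_const (y := 1 / 2)).tendsto _).comp hlim
  rw [lintegral_zero, ENNReal.zero_rpow_of_pos (by norm_num)] at h2
  refine h2.congr fun k => ?_
  rw [eLpNorm_two_eq]
  rfl

/-- `L²` convergence gives almost everywhere convergence of a subsequence, and Fatou does the rest.
The solution is continuous in time only with values in `L²`, so this is what makes its `L^r` norm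
measurable in time. -/
theorem lowerSemicontinuous_eLpNorm (r : ℝ≥0∞) :
    LowerSemicontinuous fun w : LTwo n => eLpNorm w r volume := by
  rw [lowerSemicontinuous_iff_isClosed_preimage]
  intro c
  refine IsSeqClosed.isClosed fun w w' hw hlim => ?_
  obtain ⟨ns, -, hns⟩ := (tendstoInMeasure_of_tendsto_Lp hlim).exists_seq_tendsto_ae
  refine (Lp.eLpNorm_lim_le_liminf_eLpNorm (fun k => (Lp.memLp (w (ns k))).1) _ hns).trans ?_
  refine liminf_le_of_le (by isBoundedDefault) fun b hb => ?_
  obtain ⟨m, hm⟩ := hb.exists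
  exact hm.trans (hw (ns m))

theorem measurable_cubeNorm (r : ℝ≥0∞) {u : ℝ → LTwo n} (hu : Continuous u) :
    Measurable fun τ => cubeNorm r (u τ) :=
  (((lowerSemicontinuous_eLpNorm 2).comp hu).measurable.pow_const 3).add
    (((lowerSemicontinuous_eLpNorm r).comp hu).measurable.pow_const 3)

end GeneralPotential

/-! ### Product rule for an absolutely continuous and a `C¹` curve -/

section ProductRule

variable {E : Type*} [NormedAddCommGroup E] [InnerProductSpace ℝ E]

theorem intervalIntegrable_inner_of_continuous {f z : ℝ → E} {s t : ℝ} (hst : s ≤ t)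
    (hf : IntervalIntegrable f volume s t) (hz : Continuous z) :
    IntervalIntegrable (fun τ => inner ℝ (f τ) (z τ)) volume s t := by
  obtain ⟨M, hM⟩ := isCompact_Icc.exists_bound_of_continuousOn (hz.continuousOn (s := Icc s t))
  rw [intervalIntegrable_iff_integrableOn_Ioc_of_le hst] at hf ⊢
  refine Integrable.mono' (hf.norm.mul_const M)
    (hf.1.inner (𝕜 := ℝ) hz.aestronglyMeasurable) ?_
  filter_upwards [ae_restrict_mem measurableSet_Ioc] with τ hτ
  refine (norm_inner_le_norm _ _).trans ?_
  gcongr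
  exact hM τ (Ioc_subset_Icc_self hτ)

variable [CompleteSpace E]

/-- The product rule for `⟪∫ f, z⟫` with `f` integrable and `z` continuously differentiable. -/
theorem inner_primitive_eq_of_integrable {f z z' : ℝ → E} (hf : Integrable f)
    (hz : ∀ τ, HasDerivAt z (z' τ) τ) (hz' : Continuous z') {s t : ℝ} (hst : s ≤ t) :
    inner ℝ (∫ σ in s..t, f σ) (z t) =
      ∫ τ in s..t, (inner ℝ (f τ) (z τ) + inner ℝ (∫ σ in s..τ, f σ) (z' τ)) := by
  have hzc : Continuous z := continuous_iff_continuousAt.2 fun τ => (hz τ).continuousAt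
  obtain ⟨M, hM⟩ := isCompact_Icc.exists_bound_of_continuousOn (hzc.continuousOn (s := Icc s t))
  obtain ⟨M', hM'⟩ := isCompact_Icc.exists_bound_of_continuousOn (hz'.continuousOn (s := Icc s t))
  have hM0 : 0 ≤ M := (norm_nonneg _).trans (hM s (left_mem_Icc.2 hst))
  have hM0' : 0 ≤ M' := (norm_nonneg _).trans (hM' s (left_mem_Icc.2 hst))
  have ii : ∀ {f : ℝ → E}, Integrable f → ∀ a b, IntervalIntegrable f volume a b :=
    fun hf a b => hf.intervalIntegrable
  have hprim : ∀ {f : ℝ → E}, Integrable f → Continuous fun τ => ∫ σ in s..τ, f σ := fun hf =>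
    intervalIntegral.continuous_primitive (ii hf) s
  have i1 : ∀ {f : ℝ → E}, Integrable f →
      IntervalIntegrable (fun τ => inner ℝ (f τ) (z τ)) volume s t := fun hf =>
    intervalIntegrable_inner_of_continuous hst (ii hf s t) hzc
  have i2 : ∀ {f : ℝ → E}, Integrable f →
      IntervalIntegrable (fun τ => inner ℝ (∫ σ in s..τ, f σ) (z' τ)) volume s t := fun hf =>
    ((hprim hf).inner hz').intervalIntegrable _ _
  -- `A f` is the defect in the asserted identity. It respects differences, is bounded by a multiple
  -- of `‖f‖₁`, and vanishes for continuous `f` by the fundamental theorem of calculus; density of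
  -- continuous functions in `L¹` then gives `A f = 0`.
  let A : (ℝ → E) → ℝ := fun f => inner ℝ (∫ σ in s..t, f σ) (z t) -
      ∫ τ in s..t, (inner ℝ (f τ) (z τ) + inner ℝ (∫ σ in s..τ, f σ) (z' τ))
  have hsub : ∀ f₁ f₂ : ℝ → E, Integrable f₁ → Integrable f₂ →
      A (fun τ => f₁ τ - f₂ τ) = A f₁ - A f₂ := fun f₁ f₂ h₁ h₂ => by
    simp only [A]
    have e : ∀ τ, inner ℝ (f₁ τ - f₂ τ) (z τ) + inner ℝ (∫ σ in s..τ, (f₁ σ - f₂ σ)) (z' τ) =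
        (inner ℝ (f₁ τ) (z τ) + inner ℝ (∫ σ in s..τ, f₁ σ) (z' τ)) -
        (inner ℝ (f₂ τ) (z τ) + inner ℝ (∫ σ in s..τ, f₂ σ) (z' τ)) := fun τ => by
      rw [intervalIntegral.integral_sub (ii h₁ _ _) (ii h₂ _ _), inner_sub_left, inner_sub_left]
      ring
    simp only [e]
    rw [intervalIntegral.integral_sub ((i1 h₁).add (i2 h₁)) ((i1 h₂).add (i2 h₂)),
      intervalIntegral.integral_sub (ii h₁ _ _) (ii h₂ _ _), inner_sub_left]
    ring
  have hbound : ∀ f : ℝ → E, Integrable f →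
      |A f| ≤ (∫ τ, ‖f τ‖) * (M + (M + (t - s) * M')) := fun f hf => by
    have b0 : ∀ τ, ‖∫ σ in s..τ, f σ‖ ≤ ∫ τ, ‖f τ‖ := fun τ =>
      (intervalIntegral.norm_integral_le_integral_norm_uIoc).trans
        (setIntegral_le_integral hf.norm (ae_of_all _ fun _ => norm_nonneg _))
    have b1 : |inner ℝ (∫ σ in s..t, f σ) (z t)| ≤ (∫ τ, ‖f τ‖) * M :=
      (abs_real_inner_le_norm _ _).trans
        (mul_le_mul (b0 t) (hM t (right_mem_Icc.2 hst)) (norm_nonneg _)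
          (integral_nonneg fun _ => norm_nonneg _))
    have b2 : |∫ τ in s..t, inner ℝ (f τ) (z τ)| ≤ (∫ τ, ‖f τ‖) * M := by
      rw [intervalIntegral.integral_of_le hst, ← Real.norm_eq_abs]
      calc _ ≤ ∫ τ in Ioc s t, ‖f τ‖ * M := by
            refine norm_integral_le_of_norm_le (hf.norm.mul_const M).restrict ?_
            filter_upwards [ae_restrict_mem measurableSet_Ioc] with τ hτ
            refine (norm_inner_le_norm _ _).trans ?_
            gcongr
            exact hM τ (Ioc_subset_Icc_self hτ)
        _ ≤ ∫ τ, ‖f τ‖ * M := setIntegral_le_integral (hf.norm.mul_const M)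
            (ae_of_all _ fun _ => by positivity)
        _ = _ := integral_mul_const _ _
    have b3 : |∫ τ in s..t, inner ℝ (∫ σ in s..τ, f σ) (z' τ)| ≤
        (∫ τ, ‖f τ‖) * ((t - s) * M') := by
      have := intervalIntegral.norm_integral_le_of_norm_le_const (a := s) (b := t)
        (f := fun τ => inner ℝ (∫ σ in s..τ, f σ) (z' τ)) (C := (∫ τ, ‖f τ‖) * M') (fun τ hτ => by
          rw [uIoc_of_le hst] at hτ
          exact (norm_inner_le_norm _ _).trans (mul_le_mul (b0 τ)
            (hM' τ (Ioc_subset_Icc_self hτ)) (norm_nonneg _)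
            (integral_nonneg fun _ => norm_nonneg _)))
      rw [abs_of_nonneg (sub_nonneg.2 hst), Real.norm_eq_abs] at this
      linarith
    simp only [A]
    rw [intervalIntegral.integral_add (i1 hf) (i2 hf)]
    calc _ ≤ |inner ℝ (∫ σ in s..t, f σ) (z t)| + (|∫ τ in s..t, inner ℝ (f τ) (z τ)| +
          |∫ τ in s..t, inner ℝ (∫ σ in s..τ, f σ) (z' τ)|) :=
          (abs_sub _ _).trans (by gcongr; exact abs_add_le _ _)
      _ ≤ _ := by rw [mul_add, mul_add]; gcongr
  have hcont : ∀ f : ℝ → E, Continuous f → A f = 0 := fun f hf => by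
    have hd : ∀ τ, HasDerivAt (fun τ => inner ℝ (∫ σ in s..τ, f σ) (z τ))
        (inner ℝ (∫ σ in s..τ, f σ) (z' τ) + inner ℝ (f τ) (z τ)) τ := fun τ =>
      (intervalIntegral.integral_hasDerivAt_right (hf.intervalIntegrable _ _)
        (hf.stronglyMeasurableAtFilter _ _) hf.continuousAt).inner ℝ (hz τ)
    have hc : Continuous fun τ => inner ℝ (∫ σ in s..τ, f σ) (z' τ) + inner ℝ (f τ) (z τ) :=
      ((intervalIntegral.continuous_primitive (fun a b => hf.intervalIntegrable a b) s).inner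
        hz').add (hf.inner hzc)
    have := intervalIntegral.integral_eq_sub_of_hasDerivAt (fun τ _ => hd τ)
      (hc.intervalIntegrable s t)
    simp only [A]
    simp only [intervalIntegral.integral_same, inner_zero_left, sub_zero] at this
    rw [← this]
    simp only [add_comm, sub_self]
  suffices A f = 0 from sub_eq_zero.1 this
  rw [← abs_nonpos_iff]
  refine le_of_forall_pos_le_add fun ε hε => ?_
  set B := M + (M + (t - s) * M') with hB
  have hB0 : 0 ≤ B := by
    have := sub_nonneg.2 hst
    positivity
  -- Dividing by `B + 1` avoids the case `B = 0`.
  obtain ⟨k, -, hk, hkc, hki⟩ := hf.exists_hasCompactSupport_integral_sub_le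
    (show 0 < ε / (B + 1) by positivity)
  have h1 : A f = A fun τ => f τ - k τ := by
    rw [hsub f k hf hki, hcont k hkc, sub_zero]
  rw [h1, zero_add]
  refine (hbound _ (hf.sub hki)).trans ?_
  calc _ ≤ ε / (B + 1) * B := mul_le_mul_of_nonneg_right hk hB0
    _ ≤ ε / (B + 1) * (B + 1) := by gcongr; linarith
    _ = ε := by field_simp

/-- The product rule for `⟪w, z⟫` where `w` is a primitive of a locally integrable function. -/
theorem inner_sub_inner_eq_integral {w k z z' : ℝ → E} {s t : ℝ} (hst : s ≤ t)
    (hk : IntervalIntegrable k volume s t)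
    (hw : ∀ τ ∈ Icc s t, w τ - w s = ∫ σ in s..τ, k σ)
    (hz : ∀ τ, HasDerivAt z (z' τ) τ) (hz' : Continuous z') :
    inner ℝ (w t) (z t) - inner ℝ (w s) (z s) =
      ∫ τ in s..t, (inner ℝ (k τ) (z τ) + inner ℝ (w τ) (z' τ)) := by
  have hzc : Continuous z := continuous_iff_continuousAt.2 fun τ => (hz τ).continuousAt
  have hkI : IntegrableOn k (Ioc s t) := (intervalIntegrable_iff_integrableOn_Ioc_of_le hst).1 hk
  -- Extension by zero makes the integrand integrable on the whole line without changing the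
  -- primitive on `[s, t]`.
  set f : ℝ → E := (Ioc s t).indicator k with hf
  have hfi : Integrable f := hkI.integrable_indicator measurableSet_Ioc
  have hprim : ∀ τ ∈ Icc s t, ∫ σ in s..τ, f σ = w τ - w s := fun τ hτ => by
    rw [hw τ hτ, intervalIntegral.integral_of_le hτ.1, intervalIntegral.integral_of_le hτ.1]
    refine setIntegral_congr_fun measurableSet_Ioc fun σ hσ => ?_
    exact indicator_of_mem (show σ ∈ Ioc s t from ⟨hσ.1, hσ.2.trans hτ.2⟩) k
  have key := inner_primitive_eq_of_integrable hfi hz hz' hst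
  have h0 : ∫ τ in s..t, inner ℝ (w s) (z' τ) = inner ℝ (w s) (z t) - inner ℝ (w s) (z s) :=
    intervalIntegral.integral_eq_sub_of_hasDerivAt
      (fun τ _ => by simpa using (hasDerivAt_const τ (w s)).inner ℝ (hz τ))
      ((continuous_const.inner hz').intervalIntegrable _ _)
  have e : ∫ τ in s..t, (inner ℝ (k τ) (z τ) + inner ℝ (w τ) (z' τ)) =
      ∫ τ in s..t, ((inner ℝ (f τ) (z τ) + inner ℝ (∫ σ in s..τ, f σ) (z' τ)) +
        inner ℝ (w s) (z' τ)) := by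
    rw [intervalIntegral.integral_of_le hst, intervalIntegral.integral_of_le hst]
    refine setIntegral_congr_fun measurableSet_Ioc fun τ hτ => ?_
    rw [hprim τ (Ioc_subset_Icc_self hτ), hf, indicator_of_mem hτ, inner_sub_left]
    ring
  rw [e, intervalIntegral.integral_add, ← key, h0, hprim t (right_mem_Icc.2 hst), inner_sub_left]
  · ring
  · refine (intervalIntegrable_inner_of_continuous hst hfi.intervalIntegrable hzc).add ?_
    exact ((intervalIntegral.continuous_primitive (fun a b => hfi.intervalIntegrable) s).inner
      hz').intervalIntegrable _ _
  · exact (continuous_const.inner hz').intervalIntegrable _ _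

end ProductRule

/-! ### The equation as an identity in `L²` -/

section Solutions

variable {n : ℕ} {p₁ p₂ r : ℝ≥0∞} {V : EuclideanSpace ℝ (Fin n) → ℝ}
  {u u' : ℝ → LTwo n} {g : ℝ → LTwoVec n}

/-- Since `3 p₂ ≥ 3`, the subtraction `2⁻¹ - (3 p₂)⁻¹` in `ℝ≥0∞` is not truncated. -/
theorem IsHartreePotential.exists_exponent (hV : IsHartreePotential n p₁ p₂ V) :
    ∃ r : ℝ≥0∞, r⁻¹ + (3 * p₂)⁻¹ = 2⁻¹ := by
  refine ⟨(2⁻¹ - (3 * p₂)⁻¹)⁻¹, ?_⟩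
  rw [inv_inv]
  refine tsub_add_cancel_of_le (ENNReal.inv_le_inv.2 ?_)
  calc (2 : ℝ≥0∞) ≤ 3 * 1 := by norm_num
    _ ≤ 3 * p₂ := by gcongr; exact hV.one_le

namespace IsFiniteEnergySolution

theorem continuous (hu : IsFiniteEnergySolution p₂ V u u' g) : Continuous u :=
  continuous_iff_continuousAt.2 fun t => (hu.hasDerivAt t).continuousAt

theorem continuous_gradComp (hu : IsFiniteEnergySolution p₂ V u u' g) (i : Fin n) :
    Continuous fun τ => gradComp i (g τ) := (gradComp i).continuous.comp hu.continuous_grad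

theorem lintegral_cubeNorm_lt_top (hu : IsFiniteEnergySolution p₂ V u u' g)
    (hr : r⁻¹ + (3 * p₂)⁻¹ = 2⁻¹) (a b : ℝ) :
    ∫⁻ τ in Icc a b, cubeNorm r (u τ) < ⊤ := by
  have h2 : ∀ τ, eLpNorm (u τ) 2 volume = ENNReal.ofReal ‖u τ‖ := fun τ => by
    rw [Lp.norm_def, ENNReal.ofReal_toReal (Lp.memLp (u τ)).2.ne]
  have hcont : Continuous fun τ => eLpNorm (u τ) 2 volume ^ 3 := by
    simp_rw [h2]
    exact (ENNReal.continuous_pow 3).comp (ENNReal.continuous_ofReal.comp hu.continuous.norm)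
  simp only [cubeNorm]
  rw [lintegral_add_left hcont.measurable]
  refine ENNReal.add_lt_top.2 ⟨?_, hu.strichartz r hr a b⟩
  obtain ⟨M, hM⟩ := isCompact_Icc.exists_bound_of_continuousOn
    (hu.continuous.continuousOn (s := Icc a b))
  calc ∫⁻ τ in Icc a b, eLpNorm (u τ) 2 volume ^ 3 ≤ ∫⁻ τ in Icc a b, ENNReal.ofReal M ^ 3 := by
        refine setLIntegral_mono measurable_const fun τ hτ => ?_
        rw [h2]
        gcongr
        exact hM τ hτ
    _ < ⊤ := by
        rw [setLIntegral_const]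
        exact ENNReal.mul_lt_top (ENNReal.pow_lt_top ENNReal.ofReal_lt_top) (by simp)

theorem ae_cubeNorm_lt_top (hu : IsFiniteEnergySolution p₂ V u u' g)
    (hr : r⁻¹ + (3 * p₂)⁻¹ = 2⁻¹) (a b : ℝ) :
    ∀ᵐ τ ∂(volume.restrict (Icc a b)), cubeNorm r (u τ) < ⊤ :=
  ae_lt_top (measurable_cubeNorm r hu.continuous) (hu.lintegral_cubeNorm_lt_top hr a b).ne

end IsFiniteEnergySolution

theorem lintegral_hartreeMaj_ne_top (hV : IsHartreePotential n p₁ p₂ V)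
    (hr : r⁻¹ + (3 * p₂)⁻¹ = 2⁻¹) {w : EuclideanSpace ℝ (Fin n) → ℂ}
    (hwm : AEStronglyMeasurable w) (hw : cubeNorm r w < ⊤) :
    ∫⁻ x, hartreeMaj V w x ^ (2 : ℝ) ≠ ⊤ := by
  obtain ⟨C, hC, h⟩ := hV.exists_hartreeMaj_le hr
  intro htop
  have := h w hwm
  rw [htop, ENNReal.top_rpow_of_pos (by norm_num)] at this
  exact (ENNReal.mul_lt_top hC.lt_top hw).ne (top_le_iff.1 this)

theorem memLp_hartree (hV : IsHartreePotential n p₁ p₂ V)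
    (hr : r⁻¹ + (3 * p₂)⁻¹ = 2⁻¹) {w : EuclideanSpace ℝ (Fin n) → ℂ}
    (hwm : AEStronglyMeasurable w) (hw : cubeNorm r w < ⊤) : MemLp (hartree V w) 2 :=
  ⟨aestronglyMeasurable_hartree hV.aestronglyMeasurable hwm, (eLpNorm_hartree_le V w).trans_lt
    (ENNReal.rpow_lt_top_of_nonneg (by norm_num) (lintegral_hartreeMaj_ne_top hV hr hwm hw))⟩

namespace IsFiniteEnergySolution

/-- The norm of `F(u(τ))` is at most a constant times `cubeNorm`, which is integrable in time by the
`L³_loc L^r` hypothesis. Measurability comes from truncating the potential. -/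
theorem integrableOn_hartreeLp (hu : IsFiniteEnergySolution p₂ V u u' g)
    (hV : IsHartreePotential n p₁ p₂ V) (a b : ℝ) :
    IntegrableOn (fun τ => hartreeLp V (u τ)) (Icc a b) := by
  obtain ⟨r, hr⟩ := hV.exists_exponent
  have hVm := hV.aestronglyMeasurable
  have hae := hu.ae_cubeNorm_lt_top hr a b
  constructor
  · refine aestronglyMeasurable_of_tendsto_ae atTop
      (f := fun k τ => hartreeLp (clampFun V k) (u τ)) (fun k => ?_) ?_
    · exact ((continuous_hartreeLp_of_bounded (aestronglyMeasurable_clampFun hVm k)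
        (abs_clampFun_le k)).comp hu.continuous).aestronglyMeasurable
    · filter_upwards [hae] with τ hτ
      exact tendsto_hartreeLp_clampFun hVm
        (lintegral_hartreeMaj_ne_top hV hr (Lp.memLp (u τ)).1 hτ)
  · obtain ⟨C, hC, h⟩ := hV.exists_hartreeMaj_le hr
    refine lt_of_le_of_lt (b := ∫⁻ τ in Icc a b, C * cubeNorm r (u τ)) ?_ ?_
    · refine lintegral_mono_ae ?_
      filter_upwards [hae] with τ hτ
      have hm := memLp_hartree hV hr (Lp.memLp (u τ)).1 hτ
      rw [hartreeLp_eq hm, Lp.enorm_toLp]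
      exact (eLpNorm_hartree_le V (u τ)).trans (h _ (Lp.memLp (u τ)).1)
    · rw [lintegral_const_mul _ (measurable_cubeNorm r hu.continuous)]
      exact ENNReal.mul_lt_top hC.lt_top (hu.lintegral_cubeNorm_lt_top hr a b)

theorem intervalIntegrable_hartreeLp (hu : IsFiniteEnergySolution p₂ V u u' g)
    (hV : IsHartreePotential n p₁ p₂ V) {s t : ℝ} (hst : s ≤ t) :
    IntervalIntegrable (fun τ => hartreeLp V (u τ)) volume s t := by
  rw [intervalIntegrable_iff_integrableOn_Icc_of_le hst]
  exact hu.integrableOn_hartreeLp hV s t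

end IsFiniteEnergySolution

theorem IsTest.integrable_smul {ψ : EuclideanSpace ℝ (Fin n) → ℝ} (hψ : IsTest ψ) (f : LTwo n) :
    Integrable fun x => ψ x • f x :=
  memLp_one_iff_integrable.1 ((Lp.memLp f).smul (hψ.memLp 2))

theorem IsTest.memLp_ofReal {ψ : EuclideanSpace ℝ (Fin n) → ℝ} (hψ : IsTest ψ) :
    MemLp (fun x => (ψ x : ℂ)) 2 := (hψ.memLp 2).ofReal

/-- Pairing with a test function as a continuous linear functional on `L²`. -/
def testL (ψ : EuclideanSpace ℝ (Fin n) → ℝ) (hψ : IsTest ψ) : LTwo n →L[ℝ] ℂ :=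
  (innerSL ℂ (hψ.memLp_ofReal.toLp _)).restrictScalars ℝ

theorem testL_apply {ψ : EuclideanSpace ℝ (Fin n) → ℝ} (hψ : IsTest ψ) (f : LTwo n) :
    testL ψ hψ f = ∫ x, ψ x • f x := by
  change inner ℂ (hψ.memLp_ofReal.toLp _) f = _
  rw [L2.inner_def]
  refine integral_congr_ae ?_
  filter_upwards [hψ.memLp_ofReal.coeFn_toLp] with x hx
  rw [hx]
  simp [mul_comm]

theorem spatialConv_eq_testL {φ : EuclideanSpace ℝ (Fin n) → ℝ} (hφ : IsTest φ) (f : LTwo n)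
    (x : EuclideanSpace ℝ (Fin n)) :
    spatialConv φ f x = testL (fun y => φ (x - y)) (hφ.comp_sub_left x) f := by
  rw [testL_apply, spatialConv_eq_swap]

namespace IsFiniteEnergySolution

/-- Both spatial derivatives are moved to the test function and the time integral is moved inside
the pairing. The integrals on the right are then Bochner integrals in `L²` that do not depend on the
test function. -/
theorem testL_equation (hu : IsFiniteEnergySolution p₂ V u u' g)
    (hV : IsHartreePotential n p₁ p₂ V) {ψ : EuclideanSpace ℝ (Fin n) → ℝ} (hψ : IsTest ψ)
    {s t : ℝ} (hst : s ≤ t) :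
    testL ψ hψ (u' t) - testL ψ hψ (u' s) =
      (∑ j, testL _ ((hψ.partialDeriv j).partialDeriv j) (∫ τ in s..t, u τ)) -
        testL ψ hψ (∫ τ in s..t, u τ) - testL ψ hψ (∫ τ in s..t, hartreeLp V (u τ)) := by
  obtain ⟨r, hr⟩ := hV.exists_exponent
  have heq := hu.equation ψ hψ.contDiff hψ.hasCompactSupport s t hst
  have iu : IntervalIntegrable u volume s t := hu.continuous.intervalIntegrable _ _
  have iF := hu.intervalIntegrable_hartreeLp hV hst
  rw [testL_apply, testL_apply, heq]
  have hgrad : ∀ τ, ∫ x, ∑ i, partialDeriv i ψ x • g τ x i =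
      -∑ j, testL _ ((hψ.partialDeriv j).partialDeriv j) (u τ) := fun τ => by
    have hae : ∀ᵐ x, ∀ i, gradComp i (g τ) x = g τ x i := by
      rw [ae_all_iff]; exact fun i => coeFn_gradComp i (g τ)
    have e1 : ∫ x, ∑ i, partialDeriv i ψ x • g τ x i =
        ∫ x, ∑ i, partialDeriv i ψ x • gradComp i (g τ) x := by
      refine integral_congr_ae ?_
      filter_upwards [hae] with x hx
      simp only [hx]
    rw [e1, integral_finsetSum _ fun i _ =>
      (hψ.partialDeriv i).integrable_smul _, ← Finset.sum_neg_distrib]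
    refine Finset.sum_congr rfl fun i _ => ?_
    rw [testL_apply, (hu.isWeakGradient τ).integral_gradComp (hψ.partialDeriv i) i, neg_neg]
  have hint : ∫ τ in s..t, ((∫ x, ∑ i, partialDeriv i ψ x • g τ x i) + (∫ x, ψ x • u τ x)
            + ∫ x, ψ x • hartree V (u τ) x) =
      ∫ τ in s..t, ((-∑ j, testL _ ((hψ.partialDeriv j).partialDeriv j) (u τ)) + testL ψ hψ (u τ) +
        testL ψ hψ (hartreeLp V (u τ))) := by
    rw [intervalIntegral.integral_of_le hst, intervalIntegral.integral_of_le hst]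
    refine integral_congr_ae ?_
    -- Only at times with finite `cubeNorm`, hence for almost every time, is `hartreeLp` known to be
    -- the nonlinearity rather than its default value 0.
    filter_upwards [ae_restrict_of_ae_restrict_of_subset Ioc_subset_Icc_self
      (hu.ae_cubeNorm_lt_top hr s t)] with τ hτ
    have hm := memLp_hartree hV hr (Lp.memLp (u τ)).1 hτ
    rw [hgrad, testL_apply, testL_apply hψ (hartreeLp V (u τ))]
    congr 1
    refine integral_congr_ae ?_
    filter_upwards [coeFn_hartreeLp hm] with x hx
    rw [hx]
  have c1 : ∀ (ψ' : EuclideanSpace ℝ (Fin n) → ℝ) (h : IsTest ψ'),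
      IntervalIntegrable (fun τ => testL ψ' h (u τ)) volume s t := fun ψ' h =>
    ((testL ψ' h).continuous.comp hu.continuous).intervalIntegrable _ _
  have c2 : IntervalIntegrable (fun τ => -∑ j, testL _ ((hψ.partialDeriv j).partialDeriv j) (u τ))
      volume s t := by
    refine Continuous.intervalIntegrable ?_ _ _
    exact (continuous_finsetSum _ fun j _ => (testL _ _).continuous.comp hu.continuous).neg
  have c3 : IntervalIntegrable (fun τ => testL ψ hψ (hartreeLp V (u τ))) volume s t := by
    rw [intervalIntegrable_iff_integrableOn_Ioc_of_le hst] at iF ⊢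
    exact (testL ψ hψ).integrable_comp iF
  rw [hint, intervalIntegral.integral_add (c2.add (c1 _ _)) c3,
    intervalIntegral.integral_add c2 (c1 _ _), intervalIntegral.integral_neg,
    intervalIntegral.integral_finsetSum fun j _ => c1 _ _,
    ContinuousLinearMap.intervalIntegral_comp_comm _ iu,
    ContinuousLinearMap.intervalIntegral_comp_comm _ iF]
  have : ∀ j, ∫ τ in s..t, testL _ ((hψ.partialDeriv j).partialDeriv j) (u τ) =
      testL _ ((hψ.partialDeriv j).partialDeriv j) (∫ τ in s..t, u τ) := fun j =>
    ContinuousLinearMap.intervalIntegral_comp_comm _ iu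
  simp only [this]
  ring

/-- Testing with `y ↦ φ(x - y)` for every `x` turns the distributional equation into one for
`L²`-valued curves: `φ * u'` is the primitive of an integrable function, as the product rule
requires. -/
theorem convL_equation (hu : IsFiniteEnergySolution p₂ V u u' g)
    (hV : IsHartreePotential n p₁ p₂ V) {φ : EuclideanSpace ℝ (Fin n) → ℝ} (hφ : IsTest φ)
    {s t : ℝ} (hst : s ≤ t) :
    convL φ hφ (u' t) - convL φ hφ (u' s) =
      ∫ τ in s..t, (lapL φ hφ (u τ) - convL φ hφ (u τ) - convL φ hφ (hartreeLp V (u τ))) := by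
  have iu : IntervalIntegrable u volume s t := hu.continuous.intervalIntegrable _ _
  have iF := hu.intervalIntegrable_hartreeLp hV hst
  have d1 : IntervalIntegrable (fun τ => lapL φ hφ (u τ)) volume s t :=
    ((lapL φ hφ).continuous.comp hu.continuous).intervalIntegrable _ _
  have d2 : IntervalIntegrable (fun τ => convL φ hφ (u τ)) volume s t :=
    ((convL φ hφ).continuous.comp hu.continuous).intervalIntegrable _ _
  have d3 : IntervalIntegrable (fun τ => convL φ hφ (hartreeLp V (u τ))) volume s t := by
    rw [intervalIntegrable_iff_integrableOn_Ioc_of_le hst] at iF ⊢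
    exact (convL φ hφ).integrable_comp iF
  rw [intervalIntegral.integral_sub (d1.sub d2) d3, intervalIntegral.integral_sub d1 d2,
    ContinuousLinearMap.intervalIntegral_comp_comm _ iu,
    ContinuousLinearMap.intervalIntegral_comp_comm _ iu,
    ContinuousLinearMap.intervalIntegral_comp_comm _ iF]
  set P := ∫ τ in s..t, u τ
  set Q := ∫ τ in s..t, hartreeLp V (u τ)
  refine Lp.ext ?_
  have hsum : (lapL φ hφ P : EuclideanSpace ℝ (Fin n) → ℂ) =ᵐ[volume]
      fun x => ∑ j, spatialConv (partialDeriv j (partialDeriv j φ)) P x := by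
    rw [lapL, _root_.sum_apply]
    have h1 := Lp.coeFn_finsetSum Finset.univ fun j =>
      convL (partialDeriv j (partialDeriv j φ)) ((hφ.partialDeriv j).partialDeriv j) P
    have h2 : ∀ᵐ x, ∀ j, convL (partialDeriv j (partialDeriv j φ))
        ((hφ.partialDeriv j).partialDeriv j) P x =
        spatialConv (partialDeriv j (partialDeriv j φ)) P x := by
      rw [ae_all_iff]; exact fun j => coeFn_convL _ P
    filter_upwards [h1, h2] with x h1 h2
    rw [h1]
    simp only [Finset.sum_apply, h2]
  filter_upwards [hsum, coeFn_convL hφ P, coeFn_convL hφ Q, coeFn_convL hφ (u' t),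
    coeFn_convL hφ (u' s), Lp.coeFn_sub (convL φ hφ (u' t)) (convL φ hφ (u' s)),
    Lp.coeFn_sub (lapL φ hφ P - convL φ hφ P) (convL φ hφ Q),
    Lp.coeFn_sub (lapL φ hφ P) (convL φ hφ P)] with x h1 h2 h3 h4 h5 h6 h7 h8
  rw [h6, h7, Pi.sub_apply, Pi.sub_apply, h8, Pi.sub_apply, h1, h2, h3, h4, h5]
  have key := hu.testL_equation hV (hφ.comp_sub_left x) hst
  rw [spatialConv_eq_testL hφ, spatialConv_eq_testL hφ, spatialConv_eq_testL hφ,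
    spatialConv_eq_testL hφ, key]
  congr 2
  refine Finset.sum_congr rfl fun j _ => ?_
  rw [spatialConv_eq_testL ((hφ.partialDeriv j).partialDeriv j), testL_apply, testL_apply]
  -- Two derivatives of a reflected function produce two sign changes, which cancel.
  have e : partialDeriv j (partialDeriv j fun y => φ (x - y)) =
      fun y => partialDeriv j (partialDeriv j φ) (x - y) := by
    rw [hφ.partialDeriv_comp_sub_left]
    have h := (hφ.partialDeriv j).partialDeriv_comp_sub_left x j
    funext y
    have h' := congrFun h y
    simp only [partialDeriv] at h' ⊢
    rw [fderiv_fun_neg]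
    simp only [neg_apply]
    rw [h', neg_neg]
  rw [e]

end IsFiniteEnergySolution

end Solutions

/-! ### The Morawetz inequality for the multiplier -/

section MorawetzAction

variable {n : ℕ} {p₁ p₂ : ℝ≥0∞} {V : EuclideanSpace ℝ (Fin n) → ℝ}
  {u u' : ℝ → LTwo n} {g : ℝ → LTwoVec n}
  {h : Fin n → EuclideanSpace ℝ (Fin n) → ℝ}
  {Dh : Fin n → Fin n → EuclideanSpace ℝ (Fin n) → ℝ} {d : EuclideanSpace ℝ (Fin n) → ℝ}
  {Dd DDd : Fin n → EuclideanSpace ℝ (Fin n) → ℝ}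

theorem IsMorawetzField.norm_multL_moll_le (H : IsMorawetzField h Dh d Dd DDd) {w : LTwo n}
    {γ : LTwoVec n} (hw : IsWeakGradient w γ) (m : ℕ) :
    ‖H.multL (moll n m) (isTest_moll m) w‖ ≤ ‖γ‖ := by
  have h1 := H.norm_multL_sq_le (isTest_moll m) w
  have h2 : ∑ i, ‖convL (partialDeriv i (moll n m)) ((isTest_moll m).partialDeriv i) w‖ ^ 2 ≤
      ‖γ‖ ^ 2 := by
    rw [← sum_norm_gradComp_sq]
    refine Finset.sum_le_sum fun i _ => ?_
    rw [hw.convL_partialDeriv (isTest_moll m) i]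
    have := norm_mollL_le m (gradComp i γ)
    unfold mollL at this
    gcongr
  exact (abs_le_of_sq_le_sq' (h1.trans h2) (norm_nonneg _)).2

/-- The Morawetz action `⟨J u', N u⟩`, with `J` the mollification and `N` the mollified multiplier,
is differentiated in time. All contributions but that of the nonlinearity are zero or nonpositive,
and the action is at most `‖u'‖ ‖g‖` at each endpoint by the Hardy bound. -/
theorem IsFiniteEnergySolution.integral_inner_moll_le (hu : IsFiniteEnergySolution p₂ V u u' g)
    (hV : IsHartreePotential n p₁ p₂ V) (H : IsMorawetzField h Dh d Dd DDd) {s t : ℝ}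
    (hst : s ≤ t) (m : ℕ) :
    ∫ τ in s..t, inner ℝ (mollL n m (hartreeLp V (u τ)))
        (H.multL (moll n m) (isTest_moll m) (u τ)) ≤
      ‖u' s‖ * ‖g s‖ + ‖u' t‖ * ‖g t‖ := by
  set φ := moll n m with hφdef
  have hφ : IsTest φ := isTest_moll m
  set N := H.multL φ hφ with hN
  set J : LTwo n →L[ℝ] LTwo n := mollL n m with hJ
  have hJdef : J = convL φ hφ := rfl
  set L := lapL φ hφ
  have hJF : IntervalIntegrable (fun τ => J (hartreeLp V (u τ))) volume s t := by
    have iF := hu.intervalIntegrable_hartreeLp hV hst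
    rw [intervalIntegrable_iff_integrableOn_Ioc_of_le hst] at iF ⊢
    exact J.integrable_comp iF
  have hlin : Continuous fun τ => L (u τ) - J (u τ) :=
    (L.continuous.comp hu.continuous).sub (J.continuous.comp hu.continuous)
  have hNc : Continuous fun τ => N (u τ) := N.continuous.comp hu.continuous
  have hNc' : Continuous fun τ => N (u' τ) := N.continuous.comp hu.continuous_deriv
  have key := inner_sub_inner_eq_integral (w := fun τ => J (u' τ))
    (k := fun τ => L (u τ) - J (u τ) - J (hartreeLp V (u τ))) (z := fun τ => N (u τ))
    (z' := fun τ => N (u' τ)) hst ((hlin.intervalIntegrable _ _).sub hJF)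
    (fun τ hτ => hu.convL_equation hV hφ hτ.1)
    (fun τ => N.hasFDerivAt.comp_hasDerivAt τ (hu.hasDerivAt τ)) hNc'
  have iJFN : IntervalIntegrable (fun τ => inner ℝ (J (hartreeLp V (u τ))) (N (u τ)))
      volume s t := intervalIntegrable_inner_of_continuous hst hJF hNc
  have hle : ∀ τ, inner ℝ (L (u τ) - J (u τ) - J (hartreeLp V (u τ))) (N (u τ)) +
      inner ℝ (J (u' τ)) (N (u' τ)) ≤ -inner ℝ (J (hartreeLp V (u τ))) (N (u τ)) := fun τ => by
    have h1 := H.inner_lapL_multL_nonpos hφ (u τ)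
    have h2 := H.inner_convL_multL hφ (u τ)
    have h3 := H.inner_convL_multL hφ (u' τ)
    rw [inner_sub_left, inner_sub_left, hJdef, h2, h3]
    linarith
  have hint : IntervalIntegrable (fun τ => inner ℝ (L (u τ) - J (u τ) - J (hartreeLp V (u τ)))
      (N (u τ)) + inner ℝ (J (u' τ)) (N (u' τ))) volume s t :=
    (intervalIntegrable_inner_of_continuous hst ((hlin.intervalIntegrable _ _).sub hJF) hNc).add
      (((J.continuous.comp hu.continuous_deriv).inner hNc').intervalIntegrable _ _)
  have hmono := intervalIntegral.integral_mono_on hst hint iJFN.neg fun τ _ => hle τ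
  rw [← key] at hmono
  have hneg : ∫ τ in s..t, (-fun τ => inner ℝ (J (hartreeLp V (u τ))) (N (u τ))) τ =
      -∫ τ in s..t, inner ℝ (J (hartreeLp V (u τ))) (N (u τ)) := intervalIntegral.integral_neg
  have hb : ∀ τ, |inner ℝ (J (u' τ)) (N (u τ))| ≤ ‖u' τ‖ * ‖g τ‖ := fun τ =>
    (abs_real_inner_le_norm _ _).trans (mul_le_mul (norm_mollL_le m _)
      (H.norm_multL_moll_le (hu.isWeakGradient τ) m) (norm_nonneg _) (norm_nonneg _))
  have hs := (abs_le.1 (hb s)).2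
  have ht := (abs_le.1 (hb t)).1
  rw [hneg] at hmono
  linarith

theorem IsMorawetzField.tendsto_multL_moll (H : IsMorawetzField h Dh d Dd DDd) {w : LTwo n}
    {γ : LTwoVec n} (hw : IsWeakGradient w γ) :
    Tendsto (fun m => H.multL (moll n m) (isTest_moll m) w) atTop
      (𝓝 (H.multiplier (fun i => gradComp i γ) w)) := by
  have e : ∀ m, H.multL (moll n m) (isTest_moll m) w =
      H.multiplier (fun i => mollL n m (gradComp i γ)) (mollL n m w) := fun m => by
    rw [H.multL_apply]
    have : (fun i => convL (partialDeriv i (moll n m)) ((isTest_moll m).partialDeriv i) w) =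
        fun i => mollL n m (gradComp i γ) :=
      funext fun i => hw.convL_partialDeriv (isTest_moll m) i
    rw [this]
    rfl
  simp_rw [e]
  refine Tendsto.add (tendsto_finsetSum _ fun i _ => ?_) ?_
  · exact ((mulL (h i) _).continuous.tendsto _).comp (tendsto_mollL _)
  · exact (((mulL d _).continuous.tendsto _).comp (tendsto_mollL _)).const_smul _

theorem IsMorawetzField.norm_multiplier_le (H : IsMorawetzField h Dh d Dd DDd) {w : LTwo n}
    {γ : LTwoVec n} (hw : IsWeakGradient w γ) :
    ‖H.multiplier (fun i => gradComp i γ) w‖ ≤ ‖γ‖ :=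
  le_of_tendsto (H.tendsto_multL_moll hw).norm
    (Eventually.of_forall fun m => H.norm_multL_moll_le hw m)

theorem IsFiniteEnergySolution.continuous_multiplier (hu : IsFiniteEnergySolution p₂ V u u' g)
    (H : IsMorawetzField h Dh d Dd DDd) :
    Continuous fun τ => H.multiplier (fun i => gradComp i (g τ)) (u τ) :=
  (continuous_finsetSum _ fun i _ => (mulL (h i) _).continuous.comp (hu.continuous_gradComp i)).add
    (((mulL d H.bdd_div).continuous.comp hu.continuous).fun_const_smul (1 / 2 : ℝ))

/-- The mollification is removed by dominated convergence, with dominating function `‖F(u(τ))‖`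
times the maximum of `‖g‖` on `[s, t]`. -/
theorem IsFiniteEnergySolution.integral_inner_multiplier_le
    (hu : IsFiniteEnergySolution p₂ V u u' g)
    (hV : IsHartreePotential n p₁ p₂ V) (H : IsMorawetzField h Dh d Dd DDd) {s t : ℝ}
    (hst : s ≤ t) :
    ∫ τ in s..t, inner ℝ (hartreeLp V (u τ)) (H.multiplier (fun i => gradComp i (g τ)) (u τ)) ≤
      ‖u' s‖ * ‖g s‖ + ‖u' t‖ * ‖g t‖ := by
  have iF := hu.intervalIntegrable_hartreeLp hV hst
  refine le_of_tendsto (?_ : Tendsto (fun m => ∫ τ in s..t,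
    inner ℝ (mollL n m (hartreeLp V (u τ))) (H.multL (moll n m) (isTest_moll m) (u τ))) atTop _)
    (Eventually.of_forall fun m => hu.integral_inner_moll_le hV H hst m)
  obtain ⟨M, hM⟩ := isCompact_Icc.exists_bound_of_continuousOn
    (hu.continuous_grad.continuousOn (s := Icc s t))
  refine intervalIntegral.tendsto_integral_filter_of_dominated_convergence
    (fun τ => ‖hartreeLp V (u τ)‖ * M) ?_ ?_ (iF.norm.mul_const M) ?_
  · refine Eventually.of_forall fun m => ?_
    rw [uIoc_of_le hst]
    rw [intervalIntegrable_iff_integrableOn_Ioc_of_le hst] at iF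
    exact ((mollL n m).continuous.comp_aestronglyMeasurable iF.1).inner (𝕜 := ℝ)
      ((H.multL (moll n m) (isTest_moll m)).continuous.comp hu.continuous).aestronglyMeasurable
  · refine Eventually.of_forall fun m => ae_of_all _ fun τ hτ => ?_
    rw [uIoc_of_le hst] at hτ
    exact (norm_inner_le_norm _ _).trans (mul_le_mul (norm_mollL_le m _)
      ((H.norm_multL_moll_le (hu.isWeakGradient τ) m).trans (hM τ (Ioc_subset_Icc_self hτ)))
      (norm_nonneg _) (norm_nonneg _))
  · exact ae_of_all _ fun τ _ => (tendsto_mollL _).inner (H.tendsto_multL_moll (hu.isWeakGradient τ))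

end MorawetzAction

/-! ### Fubini for the trilinear form -/

section Fubini

variable {n : ℕ} {V A B : EuclideanSpace ℝ (Fin n) → ℝ}

theorem integrable_triform_integrand (hV : AEStronglyMeasurable V) (hA : AEStronglyMeasurable A)
    (hB : AEStronglyMeasurable B)
    (h : triform (fun z => ‖V z‖ₑ) (fun x => ‖A x‖ₑ) (fun x => ‖B x‖ₑ) ≠ ⊤) :
    Integrable (fun q : EuclideanSpace ℝ (Fin n) × EuclideanSpace ℝ (Fin n) =>
      V q.2 * A q.1 * B (q.1 - q.2)) (volume.prod volume) := by
  refine ⟨((hV.comp_snd.mul hA.comp_fst).mul (hB.comp_quasiMeasurePreserving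
    (quasiMeasurePreserving_sub_of_right_invariant volume volume))), ?_⟩
  rw [triform_eq_lintegral_prod hV.enorm hA.enorm hB.enorm] at h
  refine lt_of_le_of_lt (le_of_eq ?_) h.lt_top
  simp only [enorm_mul]

/-- Exchanging the integrals leaves `V` multiplying the correlation of `A` and `B`, a function of
the shift `z` alone, so that identities for correlations carry over to rough `V`. -/
theorem integral_mul_spatialConv (hV : AEStronglyMeasurable V) (hA : AEStronglyMeasurable A)
    (hB : AEStronglyMeasurable B)
    (h : triform (fun z => ‖V z‖ₑ) (fun x => ‖A x‖ₑ) (fun x => ‖B x‖ₑ) ≠ ⊤) :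
    ∫ x, A x * spatialConv V B x = ∫ z, V z * ∫ x, A x * B (x - z) := by
  have hi := integrable_triform_integrand hV hA hB h
  have e1 : ∀ x, A x * spatialConv V B x = ∫ z, V z * A x * B (x - z) := fun x => by
    rw [spatialConv_def, ← integral_const_mul]
    refine integral_congr_ae (ae_of_all _ fun z => ?_)
    simp only [smul_eq_mul]
    ring
  have e2 : ∀ z, V z * ∫ x, A x * B (x - z) = ∫ x, V z * A x * B (x - z) := fun z => by
    rw [← integral_const_mul]
    simp only [mul_assoc]
  simp_rw [e1, e2]
  exact integral_integral_swap hi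

theorem integrable_mul_spatialConv (hV : AEStronglyMeasurable V) (hA : AEStronglyMeasurable A)
    (hB : AEStronglyMeasurable B)
    (h : triform (fun z => ‖V z‖ₑ) (fun x => ‖A x‖ₑ) (fun x => ‖B x‖ₑ) ≠ ⊤) :
    Integrable fun x => A x * spatialConv V B x := by
  refine (integrable_triform_integrand hV hA hB h).integral_prod_left.congr
    (ae_of_all _ fun x => ?_)
  simp only
  rw [spatialConv_def, ← integral_const_mul]
  refine integral_congr_ae (ae_of_all _ fun z => ?_)
  simp only [smul_eq_mul]
  ring

/-- The trilinear form with `V = 1` is `‖A‖₁ ‖B‖₁`. -/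
theorem integrable_correlation (hA : Integrable A) (hB : Integrable B) :
    Integrable fun z => ∫ x, A x * B (x - z) := by
  have h : triform (fun _ => ‖(1 : ℝ)‖ₑ) (fun x => ‖A x‖ₑ) (fun x => ‖B x‖ₑ) ≠ ⊤ :=
    ((triform_le_of_ae_le (ae_of_all _ fun _ => le_rfl) hA.1.enorm hB.1.enorm).trans_lt
      (ENNReal.mul_lt_top (ENNReal.mul_lt_top (by simp) hA.2) hB.2)).ne
  have := (integrable_triform_integrand (V := fun _ => 1) aestronglyMeasurable_const hA.1 hB.1
    h).integral_prod_right
  simpa only [one_mul] using this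

theorem triform_ne_top_of_isTest {θ : EuclideanSpace ℝ (Fin n) → ℝ} (hθ : IsTest θ)
    (hA : Integrable A) (hB : Integrable B) :
    triform (fun z => ‖θ z‖ₑ) (fun x => ‖A x‖ₑ) (fun x => ‖B x‖ₑ) ≠ ⊤ := by
  obtain ⟨-, C, hC⟩ := hθ.isBddCont
  have hb : ∀ᵐ z, ‖θ z‖ₑ ≤ ENNReal.ofReal C := ae_of_all _ fun z => by
    rw [← ofReal_norm]
    exact ENNReal.ofReal_le_ofReal (hC z)
  exact ((triform_le_of_ae_le hb hA.1.enorm hB.1.enorm).trans_lt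
      (ENNReal.mul_lt_top (ENNReal.mul_lt_top (by simp) hA.2) hB.2)).ne

end Fubini

/-! ### Weak gradients tested against bounded smooth functions -/

section BoundedTesting

variable {n : ℕ}

theorem IsC1Bdd.partialDeriv_eq {i : Fin n} {Φ Φ' : EuclideanSpace ℝ (Fin n) → ℝ}
    (h : IsC1Bdd i Φ Φ') (hd : Differentiable ℝ Φ) : partialDeriv i Φ = Φ' := by
  funext x
  have h1 := (hd x).hasFDerivAt.hasLineDerivAt (EuclideanSpace.single i 1)
  exact HasDerivAt.unique h1 (h.hasLineDerivAt x)

/-- A smooth cutoff equal to `1` on the ball of radius `m + 1`. -/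
def cutoff (n m : ℕ) (x : EuclideanSpace ℝ (Fin n)) : ℝ :=
  (mollBump n 0) (((m : ℝ) + 1)⁻¹ • x)

theorem isTest_cutoff (m : ℕ) : IsTest (cutoff n m) := by
  have hm : ((m : ℝ) + 1)⁻¹ ≠ 0 := by positivity
  refine ⟨(mollBump n 0).contDiff.comp (contDiff_const_smul _), ?_⟩
  exact (mollBump n 0).hasCompactSupport.comp_homeomorph (Homeomorph.smulOfNeZero _ hm)

theorem abs_cutoff_le (m : ℕ) (x : EuclideanSpace ℝ (Fin n)) : |cutoff n m x| ≤ 1 := by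
  unfold cutoff
  rw [abs_of_nonneg (mollBump n 0).nonneg]
  exact (mollBump n 0).le_one

theorem tendsto_cutoff (x : EuclideanSpace ℝ (Fin n)) :
    Tendsto (fun m => cutoff n m x) atTop (𝓝 1) := by
  refine tendsto_const_nhds.congr' ?_
  filter_upwards [eventually_ge_atTop ⌈‖x‖⌉₊] with m hm
  have hx : ‖x‖ ≤ m := Nat.ceil_le.1 hm
  refine ((mollBump n 0).one_of_mem_closedBall ?_).symm
  have : (mollBump n 0).rIn = 1 := by simp [mollBump]
  rw [mem_closedBall_zero_iff, this, norm_smul, norm_inv, Real.norm_of_nonneg (by positivity),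
    inv_mul_le_iff₀ (by positivity)]
  linarith

theorem exists_abs_partialDeriv_cutoff_le (i : Fin n) :
    ∃ C, ∀ m x, |partialDeriv i (cutoff n m) x| ≤ C * ((m : ℝ) + 1)⁻¹ := by
  have ht : IsTest (mollBump n 0) := ⟨(mollBump n 0).contDiff, (mollBump n 0).hasCompactSupport⟩
  obtain ⟨-, C, hC⟩ := (ht.partialDeriv i).isBddCont
  refine ⟨C, fun m x => ?_⟩
  have h1 : HasFDerivAt (fun y : EuclideanSpace ℝ (Fin n) => ((m : ℝ) + 1)⁻¹ • y)
    (((m : ℝ) + 1)⁻¹ • ContinuousLinearMap.id ℝ _) x := (hasFDerivAt_id x).fun_const_smul _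
  have h2 := (ht.differentiable (((m : ℝ) + 1)⁻¹ • x)).hasFDerivAt.comp x h1
  have h3 : fderiv ℝ (cutoff n m) x = _ := h2.fderiv
  have hm : 0 < ((m : ℝ) + 1)⁻¹ := by positivity
  have h4 : partialDeriv i (cutoff n m) x =
      ((m : ℝ) + 1)⁻¹ * partialDeriv i (mollBump n 0) (((m : ℝ) + 1)⁻¹ • x) := by
    rw [partialDeriv, h3]
    simp [partialDeriv]
  rw [h4, abs_mul, abs_of_pos hm, mul_comm]
  exact mul_le_mul_of_nonneg_right (hC _) hm.le

/-- An integrable weak gradient may be tested against smooth functions that are bounded together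
with their derivative. -/
theorem IsWeakGradient.integral_eq_of_bdd {f : EuclideanSpace ℝ (Fin n) → ℝ}
    {G : EuclideanSpace ℝ (Fin n) → EuclideanSpace ℝ (Fin n)} (hfG : IsWeakGradient f G)
    (hf : Integrable f) {i : Fin n} (hG : Integrable fun x => G x i)
    {Φ Φ' : EuclideanSpace ℝ (Fin n) → ℝ} (hΦ : ContDiff ℝ ∞ Φ) (hb : IsC1Bdd i Φ Φ') :
    ∫ x, Φ' x * f x = - ∫ x, Φ x * G x i := by
  have hd : Differentiable ℝ Φ := hΦ.differentiable (by simp)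
  obtain ⟨hc0, C₀, hC₀⟩ := hb.bdd
  obtain ⟨hc1, C₁, hC₁⟩ := hb.bdd_deriv
  obtain ⟨C, hC⟩ := exists_abs_partialDeriv_cutoff_le (n := n) i
  have hC0 : 0 ≤ C := by
    have := (abs_nonneg _).trans (hC 0 0)
    simpa using this
  have hC₀0 : 0 ≤ C₀ := (abs_nonneg _).trans (hC₀ 0)
  -- The cut off function is an admissible test function. The error term contains the derivative of
  -- the cutoff, which is `O(1/(m+1))`, and `f`, `Gᵢ` integrable make both limits dominated.
  have key : ∀ m, ∫ x, (partialDeriv i (cutoff n m) x * Φ x + cutoff n m x * Φ' x) * f x =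
      -∫ x, cutoff n m x * Φ x * G x i := fun m => by
    have ht := isTest_cutoff (n := n) m
    have h1 := hfG.integral_eq (fun x => cutoff n m x * Φ x) (ht.contDiff.mul hΦ)
      ht.hasCompactSupport.mul_right i
    simp only [smul_eq_mul] at h1
    rw [← h1]
    refine integral_congr_ae (ae_of_all _ fun x => ?_)
    have h2 := ((ht.differentiable x).hasFDerivAt.mul (hd x).hasFDerivAt).fderiv
    have h3 : partialDeriv i (fun x => cutoff n m x * Φ x) x =
        cutoff n m x * partialDeriv i Φ x + Φ x * partialDeriv i (cutoff n m) x := by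
      simp only [partialDeriv]
      change fderiv ℝ (cutoff n m * Φ) x _ = _
      rw [h2]
      simp
    simp only [h3, hb.partialDeriv_eq hd]
    ring
  have l1 : Tendsto (fun m => ∫ x, (partialDeriv i (cutoff n m) x * Φ x +
      cutoff n m x * Φ' x) * f x) atTop (𝓝 (∫ x, Φ' x * f x)) := by
    refine tendsto_integral_of_dominated_convergence (fun x => (C * C₀ + C₁) * ‖f x‖)
      (fun m => ?_) (hf.norm.const_mul _) (fun m => ae_of_all _ fun x => ?_)
      (ae_of_all _ fun x => ?_)
    · exact (((((isTest_cutoff m).partialDeriv i).contDiff.continuous.mul hc0).add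
        ((isTest_cutoff m).contDiff.continuous.mul hc1)).aestronglyMeasurable).mul hf.1
    · rw [norm_mul]
      refine mul_le_mul_of_nonneg_right ?_ (norm_nonneg _)
      refine (norm_add_le _ _).trans (add_le_add ?_ ?_)
      · rw [norm_mul]
        refine mul_le_mul ((hC m x).trans ?_) (hC₀ x) (norm_nonneg _) hC0
        refine mul_le_of_le_one_right hC0 (inv_le_one_of_one_le₀ ?_)
        linarith [(Nat.cast_nonneg m : (0 : ℝ) ≤ m)]
      · rw [norm_mul]
        have := mul_le_mul (abs_cutoff_le m x) (hC₁ x) (abs_nonneg _) zero_le_one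
        rwa [one_mul] at this
    · have a1 : Tendsto (fun m => partialDeriv i (cutoff n m) x) atTop (𝓝 0) := by
        have hz : Tendsto (fun m : ℕ => C * ((m : ℝ) + 1)⁻¹) atTop (𝓝 0) := by
          have := tendsto_one_div_add_atTop_nhds_zero_nat (𝕜 := ℝ)
          simpa using this.const_mul C
        exact squeeze_zero_norm (fun m => hC m x) hz
      have := (((a1.mul_const (Φ x)).add ((tendsto_cutoff x).mul_const (Φ' x))).mul_const (f x))
      simpa using this
  have l2 : Tendsto (fun m => -∫ x, cutoff n m x * Φ x * G x i) atTop
      (𝓝 (-∫ x, Φ x * G x i)) := by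
    refine (tendsto_integral_of_dominated_convergence (fun x => C₀ * ‖G x i‖)
      (fun m => ?_) (hG.norm.const_mul _) (fun m => ae_of_all _ fun x => ?_)
      (ae_of_all _ fun x => ?_)).neg
    · exact ((isTest_cutoff m).contDiff.continuous.mul hc0).aestronglyMeasurable.mul hG.1
    · rw [norm_mul, norm_mul]
      refine mul_le_mul_of_nonneg_right ?_ (norm_nonneg _)
      have := mul_le_mul (abs_cutoff_le m x) (hC₀ x) (abs_nonneg _) zero_le_one
      rwa [one_mul] at this
    · have := ((tendsto_cutoff x).mul_const (Φ x)).mul_const (G x i)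
      simpa using this
  exact tendsto_nhds_unique (l1.congr key) l2

theorem IsWeakGradient.spatialConv_partialDeriv {f : EuclideanSpace ℝ (Fin n) → ℝ}
    {G : EuclideanSpace ℝ (Fin n) → EuclideanSpace ℝ (Fin n)} (hfG : IsWeakGradient f G)
    {θ : EuclideanSpace ℝ (Fin n) → ℝ} (hθ : IsTest θ) (i : Fin n)
    (x : EuclideanSpace ℝ (Fin n)) :
    spatialConv (partialDeriv i θ) f x = spatialConv θ (fun y => G y i) x := by
  rw [spatialConv_eq_swap, spatialConv_eq_swap]
  have ht := hθ.comp_sub_left x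
  have := hfG.integral_eq _ ht.contDiff ht.hasCompactSupport i
  rw [hθ.partialDeriv_comp_sub_left] at this
  simp only [neg_smul, integral_neg, neg_inj] at this
  exact this

end BoundedTesting

/-! ### Integration by parts through a convolution -/

section DivergenceIdentity

variable {n : ℕ} {h : Fin n → EuclideanSpace ℝ (Fin n) → ℝ}
  {Dh : Fin n → Fin n → EuclideanSpace ℝ (Fin n) → ℝ} {d : EuclideanSpace ℝ (Fin n) → ℝ}
  {Dd DDd : Fin n → EuclideanSpace ℝ (Fin n) → ℝ} {f : EuclideanSpace ℝ (Fin n) → ℝ}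
  {G : EuclideanSpace ℝ (Fin n) → EuclideanSpace ℝ (Fin n)}

/-- The weak divergence `div (f h) = h·∇f + f div h`. -/
def divProd (h : Fin n → EuclideanSpace ℝ (Fin n) → ℝ) (d : EuclideanSpace ℝ (Fin n) → ℝ)
    (f : EuclideanSpace ℝ (Fin n) → ℝ)
    (G : EuclideanSpace ℝ (Fin n) → EuclideanSpace ℝ (Fin n)) (x : EuclideanSpace ℝ (Fin n)) : ℝ :=
  ∑ i, h i x * G x i + d x * f x

theorem IsBddCont.integrable_mul {c : EuclideanSpace ℝ (Fin n) → ℝ} (hc : IsBddCont c)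
    {f : EuclideanSpace ℝ (Fin n) → ℝ} (hf : Integrable f) : Integrable fun x => c x * f x := by
  obtain ⟨hc, C, hC⟩ := hc
  exact hf.bdd_mul hc.aestronglyMeasurable (ae_of_all _ hC)

theorem IsMorawetzField.integrable_divProd (H : IsMorawetzField h Dh d Dd DDd) (hf : Integrable f)
    (hG : ∀ i, Integrable fun x => G x i) : Integrable (divProd h d f G) :=
  (integrable_finsetSum _ fun i _ => (H.field i i).bdd.integrable_mul (hG i)).add
    (H.bdd_div.integrable_mul hf)

/-- For a smooth kernel `θ`, the function `hᵢ (θ * f)` may be tested against the weak gradient of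
`f`. The term with `∂ᵢhᵢ` cancels the divergence part of `divProd`, and the remaining derivative
falls on `θ * f`, hence on its second factor. -/
theorem IsMorawetzField.integral_divProd_test (H : IsMorawetzField h Dh d Dd DDd)
    (hs : ∀ i, ContDiff ℝ ∞ (h i)) (hfG : IsWeakGradient f G) (hf : Integrable f)
    (hG : ∀ i, Integrable fun x => G x i) {θ : EuclideanSpace ℝ (Fin n) → ℝ} (hθ : IsTest θ) :
    ∫ x, divProd h d f G x * spatialConv θ f x =
      -∑ i, ∫ x, (f x * h i x) * spatialConv θ (fun y => G y i) x := by
  have hsm : ContDiff ℝ ∞ (spatialConv θ f) :=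
    hθ.hasCompactSupport.contDiff_convolution_left _ hθ.contDiff hf.locallyIntegrable
  have hbdd : ∀ {ψ : EuclideanSpace ℝ (Fin n) → ℝ}, IsTest ψ → IsBddCont (spatialConv ψ f) :=
    fun hψ => by
      obtain ⟨-, C, hC⟩ := hψ.isBddCont
      exact ⟨(hψ.hasCompactSupport.contDiff_convolution_left (n := ⊤) _ hψ.contDiff
        hf.locallyIntegrable).continuous, _, fun x => abs_spatialConv_le hC hf x⟩
  have hΘ := hbdd hθ
  have hC1 : ∀ i, IsC1Bdd i (fun x => h i x * spatialConv θ f x)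
      (fun x => Dh i i x * spatialConv θ f x + h i x * spatialConv (partialDeriv i θ) f x) :=
    fun i => ⟨fun x => ((H.field i i).hasLineDerivAt x).mul_real
        (hasLineDerivAt_spatialConv hθ hf.locallyIntegrable i x),
      (H.field i i).bdd.mul hΘ, ((H.field i i).bdd_deriv.mul hΘ).add
        ((H.field i i).bdd.mul (hbdd (hθ.partialDeriv i)))⟩
  have key : ∀ i, ∫ x, (h i x * spatialConv θ f x) * G x i =
      -(∫ x, (Dh i i x * spatialConv θ f x) * f x) -
        ∫ x, (f x * h i x) * spatialConv θ (fun y => G y i) x := fun i => by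
    have h1 := hfG.integral_eq_of_bdd hf (hG i) ((hs i).mul hsm) (hC1 i)
    have i1 : Integrable fun x => (Dh i i x * spatialConv θ f x) * f x :=
      ((H.field i i).bdd_deriv.mul hΘ).integrable_mul hf
    have i2 : Integrable fun x => (h i x * spatialConv (partialDeriv i θ) f x) * f x :=
      ((H.field i i).bdd.mul (hbdd (hθ.partialDeriv i))).integrable_mul hf
    simp only [add_mul] at h1
    rw [integral_add i1 i2] at h1
    have e : ∫ x, (h i x * spatialConv (partialDeriv i θ) f x) * f x =
        ∫ x, (f x * h i x) * spatialConv θ (fun y => G y i) x := by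
      refine integral_congr_ae (ae_of_all _ fun x => ?_)
      simp only [hfG.spatialConv_partialDeriv hθ]
      ring
    rw [← e]
    linarith
  have j1 : ∀ i, Integrable fun x => (h i x * spatialConv θ f x) * G x i := fun i =>
    ((H.field i i).bdd.mul hΘ).integrable_mul (hG i)
  have j2 : ∀ i, Integrable fun x => (Dh i i x * spatialConv θ f x) * f x := fun i =>
    ((H.field i i).bdd_deriv.mul hΘ).integrable_mul hf
  have e0 : ∫ x, divProd h d f G x * spatialConv θ f x =
      (∑ i, ∫ x, (h i x * spatialConv θ f x) * G x i) +
        ∑ i, ∫ x, (Dh i i x * spatialConv θ f x) * f x := by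
    rw [← integral_finsetSum _ fun i _ => j1 i, ← integral_finsetSum _ fun i _ => j2 i,
      ← integral_add (integrable_finsetSum _ fun i _ => j1 i)
        (integrable_finsetSum _ fun i _ => j2 i)]
    refine integral_congr_ae (ae_of_all _ fun x => ?_)
    simp only [divProd, H.div_eq, add_mul, Finset.sum_mul]
    congr 1 <;> exact Finset.sum_congr rfl fun i _ => by ring
  rw [e0, ← Finset.sum_add_distrib, ← Finset.sum_neg_distrib]
  refine Finset.sum_congr rfl fun i _ => ?_
  rw [key]
  ring

/-- Both sides are integrable functions of the shift, and by Fubini and `integral_divProd_test` they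
have the same integral against every test function. -/
theorem IsMorawetzField.correlation_ae_eq (H : IsMorawetzField h Dh d Dd DDd)
    (hs : ∀ i, ContDiff ℝ ∞ (h i)) (hfG : IsWeakGradient f G) (hf : Integrable f)
    (hG : ∀ i, Integrable fun x => G x i) :
    ∀ᵐ z, ∫ x, divProd h d f G x * f (x - z) =
      -∑ i, ∫ x, (f x * h i x) * G (x - z) i := by
  have hfh : ∀ i, Integrable fun x => f x * h i x := fun i =>
    ((H.field i i).bdd.integrable_mul hf).congr (ae_of_all _ fun x => mul_comm _ _)
  have hD := H.integrable_divProd hf hG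
  have k1 := integrable_correlation hD hf
  have k2 : ∀ i, Integrable fun z => ∫ x, (f x * h i x) * G (x - z) i := fun i =>
    integrable_correlation (hfh i) (hG i)
  refine ae_eq_of_integral_contDiff_smul_eq k1.locallyIntegrable
    (integrable_finsetSum _ fun i _ => k2 i).neg.locallyIntegrable fun θ hθ hc => ?_
  have ht : IsTest θ := ⟨hθ, hc⟩
  simp only [smul_eq_mul]
  rw [← integral_mul_spatialConv ht.integrable.1 hD.1 hf.1 (triform_ne_top_of_isTest ht hD hf),
    H.integral_divProd_test hs hfG hf hG ht]
  have e : ∀ z, θ z * -∑ i, ∫ x, (f x * h i x) * G (x - z) i =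
      -∑ i, θ z * ∫ x, (f x * h i x) * G (x - z) i := fun z => by
    rw [mul_neg, Finset.mul_sum]
  simp only [e]
  rw [integral_neg, integral_finsetSum _ fun i _ => ht.isBddCont.integrable_mul (k2 i)]
  congr 1
  refine Finset.sum_congr rfl fun i _ => ?_
  exact integral_mul_spatialConv ht.integrable.1 (hfh i).1 (hG i).1
    (triform_ne_top_of_isTest ht (hfh i) (hG i))

/-- Integration by parts `∫ (V * f) div (f h) = -∫ f h·(V * ∇f)` under absolute convergence. -/
theorem IsMorawetzField.integral_divProd (H : IsMorawetzField h Dh d Dd DDd)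
    (hs : ∀ i, ContDiff ℝ ∞ (h i)) (hfG : IsWeakGradient f G) (hf : Integrable f)
    (hG : ∀ i, Integrable fun x => G x i) {V : EuclideanSpace ℝ (Fin n) → ℝ}
    (hV : AEStronglyMeasurable V)
    (t1 : triform (fun z => ‖V z‖ₑ) (fun x => ‖divProd h d f G x‖ₑ) (fun x => ‖f x‖ₑ) ≠ ⊤)
    (t2 : ∀ i, triform (fun z => ‖V z‖ₑ) (fun x => ‖f x * h i x‖ₑ) (fun x => ‖G x i‖ₑ) ≠ ⊤) :
    ∫ x, divProd h d f G x * spatialConv V f x =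
      -∑ i, ∫ x, (f x * h i x) * spatialConv V (fun y => G y i) x := by
  have hfh : ∀ i, Integrable fun x => f x * h i x := fun i =>
    ((H.field i i).bdd.integrable_mul hf).congr (ae_of_all _ fun x => mul_comm _ _)
  have hD := H.integrable_divProd hf hG
  rw [integral_mul_spatialConv hV hD.1 hf.1 t1]
  have e : ∀ i, ∫ x, (f x * h i x) * spatialConv V (fun y => G y i) x =
      ∫ z, V z * ∫ x, (f x * h i x) * G (x - z) i := fun i =>
    integral_mul_spatialConv hV (hfh i).1 (hG i).1 (t2 i)
  simp only [e]
  have hi : ∀ i, Integrable fun z => V z * ∫ x, (f x * h i x) * G (x - z) i := fun i => by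
    refine (integrable_triform_integrand hV (hfh i).1 (hG i).1 (t2 i)).integral_prod_right.congr
      (ae_of_all _ fun z => ?_)
    simp only
    rw [← integral_const_mul]
    simp only [mul_assoc]
  rw [← integral_finsetSum _ fun i _ => hi i, ← integral_neg]
  refine integral_congr_ae ?_
  filter_upwards [H.correlation_ae_eq hs hfG hf hG] with z hz
  rw [hz, mul_neg, Finset.mul_sum]

end DivergenceIdentity

/-! ### The Morawetz density at a fixed time -/

section FixedTime

variable {n : ℕ} {p₁ p₂ r : ℝ≥0∞} {V : EuclideanSpace ℝ (Fin n) → ℝ}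

/-- The `ℓ¹` norm of a square integrable vector field. -/
def gradSum (γ : LTwoVec n) (x : EuclideanSpace ℝ (Fin n)) : ℝ := ∑ i, ‖gradComp i γ x‖

theorem memLp_gradSum (γ : LTwoVec n) : MemLp (gradSum γ) 2 :=
  memLp_finsetSum _ fun i _ => (Lp.memLp (gradComp i γ)).norm

theorem eLpNorm_gradSum_le (γ : LTwoVec n) :
    eLpNorm (gradSum γ) 2 volume ≤ ∑ i, ‖gradComp i γ‖ₑ := by
  have h := eLpNorm_sum_le (μ := volume) (p := 2) (s := Finset.univ)
    (f := fun (i : Fin n) x => ‖gradComp i γ x‖)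
    (fun i _ => (Lp.memLp (gradComp i γ)).1.norm) one_le_two
  have e : (∑ i : Fin n, fun x => ‖gradComp i γ x‖) = gradSum γ := by
    funext x
    simp [gradSum]
  rw [e] at h
  refine h.trans (Finset.sum_le_sum fun i _ => ?_)
  rw [eLpNorm_norm, Lp.enorm_def]

theorem abs_densityGrad_apply_le (w : LTwo n) (γ : LTwoVec n) (x : EuclideanSpace ℝ (Fin n))
    (i : Fin n) : |densityGrad w γ x i| ≤ 2 * ‖w x‖ * ‖gradComp i γ x‖ := by
  have h := abs_real_inner_le_norm (w x) (gradComp i γ x)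
  simp only [densityGrad, abs_mul, abs_two]
  linarith

theorem norm_densityGrad_le (w : LTwo n) (γ : LTwoVec n) (x : EuclideanSpace ℝ (Fin n)) :
    ‖densityGrad w γ x‖ ≤ ‖w x‖ * (2 * gradSum γ x) := by
  have h1 : ‖densityGrad w γ x‖ ≤ ∑ i, |densityGrad w γ x i| := by
    rw [EuclideanSpace.norm_eq]
    refine Real.sqrt_le_iff.2 ⟨Finset.sum_nonneg fun _ _ => abs_nonneg _, ?_⟩
    simp only [Real.norm_eq_abs]
    exact Finset.sum_sq_le_sq_sum_of_nonneg fun _ _ => abs_nonneg _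
  refine h1.trans ((Finset.sum_le_sum fun i _ => abs_densityGrad_apply_le w γ x i).trans
    (le_of_eq ?_))
  rw [← Finset.mul_sum, gradSum]
  ring

theorem enorm_densityGrad_le (w : LTwo n) (γ : LTwoVec n) (x : EuclideanSpace ℝ (Fin n)) :
    ‖densityGrad w γ x‖ₑ ≤ ‖w x‖ₑ * ‖2 * gradSum γ x‖ₑ := by
  rw [← enorm_norm (w x), ← enorm_mul]
  refine enorm_le_iff_norm_le.2 ((norm_densityGrad_le w γ x).trans (le_abs_self _))

theorem IsHartreePotential.exists_triform_densityGrad_le (hV : IsHartreePotential n p₁ p₂ V)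
    (hr : r⁻¹ + (3 * p₂)⁻¹ = 2⁻¹) : ∃ C : ℝ≥0∞, C ≠ ⊤ ∧ ∀ (w : LTwo n) (γ : LTwoVec n),
      triform (fun z => ‖V z‖ₑ) (fun x => ‖w x‖ₑ ^ 2) (fun x => ‖densityGrad w γ x‖ₑ) ≤
        C * cubeNorm r w * ∑ i, ‖gradComp i γ‖ₑ := by
  obtain ⟨C, hC, h⟩ := hV.exists_triform_le hr
  refine ⟨C * 2, ENNReal.mul_ne_top hC (by simp), fun w γ => ?_⟩
  have hm : MemLp (fun x => 2 * gradSum γ x) 2 := (memLp_gradSum γ).const_mul 2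
  have h1 := (h w (fun x => ‖2 * gradSum γ x‖ₑ) (Lp.memLp w).1 hm.1.enorm).2
  refine (triform_mono (ae_of_all _ fun _ => le_rfl) (fun _ => le_rfl)
    fun x => enorm_densityGrad_le w γ x).trans (h1.trans ?_)
  rw [← eLpNorm_two_eq]
  have h2 : eLpNorm (fun x => 2 * gradSum γ x) 2 volume = 2 * eLpNorm (gradSum γ) 2 volume := by
    have := eLpNorm_const_smul (2 : ℝ) (gradSum γ) 2 (volume : Measure (EuclideanSpace ℝ (Fin n)))
    have e : ‖(2 : ℝ)‖ₑ = 2 := by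
      rw [Real.enorm_of_nonneg zero_le_two]; simp
    rwa [e] at this
  rw [h2]
  calc C * cubeNorm r w * (2 * eLpNorm (gradSum γ) 2 volume) =
        C * 2 * cubeNorm r w * eLpNorm (gradSum γ) 2 volume := by ring
    _ ≤ _ := by gcongr; exact eLpNorm_gradSum_le γ

theorem triform_densityGrad_ne_top (hV : IsHartreePotential n p₁ p₂ V)
    (hr : r⁻¹ + (3 * p₂)⁻¹ = 2⁻¹) {w : LTwo n} (hw : cubeNorm r w < ⊤) (γ : LTwoVec n) :
    triform (fun z => ‖V z‖ₑ) (fun x => ‖w x‖ₑ ^ 2) (fun x => ‖densityGrad w γ x‖ₑ) ≠ ⊤ := by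
  obtain ⟨C, hC, h⟩ := hV.exists_triform_densityGrad_le hr
  refine ((h w γ).trans_lt (ENNReal.mul_lt_top (ENNReal.mul_lt_top hC.lt_top hw) ?_)).ne
  exact ENNReal.sum_lt_top.2 fun i _ => enorm_lt_top

theorem IsWeakGradient.morawetzDensity_eq {w : LTwo n} {γ : LTwoVec n} (h : IsWeakGradient w γ) :
    morawetzDensity V w = fun x =>
      ‖w x‖ ^ 2 * inner ℝ (‖x‖⁻¹ • x) (spatialConv V (densityGrad w γ) x) := by
  funext x
  rw [morawetzDensity, spatialConv_congr h.norm_sq.weakGradient_ae_eq]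

theorem norm_inv_norm_smul_le (x : EuclideanSpace ℝ (Fin n)) : ‖‖x‖⁻¹ • x‖ ≤ 1 := by
  rw [norm_smul, norm_inv, norm_norm]
  exact inv_mul_le_one

theorem lintegral_density_conv_eq (hV : AEStronglyMeasurable V) (w : LTwo n) (γ : LTwoVec n) :
    ∫⁻ x, ‖w x‖ₑ ^ 2 * ∫⁻ z, ‖V z‖ₑ * ‖densityGrad w γ (x - z)‖ₑ =
      triform (fun z => ‖V z‖ₑ) (fun x => ‖w x‖ₑ ^ 2) (fun x => ‖densityGrad w γ x‖ₑ) :=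
  lintegral_mul_conv_eq_triform hV.enorm (integrable_densityGrad w γ).1.enorm

theorem lintegral_morawetzDensity_le (hV : AEStronglyMeasurable V) {w : LTwo n} {γ : LTwoVec n}
    (h : IsWeakGradient w γ) : ∫⁻ x, ‖morawetzDensity V w x‖ₑ ≤
      triform (fun z => ‖V z‖ₑ) (fun x => ‖w x‖ₑ ^ 2) (fun x => ‖densityGrad w γ x‖ₑ) := by
  rw [← lintegral_density_conv_eq hV, h.morawetzDensity_eq]
  refine lintegral_mono fun x => ?_
  rw [enorm_mul, enorm_pow, enorm_norm]
  gcongr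
  refine le_trans (enorm_le_iff_norm_le.2 ?_) (enorm_spatialConv_le V _ x)
  refine (norm_inner_le_norm _ _).trans ?_
  exact mul_le_of_le_one_left (norm_nonneg _) (norm_inv_norm_smul_le x)

theorem integrable_norm_sq_mul_norm_spatialConv (hV : IsHartreePotential n p₁ p₂ V)
    (hr : r⁻¹ + (3 * p₂)⁻¹ = 2⁻¹) {w : LTwo n} (hw : cubeNorm r w < ⊤) (γ : LTwoVec n) :
    Integrable fun x => ‖w x‖ ^ 2 * ‖spatialConv V (densityGrad w γ) x‖ := by
  refine ⟨((Lp.memLp w).1.norm.pow 2).mul (aestronglyMeasurable_spatialConv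
    hV.aestronglyMeasurable (integrable_densityGrad w γ).1).norm, ?_⟩
  refine lt_of_le_of_lt ?_ (triform_densityGrad_ne_top hV hr hw γ).lt_top
  rw [← lintegral_density_conv_eq hV.aestronglyMeasurable]
  refine lintegral_mono fun x => ?_
  rw [enorm_mul, enorm_pow, enorm_norm, enorm_norm]
  gcongr
  exact enorm_spatialConv_le V _ x

theorem integrable_morawetzDensity (hV : IsHartreePotential n p₁ p₂ V)
    (hr : r⁻¹ + (3 * p₂)⁻¹ = 2⁻¹) {w : LTwo n} (hw : cubeNorm r w < ⊤) {γ : LTwoVec n}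
    (h : IsWeakGradient w γ) : Integrable (morawetzDensity V w) := by
  refine ⟨?_, (lintegral_morawetzDensity_le hV.aestronglyMeasurable h).trans_lt
    (triform_densityGrad_ne_top hV hr hw γ).lt_top⟩
  rw [h.morawetzDensity_eq]
  have hm : Measurable fun x : EuclideanSpace ℝ (Fin n) => ‖x‖⁻¹ • x := by fun_prop
  exact ((Lp.memLp w).1.norm.pow 2).mul (hm.aestronglyMeasurable.inner
    (aestronglyMeasurable_spatialConv hV.aestronglyMeasurable (integrable_densityGrad w γ).1))

/-- The convolution acts componentwise where it converges absolutely. -/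
theorem spatialConv_apply_of_lintegral_ne_top (hV : AEStronglyMeasurable V)
    {G : EuclideanSpace ℝ (Fin n) → EuclideanSpace ℝ (Fin n)} (hG : AEStronglyMeasurable G)
    {x : EuclideanSpace ℝ (Fin n)} (hx : ∫⁻ z, ‖V z‖ₑ * ‖G (x - z)‖ₑ ≠ ⊤) (i : Fin n) :
    spatialConv V G x i = spatialConv V (fun y => G y i) x := by
  have hi : Integrable fun z => V z • G (x - z) := by
    refine ⟨hV.smul (hG.comp_quasiMeasurePreserving (quasiMeasurePreserving_sub_left volume x)), ?_⟩
    simpa only [HasFiniteIntegral, enorm_smul] using hx.lt_top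
  have := (EuclideanSpace.proj (𝕜 := ℝ) i : EuclideanSpace ℝ (Fin n) →L[ℝ] ℝ).integral_comp_comm hi
  rw [spatialConv_def, spatialConv_def]
  exact this.symm

section Multiplier

variable {h : Fin n → EuclideanSpace ℝ (Fin n) → ℝ}
  {Dh : Fin n → Fin n → EuclideanSpace ℝ (Fin n) → ℝ} {d : EuclideanSpace ℝ (Fin n) → ℝ}
  {Dd DDd : Fin n → EuclideanSpace ℝ (Fin n) → ℝ}

theorem IsMorawetzField.abs_le_one (H : IsMorawetzField h Dh d Dd DDd) (i : Fin n)
    (x : EuclideanSpace ℝ (Fin n)) : |h i x| ≤ 1 := by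
  rw [← sq_le_one_iff_abs_le_one]
  exact (Finset.single_le_sum (f := fun i => h i x ^ 2) (fun _ _ => sq_nonneg _)
    (Finset.mem_univ i)).trans (H.norm_le x)

theorem IsMorawetzField.norm_toLp_le (H : IsMorawetzField h Dh d Dd DDd)
    (x : EuclideanSpace ℝ (Fin n)) : ‖WithLp.toLp 2 (fun i => h i x)‖ ≤ 1 := by
  rw [EuclideanSpace.norm_eq, Real.sqrt_le_one]
  simpa using H.norm_le x

theorem IsMorawetzField.abs_sum_mul_le (H : IsMorawetzField h Dh d Dd DDd)
    (x c : EuclideanSpace ℝ (Fin n)) : |∑ i, h i x * c i| ≤ ‖c‖ := by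
  have h1 := abs_real_inner_le_norm (WithLp.toLp 2 (fun i => h i x)) c
  have e : inner ℝ (WithLp.toLp 2 (fun i => h i x)) c = ∑ i, h i x * c i := by
    simp [PiLp.inner_apply, mul_comm]
  rw [e] at h1
  exact h1.trans (mul_le_of_le_one_left (norm_nonneg _) (H.norm_toLp_le x))

theorem IsMorawetzField.triform_divProd_ne_top (H : IsMorawetzField h Dh d Dd DDd)
    (hV : IsHartreePotential n p₁ p₂ V) (hr : r⁻¹ + (3 * p₂)⁻¹ = 2⁻¹) {w : LTwo n}
    (hw : cubeNorm r w < ⊤) (γ : LTwoVec n) :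
    triform (fun z => ‖V z‖ₑ)
      (fun x => ‖divProd h d (fun y => ‖w y‖ ^ 2) (densityGrad w γ) x‖ₑ)
      (fun x => ‖‖w x‖ ^ 2‖ₑ) ≠ ⊤ := by
  obtain ⟨C, hC, hb⟩ := hV.exists_triform_le hr
  obtain ⟨-, K, hK⟩ := H.bdd_div
  -- `|w| κ` dominates `|h·∇|w|² + d |w|²|`: the first term is at most `2|w|` times the `ℓ¹` norm of
  -- the gradient, the second at most `K|w|²`. As `κ ∈ L²`, the trilinear estimate applies.
  set κ : EuclideanSpace ℝ (Fin n) → ℝ := fun x => 2 * gradSum γ x + K * ‖w x‖ with hκ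
  have hm : MemLp κ 2 := ((memLp_gradSum γ).const_mul 2).add ((Lp.memLp w).norm.const_mul K)
  have h1 := (hb w (fun x => ‖κ x‖ₑ) (Lp.memLp w).1 hm.1.enorm).1
  rw [← eLpNorm_two_eq] at h1
  refine ((triform_mono (ae_of_all _ fun _ => le_rfl) (fun x => ?_) (fun x => ?_)).trans
    h1).trans_lt (ENNReal.mul_lt_top (ENNReal.mul_lt_top hC.lt_top hw) hm.2) |>.ne
  · rw [← enorm_norm (w x), ← enorm_mul]
    refine enorm_le_iff_norm_le.2 (le_trans ?_ (le_abs_self _))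
    have a1 := (H.abs_sum_mul_le x (densityGrad w γ x)).trans (norm_densityGrad_le w γ x)
    have a2 : |d x * ‖w x‖ ^ 2| ≤ K * ‖w x‖ ^ 2 := by
      rw [abs_mul, abs_of_nonneg (sq_nonneg ‖w x‖)]
      exact mul_le_mul_of_nonneg_right (hK x) (sq_nonneg _)
    rw [divProd, Real.norm_eq_abs]
    refine (abs_add_le _ _).trans ((add_le_add a1 a2).trans (le_of_eq ?_))
    simp only [hκ]
    ring
  · rw [enorm_pow, enorm_norm]

theorem IsMorawetzField.triform_mul_densityGrad_ne_top (H : IsMorawetzField h Dh d Dd DDd)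
    (hV : IsHartreePotential n p₁ p₂ V) (hr : r⁻¹ + (3 * p₂)⁻¹ = 2⁻¹) {w : LTwo n}
    (hw : cubeNorm r w < ⊤) (γ : LTwoVec n) (i : Fin n) :
    triform (fun z => ‖V z‖ₑ) (fun x => ‖‖w x‖ ^ 2 * h i x‖ₑ)
      (fun x => ‖densityGrad w γ x i‖ₑ) ≠ ⊤ := by
  refine ((triform_mono (ae_of_all _ fun _ => le_rfl) (fun x => ?_) (fun x => ?_)).trans_lt
    (triform_densityGrad_ne_top hV hr hw γ).lt_top).ne
  · rw [enorm_mul, enorm_pow, enorm_norm]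
    refine mul_le_of_le_one_right' ?_
    rw [← enorm_one (G := ℝ)]
    refine enorm_le_iff_norm_le.2 ?_
    rw [norm_one]
    exact H.abs_le_one i x
  · exact enorm_le_iff_norm_le.2 (PiLp.norm_apply_le _ i)

/-- The potential `V * |w|²` is real, so `2⟨(V * |w|²) w, h·∇w + (d/2) w⟩ = (V * |w|²)(h·∇|w|² + d
|w|²)` pointwise. -/
theorem IsMorawetzField.two_mul_inner_multiplier (H : IsMorawetzField h Dh d Dd DDd)
    {w : LTwo n} (hm : MemLp (hartree V w) 2) (γ : LTwoVec n) :
    2 * inner ℝ (hartreeLp V w) (H.multiplier (fun i => gradComp i γ) w) =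
      ∫ x, divProd h d (fun y => ‖w y‖ ^ 2) (densityGrad w γ) x *
        spatialConv V (fun y => ‖w y‖ ^ 2) x := by
  have hF := coeFn_hartreeLp hm
  rw [H.inner_multiplier, wpair_congr hF (EventuallyEq.refl _ _)]
  simp_rw [fun i => wpair_congr (c := h i) hF (EventuallyEq.refl _ (gradComp i γ))]
  simp only [wpair]
  have i1 : ∀ i, Integrable fun x => h i x * inner ℝ (hartree V w x) (gradComp i γ x) := fun i =>
    integrable_wpair (H.field i i).bdd hm (Lp.memLp _)
  have i2 : Integrable fun x => d x * inner ℝ (hartree V w x) (w x) :=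
    integrable_wpair H.bdd_div hm (Lp.memLp _)
  rw [← integral_finsetSum _ fun i _ => i1 i, ← integral_const_mul,
    ← integral_add (integrable_finsetSum _ fun i _ => i1 i) (i2.const_mul _), ← integral_const_mul]
  refine integral_congr_ae (ae_of_all _ fun x => ?_)
  simp only [divProd, densityGrad, hartree, real_inner_smul_left, real_inner_self_eq_norm_sq,
    add_mul, mul_add, Finset.mul_sum, Finset.sum_mul]
  congr 1
  · exact Finset.sum_congr rfl fun i _ => by ring
  · ring

/-- This links the nonlinear term of the multiplier identity to the Morawetz density with `h` in
place of `x/|x|`. -/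
theorem IsMorawetzField.integral_norm_sq_mul_sum (H : IsMorawetzField h Dh d Dd DDd)
    (hs : ∀ i, ContDiff ℝ ∞ (h i)) (hV : IsHartreePotential n p₁ p₂ V)
    (hr : r⁻¹ + (3 * p₂)⁻¹ = 2⁻¹) {w : LTwo n} (hw : cubeNorm r w < ⊤) {γ : LTwoVec n}
    (hγ : IsWeakGradient w γ) :
    ∫ x, ‖w x‖ ^ 2 * ∑ i, h i x * spatialConv V (densityGrad w γ) x i =
      -(2 * inner ℝ (hartreeLp V w) (H.multiplier (fun i => gradComp i γ) w)) := by
  have hVm := hV.aestronglyMeasurable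
  have t2 := H.triform_mul_densityGrad_ne_top hV hr hw γ
  have hG := integrable_densityGrad_apply w γ
  have hρ := integrable_norm_sq w
  rw [H.two_mul_inner_multiplier (memLp_hartree hV hr (Lp.memLp w).1 hw),
    H.integral_divProd hs hγ.norm_sq hρ hG hVm (H.triform_divProd_ne_top hV hr hw γ) t2, neg_neg,
    ← integral_finsetSum]
  · refine integral_congr_ae ?_
    have hfin := ae_lt_top' (((Lp.memLp w).1.enorm.pow_const 2).mul
      (aemeasurable_lintegral_conv hVm.enorm (integrable_densityGrad w γ).1.enorm))
      ((lintegral_density_conv_eq hVm w γ).trans_ne (triform_densityGrad_ne_top hV hr hw γ))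
    filter_upwards [hfin] with x hx
    -- Only the product of `|w|²` with the absolute convolution is known to be finite almost
    -- everywhere. Where `w` vanishes both sides are 0; elsewhere the convolution converges
    -- absolutely and acts componentwise.
    rcases eq_or_ne (w x) 0 with h0 | h0
    · simp [h0]
    · have hne : ∫⁻ z, ‖V z‖ₑ * ‖densityGrad w γ (x - z)‖ₑ ≠ ⊤ := fun htop => by
        simp only [Pi.mul_apply] at hx
        rw [htop, ENNReal.mul_top (by simpa using h0)] at hx
        exact lt_irrefl _ hx
      rw [Finset.mul_sum]
      refine Finset.sum_congr rfl fun i _ => ?_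
      rw [spatialConv_apply_of_lintegral_ne_top hVm (integrable_densityGrad w γ).1 hne, mul_assoc]
  · intro i _
    refine integrable_mul_spatialConv hVm ?_ (hG i).1 (t2 i)
    exact hρ.1.mul (H.field i i).bdd.1.aestronglyMeasurable

end Multiplier

end FixedTime

/-! ### Removing the regularisation of the field -/

section RadialLimit

variable {n : ℕ} {p₁ p₂ r : ℝ≥0∞} {V : EuclideanSpace ℝ (Fin n) → ℝ}

/-- At the origin both sides are 0, by the convention `0⁻¹ = 0`; elsewhere `√(|x|² + ε²) → |x|`. -/
theorem tendsto_radialField (i : Fin n) (x : EuclideanSpace ℝ (Fin n)) :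
    Tendsto (fun k : ℕ => radialField (1 / ((k : ℝ) + 1)) i x) atTop (𝓝 (‖x‖⁻¹ * x i)) := by
  rcases eq_or_ne x 0 with rfl | hx
  · simp [radialField]
  have h1 : Tendsto (fun k : ℕ => √(‖x‖ ^ 2 + (1 / ((k : ℝ) + 1)) ^ 2)) atTop (𝓝 ‖x‖) := by
    have h0 := ((tendsto_one_div_add_atTop_nhds_zero_nat (𝕜 := ℝ)).pow 2).const_add (‖x‖ ^ 2)
    have := h0.sqrt
    simpa using this
  have h2 := (h1.inv₀ (norm_ne_zero_iff.2 hx)).const_mul (x i)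
  rw [mul_comm] at h2
  exact h2

/-- The Morawetz multiplier `h·∇ + (div h)/2` applied to `w`, for the radial field `h`
regularised at scale `1/(k+1)` and `γ = ∇w`. -/
def radialMultiplier (hn : 3 ≤ n) (k : ℕ) (w : LTwo n) (γ : LTwoVec n) : LTwo n :=
  (isMorawetzField_radial hn (Nat.one_div_pos_of_nat (α := ℝ) (n := k))).multiplier
    (fun i => gradComp i γ) w

theorem norm_radialMultiplier_le (hn : 3 ≤ n) (k : ℕ) {w : LTwo n} {γ : LTwoVec n}
    (hγ : IsWeakGradient w γ) : ‖radialMultiplier hn k w γ‖ ≤ ‖γ‖ :=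
  IsMorawetzField.norm_multiplier_le _ hγ

/-- The pairing equals `-∫ |w|² h·(V * ∇|w|²)`, where only the bounded field depends on the
regularisation; `|h| ≤ 1` gives the dominating function `|w|² |V * ∇|w|²|`. -/
theorem tendsto_inner_radialMultiplier (hn : 3 ≤ n) (hV : IsHartreePotential n p₁ p₂ V)
    (hr : r⁻¹ + (3 * p₂)⁻¹ = 2⁻¹) {w : LTwo n} (hw : cubeNorm r w < ⊤) {γ : LTwoVec n}
    (hγ : IsWeakGradient w γ) :
    Tendsto (fun k => 2 * inner ℝ (hartreeLp V w) (radialMultiplier hn k w γ)) atTop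
      (𝓝 (-∫ x, morawetzDensity V w x)) := by
  have hc : AEStronglyMeasurable (spatialConv V (densityGrad w γ)) :=
    aestronglyMeasurable_spatialConv hV.aestronglyMeasurable (integrable_densityGrad w γ).1
  have key : Tendsto (fun k : ℕ => ∫ x, ‖w x‖ ^ 2 * ∑ i,
      radialField (1 / ((k : ℝ) + 1)) i x * spatialConv V (densityGrad w γ) x i) atTop
      (𝓝 (∫ x, morawetzDensity V w x)) := by
    refine tendsto_integral_of_dominated_convergence
      (fun x => ‖w x‖ ^ 2 * ‖spatialConv V (densityGrad w γ) x‖) (fun k => ?_)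
      (integrable_norm_sq_mul_norm_spatialConv hV hr hw γ)
      (fun k => ae_of_all _ fun x => ?_) (ae_of_all _ fun x => ?_)
    · have H := isMorawetzField_radial hn (Nat.one_div_pos_of_nat (α := ℝ) (n := k))
      refine ((Lp.memLp w).1.norm.pow 2).mul
        (Finset.aestronglyMeasurable_fun_sum _ fun i _ => ?_)
      exact (H.field i i).bdd.1.aestronglyMeasurable.mul
        ((EuclideanSpace.proj (𝕜 := ℝ) i).continuous.comp_aestronglyMeasurable hc)
    · have H := isMorawetzField_radial hn (Nat.one_div_pos_of_nat (α := ℝ) (n := k))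
      rw [norm_mul, norm_pow, norm_norm, Real.norm_eq_abs]
      exact mul_le_mul_of_nonneg_left (H.abs_sum_mul_le x _) (sq_nonneg _)
    · rw [hγ.morawetzDensity_eq]
      refine Tendsto.const_mul _ ?_
      have e : inner ℝ (‖x‖⁻¹ • x) (spatialConv V (densityGrad w γ) x) =
          ∑ i, (‖x‖⁻¹ * x i) * spatialConv V (densityGrad w γ) x i := by
        simp [PiLp.inner_apply, mul_comm]
      rw [e]
      exact tendsto_finsetSum _ fun i _ => (tendsto_radialField i x).mul_const _
  refine key.neg.congr fun k => ?_
  have H := isMorawetzField_radial hn (Nat.one_div_pos_of_nat (α := ℝ) (n := k))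
  have hs : ∀ i, ContDiff ℝ ∞ (radialField (n := n) (1 / ((k : ℝ) + 1)) i) := fun i =>
    (EuclideanSpace.proj (𝕜 := ℝ) i).contDiff.mul (contDiff_invRadius Nat.one_div_pos_of_nat)
  rw [H.integral_norm_sq_mul_sum hs hV hr hw hγ, neg_neg]
  rfl

end RadialLimit

/-! ### Integration in time and passage to the supremum norms -/

section TimeIntegral

variable {n : ℕ} {p₁ p₂ r : ℝ≥0∞} {V : EuclideanSpace ℝ (Fin n) → ℝ}
  {u u' : ℝ → LTwo n} {g : ℝ → LTwoVec n} {s t : ℝ}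

namespace IsFiniteEnergySolution

theorem lintegral_lintegral_morawetzDensity_lt_top (hu : IsFiniteEnergySolution p₂ V u u' g)
    (hV : IsHartreePotential n p₁ p₂ V) (s t : ℝ) :
    ∫⁻ τ in Icc s t, ∫⁻ x, ‖morawetzDensity V (u τ) x‖ₑ < ⊤ := by
  obtain ⟨r, hr⟩ := hV.exists_exponent
  obtain ⟨C, hC, h⟩ := hV.exists_triform_densityGrad_le hr
  have hcont : Continuous fun τ => ∑ i, ‖gradComp i (g τ)‖ := continuous_finsetSum _ fun i _ =>
    (hu.continuous_gradComp i).norm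
  obtain ⟨M, hM⟩ := isCompact_Icc.exists_bound_of_continuousOn (hcont.continuousOn (s := Icc s t))
  calc ∫⁻ τ in Icc s t, ∫⁻ x, ‖morawetzDensity V (u τ) x‖ₑ
      ≤ ∫⁻ τ in Icc s t, C * cubeNorm r (u τ) * ENNReal.ofReal M := by
        refine setLIntegral_mono (((measurable_cubeNorm r hu.continuous).const_mul C).mul_const _)
          fun τ hτ => ?_
        refine (lintegral_morawetzDensity_le hV.aestronglyMeasurable (hu.isWeakGradient τ)).trans
          ((h _ _).trans ?_)
        gcongr
        have e : ∑ i, ‖gradComp i (g τ)‖ₑ = ENNReal.ofReal (∑ i, ‖gradComp i (g τ)‖) := by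
          rw [ENNReal.ofReal_sum_of_nonneg fun _ _ => norm_nonneg _]
          simp only [ofReal_norm]
        rw [e]
        exact ENNReal.ofReal_le_ofReal ((le_abs_self _).trans (hM τ hτ))
    _ < ⊤ := by
        rw [lintegral_mul_const _ ((measurable_cubeNorm r hu.continuous).const_mul C),
          lintegral_const_mul _ (measurable_cubeNorm r hu.continuous)]
        exact ENNReal.mul_lt_top (ENNReal.mul_lt_top hC.lt_top
          (hu.lintegral_cubeNorm_lt_top hr s t)) ENNReal.ofReal_lt_top

/-- Uniformity in `k` comes from the Hardy bound, whose constant does not see the regularisation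
even though the divergence blows up at the origin as `k → ∞`. -/
theorem exists_dominating (hu : IsFiniteEnergySolution p₂ V u u' g)
    (hV : IsHartreePotential n p₁ p₂ V) (hn : 3 ≤ n) (hst : s ≤ t) :
    ∃ b : ℝ → ℝ, IntervalIntegrable b volume s t ∧ ∀ τ ∈ Icc s t, ∀ k,
      ‖2 * inner ℝ (hartreeLp V (u τ)) (radialMultiplier hn k (u τ) (g τ))‖ ≤ b τ := by
  obtain ⟨M, hM⟩ := isCompact_Icc.exists_bound_of_continuousOn
    (hu.continuous_grad.continuousOn (s := Icc s t))
  refine ⟨fun τ => 2 * (‖hartreeLp V (u τ)‖ * M),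
    ((hu.intervalIntegrable_hartreeLp hV hst).norm.mul_const M).const_mul 2, fun τ hτ k => ?_⟩
  rw [norm_mul, Real.norm_two]
  refine mul_le_mul_of_nonneg_left ((norm_inner_le_norm _ _).trans ?_) zero_le_two
  exact mul_le_mul_of_nonneg_left
    ((norm_radialMultiplier_le hn k (hu.isWeakGradient τ)).trans (hM τ hτ)) (norm_nonneg _)

theorem ae_tendsto_inner (hu : IsFiniteEnergySolution p₂ V u u' g)
    (hV : IsHartreePotential n p₁ p₂ V) (hn : 3 ≤ n) (s t : ℝ) :
    ∀ᵐ τ ∂(volume.restrict (Icc s t)),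
      Tendsto (fun k => 2 * inner ℝ (hartreeLp V (u τ)) (radialMultiplier hn k (u τ) (g τ))) atTop
        (𝓝 (-∫ x, morawetzDensity V (u τ) x)) := by
  obtain ⟨r, hr⟩ := hV.exists_exponent
  filter_upwards [hu.ae_cubeNorm_lt_top hr s t] with τ hτ
  exact tendsto_inner_radialMultiplier hn hV hr hτ (hu.isWeakGradient τ)

theorem aestronglyMeasurable_inner (hu : IsFiniteEnergySolution p₂ V u u' g)
    (hV : IsHartreePotential n p₁ p₂ V) (hn : 3 ≤ n) (s t : ℝ) (k : ℕ) :
    AEStronglyMeasurable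
      (fun τ => 2 * inner ℝ (hartreeLp V (u τ)) (radialMultiplier hn k (u τ) (g τ)))
      (volume.restrict (Icc s t)) :=
  ((hu.integrableOn_hartreeLp hV s t).1.inner
    (hu.continuous_multiplier _).aestronglyMeasurable).const_mul 2

/-- Measurability in time is obtained from the limit of the multiplier pairings, which are
measurable as inner products of `L²`-valued curves; no joint measurability of the density in `(τ,
x)` is needed. -/
theorem intervalIntegrable_integral_morawetzDensity (hu : IsFiniteEnergySolution p₂ V u u' g)
    (hV : IsHartreePotential n p₁ p₂ V) (hn : 3 ≤ n) (hst : s ≤ t) :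
    IntervalIntegrable (fun τ => ∫ x, morawetzDensity V (u τ) x) volume s t := by
  obtain ⟨b, hb, hle⟩ := hu.exists_dominating hV hn hst
  have hlim := hu.ae_tendsto_inner hV hn s t
  have hm : AEStronglyMeasurable (fun τ => -∫ x, morawetzDensity V (u τ) x)
      (volume.restrict (Icc s t)) :=
    aestronglyMeasurable_of_tendsto_ae atTop (hu.aestronglyMeasurable_inner hV hn s t) hlim
  rw [intervalIntegrable_iff_integrableOn_Icc_of_le hst] at hb ⊢
  have hneg : Integrable (fun τ => -∫ x, morawetzDensity V (u τ) x)
      (volume.restrict (Icc s t)) := by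
    refine Integrable.mono' hb hm ?_
    filter_upwards [hlim, ae_restrict_mem measurableSet_Icc] with τ h1 h2
    exact le_of_tendsto h1.norm (Eventually.of_forall (hle τ h2))
  simpa only [IntegrableOn, neg_neg] using hneg.fun_neg

/-- The limit in `k` of the multiplier inequality; the factor 2 is the one from `∇|u|² = 2 Re(ū
∇u)`. -/
theorem neg_integral_morawetzDensity_le (hu : IsFiniteEnergySolution p₂ V u u' g)
    (hV : IsHartreePotential n p₁ p₂ V) (hn : 3 ≤ n) (hst : s ≤ t) :
    -∫ τ in s..t, ∫ x, morawetzDensity V (u τ) x ≤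
      2 * (‖u' s‖ * ‖g s‖ + ‖u' t‖ * ‖g t‖) := by
  obtain ⟨b, hb, hle⟩ := hu.exists_dominating hV hn hst
  rw [← intervalIntegral.integral_neg]
  have hlim : Tendsto (fun k => ∫ τ in s..t,
      2 * inner ℝ (hartreeLp V (u τ)) (radialMultiplier hn k (u τ) (g τ))) atTop
      (𝓝 (∫ τ in s..t, -∫ x, morawetzDensity V (u τ) x)) := by
    simp only [intervalIntegral.integral_of_le hst]
    rw [intervalIntegrable_iff_integrableOn_Ioc_of_le hst] at hb
    refine tendsto_integral_of_dominated_convergence b (fun k => ?_) hb (fun k => ?_) ?_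
    · exact (hu.aestronglyMeasurable_inner hV hn s t k).mono_measure
        (Measure.restrict_mono Ioc_subset_Icc_self le_rfl)
    · filter_upwards [ae_restrict_mem measurableSet_Ioc] with τ hτ
      exact hle τ (Ioc_subset_Icc_self hτ) k
    · exact ae_restrict_of_ae_restrict_of_subset Ioc_subset_Icc_self
        (hu.ae_tendsto_inner hV hn s t)
  refine le_of_tendsto hlim (Eventually.of_forall fun k => ?_)
  rw [intervalIntegral.integral_const_mul]
  exact mul_le_mul_of_nonneg_left (hu.integral_inner_multiplier_le hV
    (isMorawetzField_radial hn (Nat.one_div_pos_of_nat (α := ℝ) (n := k))) hst) zero_le_two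

end IsFiniteEnergySolution

/-- The inequality holds on a dense subset of the open interval and is a closed condition, so it
extends to the endpoints, where it is used. For `s = t` it fails, the restricted measure being zero.
-/
theorem Continuous.enorm_le_eLpNorm_top_Icc {F : Type*} [NormedAddCommGroup F] {f : ℝ → F}
    (hf : Continuous f) (hst : s < t) {τ : ℝ} (hτ : τ ∈ Icc s t) :
    ‖f τ‖ₑ ≤ eLpNorm f ⊤ (volume.restrict (Icc s t)) := by
  have hae : ∀ᵐ x ∂(volume.restrict (Icc s t)),
      ‖f x‖ₑ ≤ eLpNorm f ⊤ (volume.restrict (Icc s t)) := by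
    simpa only [eLpNorm_exponent_top] using
      enorm_ae_le_eLpNormEssSup f (volume.restrict (Icc s t))
  rw [ae_restrict_iff' measurableSet_Icc] at hae
  have hd := Measure.dense_of_ae hae
  have hcl : IsClosed {x | ‖f x‖ₑ ≤ eLpNorm f ⊤ (volume.restrict (Icc s t))} :=
    isClosed_le hf.enorm continuous_const
  have h1 : Icc s t ⊆ closure (Ioo s t ∩
      {x | x ∈ Icc s t → ‖f x‖ₑ ≤ eLpNorm f ⊤ (volume.restrict (Icc s t))}) := by
    refine (closure_Ioo hst.ne).symm.subset.trans ?_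
    exact closure_minimal (hd.open_subset_closure_inter isOpen_Ioo) isClosed_closure
  refine hcl.closure_subset_iff.2 ?_ (h1 hτ)
  exact fun x hx => hx.2 (Ioo_subset_Icc_self hx.1)

end TimeIntegral

end

/-! ### The Morawetz inequality -/

theorem mainTheorem10 (n : ℕ) (hn : 3 ≤ n) (p₁ p₂ : ℝ≥0∞)
    (V : EuclideanSpace ℝ (Fin n) → ℝ) (hV : IsHartreePotential n p₁ p₂ V)
    (u u' : ℝ → Lp ℂ 2 (volume : Measure (EuclideanSpace ℝ (Fin n))))
    (g : ℝ → Lp (EuclideanSpace ℂ (Fin n)) 2 (volume : Measure (EuclideanSpace ℝ (Fin n))))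
    (hu : IsFiniteEnergySolution p₂ V u u' g) (s t : ℝ) (hst : s ≤ t) :
    (∀ᵐ τ ∂(volume.restrict (Icc s t)), Integrable (morawetzDensity V (u τ)) volume) ∧
    (∫⁻ τ in Icc s t, ∫⁻ x, ‖morawetzDensity V (u τ) x‖ₑ) < ⊤ ∧
    IntervalIntegrable (fun τ => ∫ x, morawetzDensity V (u τ) x) volume s t ∧
    ENNReal.ofReal (- ∫ τ in s..t, ∫ x, morawetzDensity V (u τ) x) ≤
      4 * eLpNorm u' ⊤ (volume.restrict (Icc s t)) * eLpNorm g ⊤ (volume.restrict (Icc s t)) := by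
  obtain ⟨r, hr⟩ := hV.exists_exponent
  refine ⟨?_, hu.lintegral_lintegral_morawetzDensity_lt_top hV s t,
    hu.intervalIntegrable_integral_morawetzDensity hV hn hst, ?_⟩
  · filter_upwards [hu.ae_cubeNorm_lt_top hr s t] with τ hτ
    exact integrable_morawetzDensity hV hr hτ (hu.isWeakGradient τ)
  -- When `s = t` the essential suprema vanish, but so does the time integral.
  rcases hst.eq_or_lt with rfl | hlt
  · simp
  have bu : ∀ τ ∈ Icc s t, ‖u' τ‖ₑ ≤ _ := fun τ hτ =>
    hu.continuous_deriv.enorm_le_eLpNorm_top_Icc hlt hτ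
  have bg : ∀ τ ∈ Icc s t, ‖g τ‖ₑ ≤ _ := fun τ hτ =>
    hu.continuous_grad.enorm_le_eLpNorm_top_Icc hlt hτ
  have hs := left_mem_Icc.2 hst
  have ht := right_mem_Icc.2 hst
  set A := eLpNorm u' ⊤ (volume.restrict (Icc s t))
  set B := eLpNorm g ⊤ (volume.restrict (Icc s t))
  calc ENNReal.ofReal (- ∫ τ in s..t, ∫ x, morawetzDensity V (u τ) x)
      ≤ ENNReal.ofReal (2 * (‖u' s‖ * ‖g s‖ + ‖u' t‖ * ‖g t‖)) :=
        ENNReal.ofReal_le_ofReal (hu.neg_integral_morawetzDensity_le hV hn hst)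
    _ = 2 * (‖u' s‖ₑ * ‖g s‖ₑ + ‖u' t‖ₑ * ‖g t‖ₑ) := by
        rw [ENNReal.ofReal_mul zero_le_two, ENNReal.ofReal_add (by positivity) (by positivity),
          ENNReal.ofReal_mul (norm_nonneg _), ENNReal.ofReal_mul (norm_nonneg _)]
        simp only [ofReal_norm, ENNReal.ofReal_ofNat]
    _ ≤ 2 * (A * B + A * B) := by
        gcongr
        exacts [bu s hs, bg s hs, bu t ht, bg t ht]
    _ = 4 * A * B := by ring
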